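/- Let $V$ be a finite-dimensional complex vector space, $\Lambda\subset V$ a lattice, $X=V/\Lambda$ the corresponding complex torus, and $\mathcal L$ a holomorphic line bundle on $X$. Let $H$ be the Hermitian form on $V$ for which $E_H=\operatorname{Im}H$ is the first Chern class of $\mathcal L$, $c_1(\mathcal L)=\frac{i}{2\pi}[F_\nabla]$. An $E_H$-flat connection on the underlying complex line bundle $\mathcal L$ is a smooth connection $\nabla$ that is compatible with some Hermitian structure on $\mathcal L$ and whose curvature form $F_\nabla$ is translation-invariant. Let $\mathcal T$ be the set of $E_H$-flat connections on the complex line bundle $\mathcal L$ modulo automorphisms of this bundle (smooth gauge transformations $X\to\mathbb C^*$). Let $\operatorname{Pic}^0(X)$ be the group of isomorphism classes of topologically trivial holomorphic line bundles on $X$. (1) Sending a class in $H^1(X,U(1))$ to the holomorphic line bundle with the same locally constant transition functions is a group isomorphism $H^1(X,U(1))\cong\operatorname{Pic}^0(X)$. Moreover, $\mathcal T$ is a (non-empty) torsor over $\operatorname{Pic}^0(X)$ under tensoring with flat bundles: if $\ell\in H^1(X,U(1))$ and $(\mathcal L_\ell,\nabla_\ell)$ is the associated flat $U(1)$-bundle,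 then $\ell\cdot[\nabla]=[\nabla']$ if and only if $(\mathcal L_\ell\otimes\mathcal L,\nabla_\ell\otimes\nabla)\cong(\mathcal L,\nabla')$ as smooth complex line bundles with connection. (2) There is exactly one $E_H$-flat connection $\nabla$ on $\mathcal L$ that is compatible with the holomorphic structure, that is, with $\nabla^{0,1}=\bar\partial_{\mathcal L}$. -/

import Mathlib

open Topology Filter
open scoped ContDiff ComplexConjugate

universe u v

/-! ### Čech `H¹` with values in a sheaf of multiplicative groups of `ℂˣ`-valued functions -/

/-- A sheaf of multiplicative groups of nowhere vanishing complex functions on `X`, described by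
its germs: `mem f x` says that `f` is a section near `x`, and a section over an open set `W` is a
function with `mem f x` for all `x ∈ W`. -/
structure UnitSheaf (X : Type u) [TopologicalSpace X] where
  mem : (X → ℂ) → X → Prop
  congr : ∀ {f g : X → ℂ} {x : X}, f =ᶠ[𝓝 x] g → mem f x → mem g x
  ne_zero : ∀ {f : X → ℂ} {x : X}, mem f x → f x ≠ 0
  one : ∀ x : X, mem (fun _ => 1) x
  mul : ∀ {f g : X → ℂ} {x : X}, mem f x → mem g x → mem (fun y => f y * g y) x
  inv : ∀ {f : X → ℂ} {x : X}, mem f x → mem (fun y => (f y)⁻¹) x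

/-- Inclusion of one sheaf of units in another. -/
instance {X : Type u} [TopologicalSpace X] : LE (UnitSheaf X) where
  le S T := ∀ (f : X → ℂ) (x : X), S.mem f x → T.mem f x

/-- A Čech `1`-cocycle of the sheaf `S` on an open cover of `X`, i.e. the transition functions of
a line bundle. A section of that bundle is a family of functions `s i` on the sets `U i` with
`s i = g i j * s j` on the overlaps. (Values outside the overlaps are irrelevant.) -/
structure CechCocycle {X : Type u} [TopologicalSpace X] (S : UnitSheaf X) where
  ι : Type u
  U : ι → Set X
  isOpen_U : ∀ i, IsOpen (U i)
  cover : ∀ x, ∃ i, x ∈ U i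
  g : ι → ι → X → ℂ
  mem_g : ∀ i j x, x ∈ U i → x ∈ U j → S.mem (g i j) x
  cocycle : ∀ i j k x, x ∈ U i → x ∈ U j → x ∈ U k → g i j x * g j k x = g i k x

namespace CechCocycle

variable {X : Type u} [TopologicalSpace X] {S T : UnitSheaf X}

/-- `f` is an isomorphism between the bundles given by `d` and `c`, possibly on different covers:
the section `t` of `d` corresponds to the section `s` of `c` with `s a = f a b * t b`. -/
structure IsIsoData (c d : CechCocycle S) (f : c.ι → d.ι → X → ℂ) : Prop where
  mem_f : ∀ a b x, x ∈ c.U a → x ∈ d.U b → S.mem (f a b) x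
  comm : ∀ a a' b b' x, x ∈ c.U a → x ∈ c.U a' → x ∈ d.U b → x ∈ d.U b' →
    f a b x * d.g b b' x = c.g a a' x * f a' b' x

/-- Two cocycles are equivalent if they define isomorphic bundles (they are cohomologous on a
common refinement). -/
def IsIso (c d : CechCocycle S) : Prop := ∃ f, IsIsoData c d f

theorem g_self (c : CechCocycle S) (i : c.ι) (x : X) (hx : x ∈ c.U i) : c.g i i x = 1 := by
  have h := c.cocycle i i i x hx hx hx
  have h0 := S.ne_zero (c.mem_g i i x hx hx)
  exact mul_left_cancel₀ h0 (by rw [h, mul_one])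

theorem IsIso.refl (c : CechCocycle S) : IsIso c c :=
  ⟨c.g, c.mem_g, fun a a' b b' x ha ha' hb hb' => by
    rw [c.cocycle a b b' x ha hb hb', c.cocycle a a' b' x ha ha' hb']⟩

theorem IsIso.symm {c d : CechCocycle S} (h : IsIso c d) : IsIso d c := by
  obtain ⟨f, hf⟩ := h
  refine ⟨fun b a x => (f a b x)⁻¹, fun b a x hb ha => S.inv (hf.mem_f a b x ha hb), ?_⟩
  intro b b' a a' x hb hb' ha ha'
  have h1 := S.ne_zero (hf.mem_f a b x ha hb)
  have h2 := S.ne_zero (hf.mem_f a' b' x ha' hb')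
  have h := hf.comm a a' b b' x ha ha' hb hb'
  field_simp
  linear_combination -h

open Classical in
theorem IsIso.trans {c d e : CechCocycle S} (h : IsIso c d) (h' : IsIso d e) : IsIso c e := by
  obtain ⟨f, hf⟩ := h
  obtain ⟨k, hk⟩ := h'
  choose b hb using d.cover
  have key : ∀ a z β β' x, x ∈ c.U a → x ∈ e.U z → x ∈ d.U β → x ∈ d.U β' →
      f a β x * k β z x = f a β' x * k β' z x := by
    intro a z β β' x ha hz hβ hβ'
    have h1 := hf.comm a a β β' x ha ha hβ hβ'
    have h2 := hk.comm β β' z z x hβ hβ' hz hz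
    rw [c.g_self a x ha] at h1
    rw [e.g_self z x hz] at h2
    linear_combination (f a β x) * h2 + (k β' z x) * h1
  refine ⟨fun a z x => f a (b x) x * k (b x) z x, ?_, ?_⟩
  · intro a z x ha hz
    refine S.congr ?_ (S.mul (hf.mem_f a (b x) x ha (hb x)) (hk.mem_f (b x) z x (hb x) hz))
    filter_upwards [(c.isOpen_U a).mem_nhds ha, (e.isOpen_U z).mem_nhds hz,
      (d.isOpen_U (b x)).mem_nhds (hb x)] with y h1 h2 h3
    exact key a z _ _ y h1 h2 h3 (hb y)
  · intro a a' z z' x ha ha' hz hz'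
    have h1 := hf.comm a a' (b x) (b x) x ha ha' (hb x) (hb x)
    have h2 := hk.comm (b x) (b x) z z' x (hb x) (hb x) hz hz'
    rw [d.g_self _ x (hb x)] at h1 h2
    linear_combination (f a (b x) x) * h2 + (k (b x) z' x) * h1

instance setoid (S : UnitSheaf X) : Setoid (CechCocycle S) where
  r := IsIso
  iseqv := ⟨IsIso.refl, IsIso.symm, IsIso.trans⟩

/-- The trivial bundle. -/
def triv (S : UnitSheaf X) : CechCocycle S where
  ι := PUnit
  U _ := Set.univ
  isOpen_U _ := isOpen_univ
  cover _ := ⟨PUnit.unit, trivial⟩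
  g _ _ _ := 1
  mem_g _ _ x _ _ := S.one x
  cocycle _ _ _ _ _ _ _ := one_mul 1

/-- The tensor product of two bundles. -/
def tensor (c d : CechCocycle S) : CechCocycle S where
  ι := c.ι × d.ι
  U p := c.U p.1 ∩ d.U p.2
  isOpen_U p := (c.isOpen_U p.1).inter (d.isOpen_U p.2)
  cover x := by
    obtain ⟨i, hi⟩ := c.cover x
    obtain ⟨j, hj⟩ := d.cover x
    exact ⟨(i, j), hi, hj⟩
  g p q x := c.g p.1 q.1 x * d.g p.2 q.2 x
  mem_g p q x hp hq := S.mul (c.mem_g _ _ x hp.1 hq.1) (d.mem_g _ _ x hp.2 hq.2)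
  cocycle p q r x hp hq hr := by
    rw [← c.cocycle _ _ _ x hp.1 hq.1 hr.1, ← d.cocycle _ _ _ x hp.2 hq.2 hr.2]
    ring

/-- The dual bundle. -/
noncomputable def dual (c : CechCocycle S) : CechCocycle S where
  ι := c.ι
  U := c.U
  isOpen_U := c.isOpen_U
  cover := c.cover
  g i j x := (c.g i j x)⁻¹
  mem_g i j x hi hj := S.inv (c.mem_g i j x hi hj)
  cocycle i j k x hi hj hk := by rw [← c.cocycle i j k x hi hj hk, mul_inv]

/-- The same transition functions, regarded as sections of a larger sheaf. -/
def map (h : S ≤ T) (c : CechCocycle S) : CechCocycle T where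
  ι := c.ι
  U := c.U
  isOpen_U := c.isOpen_U
  cover := c.cover
  g := c.g
  mem_g i j x hi hj := h _ _ (c.mem_g i j x hi hj)
  cocycle := c.cocycle

theorem tensor_congr {c c' d d' : CechCocycle S} (h : IsIso c c') (h' : IsIso d d') :
    IsIso (c.tensor d) (c'.tensor d') := by
  obtain ⟨f, hf⟩ := h
  obtain ⟨k, hk⟩ := h'
  refine ⟨fun p q x => f p.1 q.1 x * k p.2 q.2 x,
    fun p q x hp hq => S.mul (hf.mem_f _ _ x hp.1 hq.1) (hk.mem_f _ _ x hp.2 hq.2), ?_⟩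
  intro p p' q q' x hp hp' hq hq'
  have h1 := hf.comm _ _ _ _ x hp.1 hp'.1 hq.1 hq'.1
  have h2 := hk.comm _ _ _ _ x hp.2 hp'.2 hq.2 hq'.2
  simp only [tensor]
  linear_combination (k p.2 q.2 x * d'.g q.2 q'.2 x) * h1 +
    (c.g p.1 p'.1 x * f p'.1 q'.1 x) * h2

theorem dual_congr {c d : CechCocycle S} (h : IsIso c d) : IsIso c.dual d.dual := by
  obtain ⟨f, hf⟩ := h
  refine ⟨fun a b x => (f a b x)⁻¹, fun a b x ha hb => S.inv (hf.mem_f a b x ha hb), ?_⟩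
  intro a a' b b' x ha ha' hb hb'
  simp only [dual]
  rw [← mul_inv, hf.comm a a' b b' x ha ha' hb hb', mul_inv]

theorem map_congr (h : S ≤ T) {c d : CechCocycle S} (hcd : IsIso c d) :
    IsIso (c.map h) (d.map h) := by
  obtain ⟨f, hf⟩ := hcd
  exact ⟨f, fun a b x ha hb => h _ _ (hf.mem_f a b x ha hb), hf.comm⟩

end CechCocycle

/-- The Čech cohomology group `H¹(X, S)`: isomorphism classes of the bundles with transition
functions in `S`; the group law is the tensor product. -/
def CechH1 {X : Type u} [TopologicalSpace X] (S : UnitSheaf X) : Type (u + 1) :=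
  Quotient (CechCocycle.setoid S)

namespace CechH1

variable {X : Type u} [TopologicalSpace X] {S T : UnitSheaf X}

/-- The class of a cocycle. -/
def mk (c : CechCocycle S) : CechH1 S := Quotient.mk _ c

noncomputable instance : CommGroup (CechH1 S) where
  one := mk (CechCocycle.triv S)
  mul := Quotient.map₂ CechCocycle.tensor fun _ _ h _ _ h' => CechCocycle.tensor_congr h h'
  inv := Quotient.map CechCocycle.dual fun _ _ h => CechCocycle.dual_congr h
  mul_assoc := by
    rintro ⟨c⟩ ⟨d⟩ ⟨e⟩
    refine Quotient.sound ⟨fun p q x => c.g p.1.1 q.1 x * (d.g p.1.2 q.2.1 x * e.g p.2 q.2.2 x),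
      fun p q x hp hq => S.mul (c.mem_g _ _ x hp.1.1 hq.1)
        (S.mul (d.mem_g _ _ x hp.1.2 hq.2.1) (e.mem_g _ _ x hp.2 hq.2.2)), ?_⟩
    intro p p' q q' x hp hp' hq hq'
    have h1 := c.cocycle _ _ _ x hp.1.1 hq.1 hq'.1
    have h1' := c.cocycle _ _ _ x hp.1.1 hp'.1.1 hq'.1
    have h2 := d.cocycle _ _ _ x hp.1.2 hq.2.1 hq'.2.1
    have h2' := d.cocycle _ _ _ x hp.1.2 hp'.1.2 hq'.2.1
    have h3 := e.cocycle _ _ _ x hp.2 hq.2.2 hq'.2.2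
    have h3' := e.cocycle _ _ _ x hp.2 hp'.2 hq'.2.2
    simp only [CechCocycle.tensor]
    calc _ = (c.g p.1.1 q.1 x * c.g q.1 q'.1 x) * (d.g p.1.2 q.2.1 x * d.g q.2.1 q'.2.1 x) *
          (e.g p.2 q.2.2 x * e.g q.2.2 q'.2.2 x) := by ring
      _ = _ := by rw [h1, h2, h3, ← h1', ← h2', ← h3']; ring
  one_mul := by
    rintro ⟨c⟩
    refine Quotient.sound ⟨fun p q x => c.g p.2 q x,
      fun p q x hp hq => c.mem_g _ _ x hp.2 hq, ?_⟩
    intro p p' q q' x hp hp' hq hq'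
    simp only [CechCocycle.tensor, CechCocycle.triv, one_mul]
    rw [c.cocycle _ _ _ x hp.2 hq hq', c.cocycle _ _ _ x hp.2 hp'.2 hq']
  mul_one := by
    rintro ⟨c⟩
    refine Quotient.sound ⟨fun p q x => c.g p.1 q x,
      fun p q x hp hq => c.mem_g _ _ x hp.1 hq, ?_⟩
    intro p p' q q' x hp hp' hq hq'
    simp only [CechCocycle.tensor, CechCocycle.triv, mul_one]
    rw [c.cocycle _ _ _ x hp.1 hq hq', c.cocycle _ _ _ x hp.1 hp'.1 hq']
  inv_mul_cancel := by
    rintro ⟨c⟩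
    refine Quotient.sound ⟨fun p _ x => c.g p.2 p.1 x,
      fun p q x hp hq => c.mem_g _ _ x hp.2 hp.1, ?_⟩
    intro p p' q q' x hp hp' hq hq'
    simp only [CechCocycle.tensor, CechCocycle.triv, CechCocycle.dual, mul_one]
    have h0 := S.ne_zero (c.mem_g _ _ x hp.1 hp'.1)
    have h1 := c.cocycle _ _ _ x hp.2 hp.1 hp'.1
    have h2 := c.cocycle _ _ _ x hp.2 hp'.2 hp'.1
    field_simp
    rw [h1, h2]
  mul_comm := by
    rintro ⟨c⟩ ⟨d⟩
    refine Quotient.sound ⟨fun p q x => c.g p.1 q.2 x * d.g p.2 q.1 x,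
      fun p q x hp hq => S.mul (c.mem_g _ _ x hp.1 hq.2) (d.mem_g _ _ x hp.2 hq.1), ?_⟩
    intro p p' q q' x hp hp' hq hq'
    have h1 := c.cocycle _ _ _ x hp.1 hq.2 hq'.2
    have h1' := c.cocycle _ _ _ x hp.1 hp'.1 hq'.2
    have h2 := d.cocycle _ _ _ x hp.2 hq.1 hq'.1
    have h2' := d.cocycle _ _ _ x hp.2 hp'.2 hq'.1
    simp only [CechCocycle.tensor]
    calc _ = (c.g p.1 q.2 x * c.g q.2 q'.2 x) * (d.g p.2 q.1 x * d.g q.1 q'.1 x) := by ring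
      _ = _ := by rw [h1, h2, ← h1', ← h2']; ring

/-- The homomorphism induced by an inclusion of sheaves. -/
noncomputable def map (h : S ≤ T) : CechH1 S →* CechH1 T where
  toFun := Quotient.map (CechCocycle.map h) fun _ _ hcd => CechCocycle.map_congr h hcd
  map_one' := rfl
  map_mul' := by
    rintro ⟨c⟩ ⟨d⟩
    rfl

end CechH1

/-! ### Complex tori -/

namespace ComplexTorus

section

variable {V : Type u} [NormedAddCommGroup V] [NormedSpace ℂ V] (Λ : Submodule ℤ V)

/-- The covering map `V → V ⧸ Λ`. -/
def proj : V → V ⧸ Λ := Submodule.Quotient.mk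

set_option linter.unusedSectionVars false in
theorem continuous_proj : Continuous (proj Λ) := continuous_quot_mk

variable {Λ}

/-- Smoothness at `x` of a function on an open neighbourhood of `x` in `V ⧸ Λ`, whose manifold
structure is the one for which `V → V ⧸ Λ` is a local diffeomorphism. -/
def SmoothAt {F : Type v} [NormedAddCommGroup F] [NormedSpace ℝ F] (f : V ⧸ Λ → F)
    (x : V ⧸ Λ) : Prop :=
  ∀ v : V, proj Λ v = x → ContDiffAt ℝ ∞ (fun w => f (proj Λ w)) v

theorem SmoothAt.congr {F : Type v} [NormedAddCommGroup F] [NormedSpace ℝ F] {f g : V ⧸ Λ → F}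
    {x : V ⧸ Λ} (h : f =ᶠ[𝓝 x] g) (hf : SmoothAt f x) : SmoothAt g x := by
  rintro v rfl
  exact (hf v rfl).congr_of_eventuallyEq
    ((continuous_proj Λ).continuousAt.tendsto.eventually h.symm)

variable (Λ)

/-- The sheaf of smooth `ℂˣ`-valued functions on `V ⧸ Λ`. -/
def smoothUnits : UnitSheaf (V ⧸ Λ) where
  mem f x := f x ≠ 0 ∧ SmoothAt f x
  congr h hf := ⟨h.self_of_nhds ▸ hf.1, hf.2.congr h⟩
  ne_zero hf := hf.1
  one _ := ⟨one_ne_zero, fun _ _ => contDiffAt_const⟩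
  mul hf hg := ⟨mul_ne_zero hf.1 hg.1, fun v hv => (hf.2 v hv).mul (hg.2 v hv)⟩
  inv hf := ⟨inv_ne_zero hf.1, fun v hv => (hf.2 v hv).inv (by rw [hv]; exact hf.1)⟩

/-- The sheaf `𝒪ˣ` of nowhere vanishing holomorphic functions on `V ⧸ Λ`: smooth functions that
are complex differentiable at every point of their domain. -/
def holUnits : UnitSheaf (V ⧸ Λ) where
  mem f x := f x ≠ 0 ∧ SmoothAt f x ∧
    ∀ v : V, proj Λ v = x → DifferentiableAt ℂ (fun w => f (proj Λ w)) v
  congr {f g x} h hf := ⟨h.self_of_nhds ▸ hf.1, hf.2.1.congr h, by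
    rintro v rfl
    exact (hf.2.2 v rfl).congr_of_eventuallyEq
      ((continuous_proj Λ).continuousAt.tendsto.eventually h.symm)⟩
  ne_zero hf := hf.1
  one _ := ⟨one_ne_zero, fun _ _ => contDiffAt_const, fun _ _ => differentiableAt_const _⟩
  mul hf hg := ⟨mul_ne_zero hf.1 hg.1, fun v hv => (hf.2.1 v hv).mul (hg.2.1 v hv),
    fun v hv => (hf.2.2 v hv).mul (hg.2.2 v hv)⟩
  inv hf := ⟨inv_ne_zero hf.1, fun v hv => (hf.2.1 v hv).inv (by rw [hv]; exact hf.1),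
    fun v hv => (hf.2.2 v hv).inv (by rw [hv]; exact hf.1)⟩

/-- The constant sheaf `U(1)`: locally constant functions with values of modulus one. -/
def circleConst : UnitSheaf (V ⧸ Λ) where
  mem f x := ‖f x‖ = 1 ∧ ∀ᶠ y in 𝓝 x, f y = f x
  congr h hf := by
    have h0 := h.self_of_nhds
    refine ⟨h0 ▸ hf.1, ?_⟩
    filter_upwards [h, hf.2] with y h1 h2
    rw [← h1, h2, h0]
  ne_zero hf h0 := by simp [h0] at hf
  one _ := ⟨norm_one, Eventually.of_forall fun _ => rfl⟩
  mul hf hg := ⟨by rw [norm_mul, hf.1, hg.1, one_mul], by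
    filter_upwards [hf.2, hg.2] with y h1 h2
    rw [h1, h2]⟩
  inv hf := ⟨by rw [norm_inv, hf.1, inv_one], by
    filter_upwards [hf.2] with y h1
    rw [h1]⟩

theorem circleConst_eventuallyEq {f : V ⧸ Λ → ℂ} {v : V}
    (hf : (circleConst Λ).mem f (proj Λ v)) :
    (fun w => f (proj Λ w)) =ᶠ[𝓝 v] fun _ => f (proj Λ v) :=
  (continuous_proj Λ).continuousAt.tendsto.eventually hf.2

theorem holUnits_le : holUnits Λ ≤ smoothUnits Λ := fun _ _ h => ⟨h.1, h.2.1⟩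

theorem circleConst_le_hol : circleConst Λ ≤ holUnits Λ := by
  intro f x hf
  refine ⟨(circleConst Λ).ne_zero hf, ?_, ?_⟩
  · rintro v rfl
    exact contDiffAt_const.congr_of_eventuallyEq (circleConst_eventuallyEq Λ hf)
  · rintro v rfl
    exact (differentiableAt_const _).congr_of_eventuallyEq (circleConst_eventuallyEq Λ hf)

theorem circleConst_le_smooth : circleConst Λ ≤ smoothUnits Λ :=
  fun _ _ h => holUnits_le Λ _ _ (circleConst_le_hol Λ _ _ h)

/-- Complex (smooth) line bundles on `V ⧸ Λ`. -/
abbrev LineBundle := CechCocycle (smoothUnits Λ)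

/-- Holomorphic line bundles on `V ⧸ Λ`. -/
abbrev HolLineBundle := CechCocycle (holUnits Λ)

variable {Λ} in
/-- The underlying complex line bundle of a holomorphic line bundle. -/
abbrev toComplex (L : HolLineBundle Λ) : LineBundle Λ := L.map (holUnits_le Λ)

/-- The Picard group `Pic(V ⧸ Λ)` of isomorphism classes of holomorphic line bundles. -/
abbrev Pic := CechH1 (holUnits Λ)

/-- The subgroup `Pic⁰(V ⧸ Λ)` of the classes of topologically trivial line bundles. -/
noncomputable def Pic0 : Subgroup (Pic Λ) := (CechH1.map (holUnits_le Λ)).ker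

/-- The cohomology group `H¹(V ⧸ Λ, U(1))`. -/
abbrev H1Circle := CechH1 (circleConst Λ)

/-- The homomorphism `H¹(V ⧸ Λ, U(1)) → Pic(V ⧸ Λ)` that sends a `U(1)`-local system to the
holomorphic line bundle with the same (locally constant) transition functions. -/
noncomputable def flatToPic : H1Circle Λ →* Pic Λ := CechH1.map (circleConst_le_hol Λ)

/-! Differential forms on open subsets of `V ⧸ Λ` are functions with values in the alternating
forms on `V`: the tangent bundle of `V ⧸ Λ` is canonically trivial with fibre `V`, and the
translations of `V ⧸ Λ` act as the identity on this fibre. -/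

variable {Λ}

/-- The exterior derivative at `proj Λ v` of a `1`-form on an open neighbourhood of that point. -/
noncomputable def dOne (a : V ⧸ Λ → V →L[ℝ] ℂ) (v : V) : V [⋀^Fin 2]→L[ℝ] ℂ :=
  extDeriv (fun w => ContinuousAlternatingMap.ofSubsingleton ℝ V ℂ (0 : Fin 1) (a (proj Λ w))) v

/-- A smooth connection on a complex line bundle: in the trivialization over `U i` it is
`d + A i` with a smooth complex `1`-form `A i`. -/
structure Connection (c : LineBundle Λ) where
  A : c.ι → V ⧸ Λ → V →L[ℝ] ℂ
  smooth : ∀ i x, x ∈ c.U i → SmoothAt (A i) x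
  transform : ∀ i j v, proj Λ v ∈ c.U i → proj Λ v ∈ c.U j →
    A j (proj Λ v) = A i (proj Λ v) +
      (c.g i j (proj Λ v))⁻¹ • fderiv ℝ (fun w => c.g i j (proj Λ w)) v

namespace Connection

/-- `F` is the curvature form of `∇`: it is `d (A i)` on each `U i`. -/
def HasCurvature {c : LineBundle Λ} (D : Connection c)
    (F : V ⧸ Λ → V [⋀^Fin 2]→L[ℝ] ℂ) : Prop :=
  ∀ i v, proj Λ v ∈ c.U i → F (proj Λ v) = dOne (D.A i) v

/-- The tensor product of two line bundles with connection. -/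
noncomputable def tensor {c d : LineBundle Λ} (D : Connection c) (D' : Connection d) :
    Connection (c.tensor d) where
  A p x := D.A p.1 x + D'.A p.2 x
  smooth p x hx v hv := (D.smooth _ _ hx.1 v hv).add (D'.smooth _ _ hx.2 v hv)
  transform p q v hp hq := by
    have h1 := c.mem_g p.1 q.1 _ hp.1 hq.1
    have h2 := d.mem_g p.2 q.2 _ hp.2 hq.2
    have e1 : DifferentiableAt ℝ (fun w => c.g p.1 q.1 (proj Λ w)) v :=
      (h1.2 v rfl).differentiableAt (by simp)
    have e2 : DifferentiableAt ℝ (fun w => d.g p.2 q.2 (proj Λ w)) v :=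
      (h2.2 v rfl).differentiableAt (by simp)
    have n1 := h1.1
    have n2 := h2.1
    rw [D.transform p.1 q.1 v hp.1 hq.1, D'.transform p.2 q.2 v hp.2 hq.2]
    simp only [CechCocycle.tensor]
    rw [fderiv_fun_mul e1 e2]
    ext w
    simp only [add_apply, smul_apply, smul_eq_mul]
    field_simp
    ring

/-- The canonical flat connection `d` on the line bundle of a `U(1)`-local system. -/
noncomputable def flat (ℓ : CechCocycle (circleConst Λ)) :
    Connection (ℓ.map (circleConst_le_smooth Λ)) where
  A _ _ := 0
  smooth _ _ _ _ _ := contDiffAt_const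
  transform i j v hi hj := by
    have h := (circleConst_eventuallyEq Λ (ℓ.mem_g i j _ hi hj)).fderiv_eq (𝕜 := ℝ)
    have h' : fderiv ℝ (fun w => (ℓ.map (circleConst_le_smooth Λ)).g i j (proj Λ w)) v = 0 := by
      refine h.trans ?_
      simp
    rw [h']
    ext w
    simp

/-- The line bundles with connection `(c, D)` and `(d, D')` are isomorphic. -/
def Isomorphic {c d : LineBundle Λ} (D : Connection c) (D' : Connection d) : Prop :=
  ∃ f, CechCocycle.IsIsoData c d f ∧ ∀ a b v, proj Λ v ∈ c.U a → proj Λ v ∈ d.U b →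
    D'.A b (proj Λ v) = D.A a (proj Λ v) +
      (f a b (proj Λ v))⁻¹ • fderiv ℝ (fun w => f a b (proj Λ w)) v

/-- Gauge equivalence of connections on a fixed line bundle: they correspond to each other under
an automorphism of the bundle, i.e. under a smooth function `φ : V ⧸ Λ → ℂˣ`. -/
def GaugeEquiv {c : LineBundle Λ} (D D' : Connection c) : Prop :=
  ∃ φ : V ⧸ Λ → ℂ, (∀ x, (smoothUnits Λ).mem φ x) ∧ ∀ i v, proj Λ v ∈ c.U i →
    D'.A i (proj Λ v) = D.A i (proj Λ v) +
      (φ (proj Λ v))⁻¹ • fderiv ℝ (fun w => φ (proj Λ w)) v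

theorem gaugeEquiv_refl {c : LineBundle Λ} (D : Connection c) : GaugeEquiv D D :=
  ⟨fun _ => 1, (smoothUnits Λ).one, fun i v _ => by simp⟩

theorem GaugeEquiv.symm {c : LineBundle Λ} {D D' : Connection c} (h : GaugeEquiv D D') :
    GaugeEquiv D' D := by
  obtain ⟨φ, h1, h2⟩ := h
  refine ⟨fun x => (φ x)⁻¹, fun x => (smoothUnits Λ).inv (h1 x), fun i v hv => ?_⟩
  have n := (h1 (proj Λ v)).1
  have e : HasFDerivAt (fun w => φ (proj Λ w)) (fderiv ℝ (fun w => φ (proj Λ w)) v) v :=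
    (((h1 (proj Λ v)).2 v rfl).differentiableAt (by simp)).hasFDerivAt
  have e' := ((hasDerivAt_inv n).hasFDerivAt.restrictScalars ℝ).comp v e
  have e2 : fderiv ℝ (fun w => (φ (proj Λ w))⁻¹) v = _ := e'.fderiv
  rw [e2, h2 i v hv]
  ext w
  simp
  field_simp
  ring

theorem GaugeEquiv.trans {c : LineBundle Λ} {D D' D'' : Connection c} (h : GaugeEquiv D D')
    (h' : GaugeEquiv D' D'') : GaugeEquiv D D'' := by
  obtain ⟨φ, h1, h2⟩ := h
  obtain ⟨ψ, k1, k2⟩ := h'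
  refine ⟨fun x => φ x * ψ x, fun x => (smoothUnits Λ).mul (h1 x) (k1 x), fun i v hv => ?_⟩
  have n := (h1 (proj Λ v)).1
  have m := (k1 (proj Λ v)).1
  have e : DifferentiableAt ℝ (fun w => φ (proj Λ w)) v :=
    ((h1 (proj Λ v)).2 v rfl).differentiableAt (by simp)
  have e' : DifferentiableAt ℝ (fun w => ψ (proj Λ w)) v :=
    ((k1 (proj Λ v)).2 v rfl).differentiableAt (by simp)
  rw [k2 i v hv, h2 i v hv, fderiv_fun_mul e e']
  ext w
  simp only [add_apply, smul_apply, smul_eq_mul]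
  field_simp
  ring

end Connection

/-- A hermitian structure on a complex line bundle: `|s|² = h i * |s i|²` over `U i`. -/
structure HermitianMetric (c : LineBundle Λ) where
  h : c.ι → V ⧸ Λ → ℝ
  pos : ∀ i x, x ∈ c.U i → 0 < h i x
  smooth : ∀ i x, x ∈ c.U i → SmoothAt (h i) x
  transform : ∀ i j x, x ∈ c.U i → x ∈ c.U j → h j x = h i x * ‖c.g i j x‖ ^ 2

/-- `∇` is compatible with the hermitian structure: `d (h(s, t)) = h(∇ s, t) + h(s, ∇ t)`; for the
local frame over `U i` this reads `d (h i) = h i * (A i + conj (A i))`. -/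
def HermitianMetric.IsCompatible {c : LineBundle Λ} (m : HermitianMetric c)
    (D : Connection c) : Prop :=
  ∀ i v, proj Λ v ∈ c.U i → ∀ w : V,
    ((fderiv ℝ (fun y => m.h i (proj Λ y)) v w : ℝ) : ℂ) =
      (m.h i (proj Λ v) : ℂ) * (D.A i (proj Λ v) w + conj (D.A i (proj Λ v) w))

/-- `∇` is a hermitian (`U(1)`-) connection for some hermitian structure on the line bundle. -/
def Connection.IsUnitary {c : LineBundle Λ} (D : Connection c) : Prop :=
  ∃ m : HermitianMetric c, m.IsCompatible D

/-- `∇` is compatible with the holomorphic structure, `∇^{0,1} = ∂̄`: in holomorphic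
trivializations the connection forms are of type `(1,0)`, i.e. complex linear. -/
def Connection.IsHolCompatible {L : HolLineBundle Λ} (D : Connection (toComplex L)) : Prop :=
  ∀ i x, x ∈ L.U i → ∀ w : V, D.A i x (Complex.I • w) = Complex.I * D.A i x w

/-- `c₁ = E` in the cohomology of `V ⧸ Λ`, where `c₁ = (i / 2π) [F]` for the curvature `F` of a
connection. The class of `E` is represented by the translation-invariant `2`-form
`(w₁, w₂) ↦ E w₂ w₁`; this is the sign for which the bundle with the factor of automorphy
`χ(λ) exp(π H(v, λ) + (π / 2) H(λ, λ))` has Chern class `Im H`. -/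
def HasChernClass (c : LineBundle Λ) (E : V → V → ℝ) : Prop :=
  ∃ (D : Connection c) (F : V ⧸ Λ → V [⋀^Fin 2]→L[ℝ] ℂ) (a : V ⧸ Λ → V →L[ℝ] ℂ),
    D.HasCurvature F ∧ (∀ x, SmoothAt a x) ∧
      ∀ v w₁ w₂ : V, Complex.I / (2 * Real.pi) * F (proj Λ v) ![w₁, w₂] =
        (E w₂ w₁ : ℂ) + dOne a v ![w₁, w₂]

/-- `(c, ∇)` is `E`-flat: `c₁ = E`, and the curvature is translation-invariant. -/
def Connection.IsEFlat {c : LineBundle Λ} (D : Connection c) (E : V → V → ℝ) : Prop :=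
  HasChernClass c E ∧
    ∃ F : V ⧸ Λ → V [⋀^Fin 2]→L[ℝ] ℂ, D.HasCurvature F ∧ ∀ x y, F (x + y) = F y

/-- The `E`-flat hermitian connections on the complex line bundle `c`. -/
def EFlatConnection (c : LineBundle Λ) (E : V → V → ℝ) :=
  {D : Connection c // D.IsEFlat E ∧ D.IsUnitary}

instance gaugeSetoid (c : LineBundle Λ) (E : V → V → ℝ) : Setoid (EFlatConnection c E) where
  r D D' := Connection.GaugeEquiv D.1 D'.1
  iseqv := ⟨fun D => Connection.gaugeEquiv_refl D.1, fun h => h.symm, fun h h' => h.trans h'⟩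

/-- The space of `E`-flat hermitian connections on `c`, up to automorphisms of `c`. -/
def EFlatSpace (c : LineBundle Λ) (E : V → V → ℝ) := Quotient (gaugeSetoid c E)

/-- The class of an `E`-flat connection. -/
def EFlatSpace.mk {c : LineBundle Λ} {E : V → V → ℝ} (D : EFlatConnection c E) :
    EFlatSpace c E := Quotient.mk _ D

end

end ComplexTorus

open ComplexTorus

set_option linter.unusedSectionVars false

/-! Everything is pulled back to `V`, where forms on the torus become `Λ`-periodic forms. Three
facts carry the argument. A closed periodic 1-form is a constant form plus the differential of a
periodic function (`exists_eq_const_add_fderiv`: integrate, then extend the periods linearly). A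
constant exact 2-form vanishes (`fderiv_symm_of_const`). A `∂̄`-closed periodic form is constant
plus `∂̄φ` (`LatticeFourier.exists_dbar_primitive`); in Fourier series this is division by a symbol
which, for each frequency `m ≠ 0`, has norm at least 1 on some basis vector, so there are no small
divisors.

Torsor. Subtracting an exact correction and then unitarizing with any Hermitian metric produces a
unitary connection with curvature `-2πi E`, so the space is non-empty. Two unitary connections with
invariant curvature differ by a global form `τ`; `dτ` is constant and exact, hence zero, so `τ = r +
dψ`. As `2 Re τ` is the logarithmic derivative of a ratio of metrics, `r` is imaginary. The gauge
transformation `exp ψ` absorbs `dψ`, and a `U(1)`-local system absorbs `r`: this is transitivity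
(`exists_isShift_of_isEFlat`). Conversely, every `U(1)`-local system is smoothly trivial, because
its flat section on `V` has a unitary character of `Λ` as multiplier and such a character is `exp (i
r)` for a real functional `r`; hence twisting by it stays on the same bundle (`exists_isShift`). The
action is free because a trivialization with zero logarithmic derivative is locally constant.

`H¹(X, U(1)) ≅ Pic⁰`. Injectivity is the maximum principle on a compact torus. For surjectivity, a
smooth trivialization gives a flat connection; `exists_antiForm_add_eq_zero` kills its `(0,1)` part
by an imaginary constant form and an exact form, and the correspondingly rescaled section on `V` is
holomorphic with a unitary multiplier.

Compatible connection. The form `-2πi E` is of type `(1,1)`, so the same lemma gives existence. For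
uniqueness, the difference `τ` is closed and of type `(1,0)`; the exponential of its primitive is an
entire function, bounded because `r` is imaginary, so Liouville's theorem gives `τ = 0`. -/

/-- Invariance of a function on `V` under the translations by `Λ`. -/
def IsPeriodic {V : Type u} [AddCommGroup V] (Λ : Submodule ℤ V) {α : Type v} (f : V → α) : Prop :=
  ∀ v, ∀ l ∈ Λ, f (v + l) = f v

/-! ### Fourier series of smooth functions that are periodic with respect to a lattice -/

namespace LatticeFourier

open MeasureTheory Module

variable {V : Type u} [NormedAddCommGroup V] [NormedSpace ℝ V] [FiniteDimensional ℝ V]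
variable {ι : Type} [Fintype ι] (b : Basis ι ℝ V)

/-- The coordinates of a vector, as continuous linear functionals. -/
noncomputable def coordL (i : ι) : V →L[ℝ] ℝ := LinearMap.toContinuousLinearMap (b.coord i)

/-- The lattice spanned by the basis `b`. -/
abbrev latticeOf : Submodule ℤ V := Submodule.span ℤ (Set.range b)

/-- The covering map of the standard torus. -/
noncomputable def toTorus (v : V) : UnitAddTorus ι := fun i => ((b.repr v i : ℝ) : UnitAddCircle)

/-- The quotient property allows continuity of a descended function to be tested on `V`, and its
surjectivity allows pointwise identities to be checked there. -/
theorem isOpenQuotientMap_toTorus : IsOpenQuotientMap (toTorus b) := by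
  have h1 : IsOpenQuotientMap (fun x : ι → ℝ => fun i => ((x i : ℝ) : UnitAddCircle)) :=
    IsOpenQuotientMap.piMap fun i => QuotientAddGroup.isOpenQuotientMap_mk
  have h2 : IsOpenQuotientMap (fun v => b.equivFunL v) :=
    b.equivFunL.toHomeomorph.isOpenQuotientMap
  exact h1.comp h2

/-- The function on the standard torus that corresponds to a periodic function. -/
noncomputable def descend {α : Type v} (f : V → α) (t : UnitAddTorus ι) : α :=
  f (∑ i, (AddCircle.equivIco 1 0 (t i) : ℝ) • b i)

variable {b}

/-- The representative of each coordinate in `[0, 1)` differs from that coordinate by an integer, so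
the two points of `V` differ by a lattice vector. -/
theorem descend_toTorus {α : Type v} {f : V → α} (hf : IsPeriodic (latticeOf b) f) (v : V) :
    descend b f (toTorus b v) = f v := by
  have key : ∀ i, ∃ n : ℤ,
      (AddCircle.equivIco 1 0 ((b.repr v i : ℝ) : UnitAddCircle) : ℝ) = b.repr v i + n := by
    intro i
    have h : (((AddCircle.equivIco 1 0 ((b.repr v i : ℝ) : UnitAddCircle) : ℝ)) : UnitAddCircle) =
        ((b.repr v i : ℝ) : UnitAddCircle) := AddCircle.coe_equivIco
    obtain ⟨n, hn⟩ := (QuotientAddGroup.eq_iff_sub_mem.mp h)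
    refine ⟨n, ?_⟩
    replace hn : n • (1 : ℝ) = _ := hn
    rw [zsmul_eq_mul, mul_one] at hn
    rw [hn]
    ring
  choose n hn using key
  have h : (∑ i, (AddCircle.equivIco 1 0 (toTorus b v i) : ℝ) • b i) = v + ∑ i, n i • b i := by
    conv_rhs => rw [← b.sum_repr v]
    rw [← Finset.sum_add_distrib]
    refine Finset.sum_congr rfl fun i _ => ?_
    rw [toTorus, hn i, add_smul, Int.cast_smul_eq_zsmul]
  rw [descend, h]
  exact hf _ _ (Submodule.sum_mem _ fun i _ =>
    Submodule.smul_mem _ _ (Submodule.subset_span ⟨i, rfl⟩))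

theorem continuous_descend {α : Type v} [TopologicalSpace α] {f : V → α}
    (hf : IsPeriodic (latticeOf b) f) (hc : Continuous f) : Continuous (descend b f) := by
  rw [(isOpenQuotientMap_toTorus b).isQuotientMap.continuous_iff]
  convert hc using 1
  exact funext (descend_toTorus hf)

theorem toTorus_add (v w : V) : toTorus b (v + w) = toTorus b v + toTorus b w := by
  ext i
  simp [toTorus]

/-- The normalized Haar measure of the standard torus. -/
noncomputable def torusMeasure (ι : Type) [Fintype ι] : Measure (UnitAddTorus ι) :=
  Measure.pi fun _ => AddCircle.haarAddCircle

instance : IsProbabilityMeasure (torusMeasure ι) := by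
  unfold torusMeasure; infer_instance

instance : (torusMeasure ι).IsAddRightInvariant := by
  unfold torusMeasure; infer_instance

theorem IsPeriodic.fderiv_apply {F : Type v} [NormedAddCommGroup F] [NormedSpace ℝ F]
    {Λ : Submodule ℤ V} {f : V → F} (hf : IsPeriodic Λ f) : IsPeriodic Λ (fderiv ℝ f) := by
  intro v l hl
  have h : (fun w => f (w + l)) = f := funext fun w => hf w l hl
  rw [← fderiv_comp_add_right, h]

theorem bounded_of_periodic {F : Type v} [NormedAddCommGroup F] {f : V → F}
    (hf : IsPeriodic (latticeOf b) f) (hc : Continuous f) : ∃ C, ∀ v, ‖f v‖ ≤ C := by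
  obtain ⟨C, hC⟩ := (isCompact_range (continuous_descend hf hc)).isBounded.exists_norm_le
  exact ⟨C, fun v => hC _ ⟨toTorus b v, descend_toTorus hf v⟩⟩

/-- By invariance of Haar measure the integral of the translate of `f` by `s • w` does not depend on
`s`. Differentiating under the integral at `s = 0` gives the claim. -/
theorem integral_descend_fderiv {f : V → ℂ} (hf : IsPeriodic (latticeOf b) f)
    (hc : ContDiff ℝ 1 f) (w : V) :
    ∫ t, descend b (fun v => fderiv ℝ f v w) t ∂(torusMeasure ι) = 0 := by
  have hf' : IsPeriodic (latticeOf b) (fun v => fderiv ℝ f v w) := fun v l hl => by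
    simp only [IsPeriodic.fderiv_apply hf v l hl]
  have hc' : Continuous (fun v => fderiv ℝ f v w) :=
    (hc.continuous_fderiv (by simp)).clm_apply continuous_const
  obtain ⟨C, hC⟩ := bounded_of_periodic hf' hc'
  have hsurj := (isOpenQuotientMap_toTorus b).surjective
  have hderiv : ∀ v : V, ∀ s : ℝ, HasDerivAt (fun s : ℝ => f (v + s • w))
      (fderiv ℝ f (v + s • w) w) s := by
    intro v s
    have h1 : HasFDerivAt f (fderiv ℝ f (v + s • w)) (v + s • w) :=
      (hc.differentiable (by simp) _).hasFDerivAt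
    have h2 : HasDerivAt (fun s : ℝ => v + s • w) w s := by
      simpa using ((hasDerivAt_id s).smul_const w).const_add v
    exact h1.comp_hasDerivAt s h2
  have hF : ∀ v : V, ∀ s : ℝ, descend b f (toTorus b v + toTorus b (s • w)) = f (v + s • w) := by
    intro v s
    rw [← toTorus_add, descend_toTorus hf]
  have hF' : ∀ v : V, ∀ s : ℝ, descend b (fun v => fderiv ℝ f v w)
      (toTorus b v + toTorus b (s • w)) = fderiv ℝ f (v + s • w) w := by
    intro v s
    rw [← toTorus_add, descend_toTorus hf']
  have hcont := continuous_descend hf hc.continuous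
  have hcont' := continuous_descend hf' hc'
  have main := hasDerivAt_integral_of_dominated_loc_of_deriv_le (μ := torusMeasure ι)
    (F := fun (s : ℝ) t => descend b f (t + toTorus b (s • w)))
    (F' := fun (s : ℝ) t => descend b (fun v => fderiv ℝ f v w) (t + toTorus b (s • w)))
    (x₀ := 0) (s := Set.univ) (bound := fun _ => C) univ_mem
    (Eventually.of_forall fun s =>
      (hcont.comp (continuous_add_const _)).aestronglyMeasurable)
    ((hcont.comp (continuous_add_const _)).integrable_of_hasCompactSupport
      (HasCompactSupport.of_compactSpace _))
    ((hcont'.comp (continuous_add_const _)).aestronglyMeasurable)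
    (Eventually.of_forall fun t s _ => by
      obtain ⟨v, rfl⟩ := hsurj t
      rw [hF']
      exact hC _)
    (integrable_const C)
    (Eventually.of_forall fun t s _ => by
      obtain ⟨v, rfl⟩ := hsurj t
      simp only [hF, hF']
      exact hderiv v s)
  have hd := main.2
  simp only [integral_add_right_eq_self (μ := torusMeasure ι)] at hd
  exact hd.unique (hasDerivAt_const _ _)

variable (b) in
/-- The linear functional with integral coordinates `m`. -/
noncomputable def lin (m : ι → ℤ) : V →L[ℝ] ℝ := ∑ i, (m i : ℝ) • coordL b i

theorem lin_apply (m : ι → ℤ) (v : V) : lin b m v = ∑ i, (m i : ℝ) * b.repr v i := by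
  simp [lin, coordL]

theorem lin_basis (m : ι → ℤ) (j : ι) : lin b m (b j) = m j := by
  classical
  simp [lin_apply, Finsupp.single_apply]

variable (b) in
/-- The exponential monomial with frequency `m`. -/
noncomputable def char (m : ι → ℤ) (v : V) : ℂ :=
  Complex.exp (2 * Real.pi * Complex.I * lin b m v)

theorem norm_char (m : ι → ℤ) (v : V) : ‖char b m v‖ = 1 := by
  rw [char, show (2 * Real.pi * Complex.I * lin b m v : ℂ) =
    ((2 * Real.pi * lin b m v : ℝ) : ℂ) * Complex.I by push_cast; ring]
  exact Complex.norm_exp_ofReal_mul_I _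

theorem mFourier_toTorus (m : ι → ℤ) (v : V) :
    UnitAddTorus.mFourier m (toTorus b v) = char b m v := by
  simp only [UnitAddTorus.mFourier, ContinuousMap.coe_mk, toTorus, fourier_coe_apply, char,
    lin_apply]
  rw [← Complex.exp_sum]
  congr 1
  push_cast
  rw [Finset.mul_sum]
  refine Finset.sum_congr rfl fun i _ => ?_
  ring

theorem char_periodic (m : ι → ℤ) : IsPeriodic (latticeOf b) (char b m) := by
  intro v l hl
  have h : toTorus b (v + l) = toTorus b v := by
    ext i
    simp only [toTorus, map_add, Finsupp.add_apply]
    have : ∃ n : ℤ, b.repr l i = n := by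
      induction hl using Submodule.span_induction with
      | mem x hx =>
        classical
        obtain ⟨j, rfl⟩ := hx
        exact ⟨if j = i then 1 else 0, by simp [Finsupp.single_apply]⟩
      | zero => exact ⟨0, by simp⟩
      | add x y _ _ h1 h2 =>
        obtain ⟨n1, h1⟩ := h1
        obtain ⟨n2, h2⟩ := h2
        exact ⟨n1 + n2, by simp [h1, h2]⟩
      | smul a x _ h1 =>
        obtain ⟨n1, h1⟩ := h1
        exact ⟨a * n1, by simp [h1]⟩
    obtain ⟨n, hn⟩ := this
    rw [hn, AddCircle.coe_add]
    simp only [add_eq_left]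
    exact (AddCircle.coe_eq_zero_iff 1).mpr ⟨n, by simp⟩
  rw [← mFourier_toTorus, h, mFourier_toTorus]

theorem hasFDerivAt_char (m : ι → ℤ) (v : V) : HasFDerivAt (char b m)
    ((char b m v * (2 * Real.pi * Complex.I)) • (Complex.ofRealCLM ∘L lin b m)) v := by
  have h1 : HasFDerivAt (fun v => (lin b m v : ℂ)) (Complex.ofRealCLM ∘L lin b m) v :=
    (Complex.ofRealCLM ∘L lin b m).hasFDerivAt
  have h2 := (h1.const_mul (2 * Real.pi * Complex.I)).cexp
  rw [smul_smul] at h2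
  exact h2

theorem contDiff_char (m : ι → ℤ) {n : WithTop ℕ∞} : ContDiff ℝ n (char b m) := by
  have h : ContDiff ℝ n (fun v => (lin b m v : ℂ)) :=
    (Complex.ofRealCLM ∘L lin b m).contDiff
  exact (contDiff_const.mul h).cexp

variable (b) in
/-- The Fourier coefficients of a periodic function. -/
noncomputable def coeff (f : V → ℂ) (m : ι → ℤ) : ℂ := UnitAddTorus.mFourierCoeff (descend b f) m

/-- Writing the whole integrand as one descended periodic function makes `integral_descend_fderiv`
applicable to it. -/
theorem coeff_eq {f : V → ℂ} (hf : IsPeriodic (latticeOf b) f) (m : ι → ℤ) :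
    coeff b f m = ∫ t, descend b (fun v => char b (-m) v * f v) t ∂(torusMeasure ι) := by
  change ∫ t, _ ∂(torusMeasure ι) = _
  congr 1
  ext t
  obtain ⟨v, rfl⟩ := (isOpenQuotientMap_toTorus b).surjective t
  rw [descend_toTorus hf, descend_toTorus, mFourier_toTorus, smul_eq_mul]
  intro v l hl
  simp only [char_periodic _ v l hl, hf v l hl]

theorem integrable_descend {f : V → ℂ} (hf : IsPeriodic (latticeOf b) f) (hc : Continuous f) :
    Integrable (descend b f) (torusMeasure ι) :=
  (continuous_descend hf hc).integrable_of_hasCompactSupport (HasCompactSupport.of_compactSpace _)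

theorem coeff_add {f g : V → ℂ} (hf : IsPeriodic (latticeOf b) f) (hc : Continuous f)
    (hg : IsPeriodic (latticeOf b) g) (hc' : Continuous g) (m : ι → ℤ) :
    coeff b (fun v => f v + g v) m = coeff b f m + coeff b g m := by
  have per : ∀ {f : V → ℂ}, IsPeriodic (latticeOf b) f →
      IsPeriodic (latticeOf b) (fun v => char b (-m) v * f v) := fun hf v l hl => by
    simp only [char_periodic _ v l hl, hf v l hl]
  have cont : ∀ {f : V → ℂ}, Continuous f → Continuous (fun v => char b (-m) v * f v) :=
    fun hf => (contDiff_char (n := 0) (-m)).continuous.mul hf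
  rw [coeff_eq hf, coeff_eq hg, coeff_eq (fun v l hl => by simp only [hf v l hl, hg v l hl]),
    ← integral_add (integrable_descend (per hf) (cont hc)) (integrable_descend (per hg) (cont hc'))]
  congr 1
  ext t
  simp only [descend]
  ring

theorem coeff_const_mul (f : V → ℂ) (c : ℂ) (m : ι → ℤ) :
    coeff b (fun v => c * f v) m = c * coeff b f m := by
  simp only [coeff, UnitAddTorus.mFourierCoeff]
  rw [← integral_const_mul]
  congr 1
  ext t
  simp only [descend, smul_eq_mul]
  ring

theorem norm_coeff_le {f : V → ℂ} {C : ℝ} (hC : ∀ v, ‖f v‖ ≤ C) (m : ι → ℤ) :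
    ‖coeff b f m‖ ≤ C := by
  have h : ‖∫ t, UnitAddTorus.mFourier (-m) t • descend b f t ∂(torusMeasure ι)‖ ≤
      C * (torusMeasure ι).real Set.univ := by
    refine norm_integral_le_of_norm_le_const (Eventually.of_forall fun t => ?_)
    obtain ⟨v, rfl⟩ := (isOpenQuotientMap_toTorus b).surjective t
    rw [norm_smul, mFourier_toTorus, norm_char, one_mul]
    exact hC _
  rw [probReal_univ, mul_one] at h
  exact h

/-- Integration by parts: the derivative of `char b (-m) * f` has integral zero. -/
theorem coeff_fderiv {f : V → ℂ} (hf : IsPeriodic (latticeOf b) f) (hc : ContDiff ℝ 1 f)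
    (w : V) (m : ι → ℤ) :
    coeff b (fun v => fderiv ℝ f v w) m = 2 * Real.pi * Complex.I * lin b m w * coeff b f m := by
  have hf' : IsPeriodic (latticeOf b) (fun v => fderiv ℝ f v w) := fun v l hl => by
    simp only [IsPeriodic.fderiv_apply hf v l hl]
  have hc' : Continuous (fun v => fderiv ℝ f v w) :=
    (hc.continuous_fderiv (by simp)).clm_apply continuous_const
  have hp : IsPeriodic (latticeOf b) (fun v => char b (-m) v * f v) := fun v l hl => by
    simp only [char_periodic _ v l hl, hf v l hl]
  have hp' : IsPeriodic (latticeOf b) (fun v => char b (-m) v * fderiv ℝ f v w) :=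
    fun v l hl => by
      simp only [char_periodic _ v l hl, hf' v l hl]
  have hcc : Continuous (char b (-m)) := (contDiff_char (n := 0) (-m)).continuous
  have h0 := integral_descend_fderiv hp ((contDiff_char (-m)).mul hc) w
  have e : ∀ v, fderiv ℝ (fun v => char b (-m) v * f v) v w = char b (-m) v * fderiv ℝ f v w +
      (-(2 * Real.pi * Complex.I * lin b m w)) * (char b (-m) v * f v) := by
    intro v
    have h1 := hasFDerivAt_char (b := b) (-m) v
    have h2 : HasFDerivAt f (fderiv ℝ f v) v := (hc.differentiable (by simp) _).hasFDerivAt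
    have h3 : HasFDerivAt (fun v => char b (-m) v * f v) _ v := h1.mul h2
    rw [h3.fderiv]
    have : lin b (-m) w = - lin b m w := by simp [lin_apply]
    simp [this]
    ring
  simp only [e] at h0
  have e2 : ∀ t, descend b (fun v => char b (-m) v * fderiv ℝ f v w +
      (-(2 * Real.pi * Complex.I * lin b m w)) * (char b (-m) v * f v)) t =
      descend b (fun v => char b (-m) v * fderiv ℝ f v w) t +
      (-(2 * Real.pi * Complex.I * lin b m w)) * descend b (fun v => char b (-m) v * f v) t :=
    fun t => rfl
  simp only [e2] at h0
  rw [integral_add (integrable_descend hp' (hcc.mul hc'))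
    ((integrable_descend hp (hcc.mul hc.continuous)).const_mul _), integral_const_mul] at h0
  rw [coeff_eq hf, coeff_eq hf']
  linear_combination h0

/-- Differentiating along the basis vector `b j` multiplies the coefficient by `2πi * m j`. Taking
`j` with `|m j| = ‖m‖` gains one power of `‖m‖` per derivative. -/
theorem exists_decay {f : V → ℂ} (hf : IsPeriodic (latticeOf b) f) (hc : ContDiff ℝ ∞ f) (k : ℕ) :
    ∃ C, ∀ m, ‖m‖ ^ k * ‖coeff b f m‖ ≤ C := by
  induction k generalizing f with
  | zero =>
    obtain ⟨C, hC⟩ := bounded_of_periodic hf hc.continuous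
    exact ⟨C, fun m => by simpa using norm_coeff_le hC m⟩
  | succ k ih =>
    have h := fun j => ih (f := fun v => fderiv ℝ f v (b j))
      (fun v l hl => by simp only [IsPeriodic.fderiv_apply hf v l hl])
      ((hc.fderiv_right (m := ∞) (by simp)).clm_apply contDiff_const)
    choose C hC using h
    have hC0 : ∀ j, 0 ≤ C j := fun j => le_trans (by positivity) (hC j 0)
    -- The index of the largest coordinate depends on `m`, so the bounds for all directions are
    -- added up.
    refine ⟨∑ j, C j, fun m => ?_⟩
    rcases eq_or_ne m 0 with rfl | hm
    · simp
      exact Finset.sum_nonneg fun j _ => hC0 j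
    have : Nonempty ι := by
      by_contra h
      rw [not_nonempty_iff] at h
      exact hm (Subsingleton.elim _ _)
    obtain ⟨j, hj⟩ : ∃ j, ‖m‖ = ‖m j‖ := by
      obtain ⟨j, -, hj⟩ := Finset.exists_max_image Finset.univ (fun j => ‖m j‖)
        Finset.univ_nonempty
      exact ⟨j, le_antisymm ((pi_norm_le_iff_of_nonneg (norm_nonneg _)).mpr
        fun i => hj i (Finset.mem_univ _)) (norm_le_pi_norm m j)⟩
    refine le_trans ?_ (Finset.single_le_sum (fun j _ => hC0 j) (Finset.mem_univ j))
    refine le_trans ?_ (hC j m)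
    rw [coeff_fderiv hf (hc.of_le (by simp)), lin_basis]
    simp only [norm_mul, Complex.norm_I, Complex.norm_real, Real.norm_eq_abs,
      abs_of_pos Real.pi_pos, mul_one]
    rw [pow_succ, hj, show ‖m j‖ = |(m j : ℝ)| from Int.norm_eq_abs _]
    have h1 : (1 : ℝ) ≤ ‖(2 : ℂ)‖ * Real.pi := by
      simp
      nlinarith [Real.pi_gt_three]
    have h2 : 0 ≤ |(m j : ℝ)| ^ k * |(m j : ℝ)| * ‖coeff b f m‖ := by positivity
    calc _ ≤ (|(m j : ℝ)| ^ k * |(m j : ℝ)| * ‖coeff b f m‖) * (‖(2 : ℂ)‖ * Real.pi) :=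
          le_mul_of_one_le_right h2 h1
      _ = _ := by ring

/-- Sequences that decay faster than any power. -/
def RapidDecay (a : (ι → ℤ) → ℂ) : Prop := ∀ k : ℕ, Summable fun m => ‖m‖ ^ k * ‖a m‖

/-- The frequencies form the standard lattice in `ι → ℝ`, and an exponent exceeding its rank
suffices. -/
theorem summable_norm_inv_pow (ι : Type) [Fintype ι] :
    ∃ n : ℕ, Summable fun m : ι → ℤ => ‖m‖⁻¹ ^ n := by
  let L := Submodule.span ℤ (Set.range (Pi.basisFun ℝ ι))
  have h := ZLattice.summable_norm_pow_inv L (Module.finrank ℤ L + 1) (Nat.lt_succ_self _)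
  refine ⟨Module.finrank ℤ L + 1, ?_⟩
  have hmem : ∀ m : ι → ℤ, (fun i => (m i : ℝ)) ∈ L := by
    intro m
    have : (fun i => (m i : ℝ)) = ∑ i, m i • Pi.basisFun ℝ ι i := by
      classical
      ext j
      simp [Finset.sum_apply, Pi.single_apply]
    rw [this]
    exact Submodule.sum_mem _ fun i _ =>
      Submodule.smul_mem _ _ (Submodule.subset_span ⟨i, rfl⟩)
  have hinj : Function.Injective (fun m : ι → ℤ => (⟨fun i => (m i : ℝ), hmem m⟩ : L)) := by
    intro m m' h
    ext i
    have h' : (m i : ℝ) = m' i := congrFun (congrArg Subtype.val h) i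
    exact_mod_cast h'
  refine (h.comp_injective hinj).congr fun m => ?_
  have h' : ‖fun i => (m i : ℝ)‖ = ‖m‖ := by
    simp only [Pi.norm_def]
    congr
  rw [← h']
  rfl

/-- Decay of order `k + n` leaves the factor `‖m‖⁻¹ ^ n`, which is summable, to spare. -/
theorem rapidDecay_coeff {f : V → ℂ} (hf : IsPeriodic (latticeOf b) f) (hc : ContDiff ℝ ∞ f) :
    RapidDecay (coeff b f) := by
  intro k
  obtain ⟨n, hn⟩ := summable_norm_inv_pow ι
  obtain ⟨C, hC⟩ := exists_decay hf hc (k + n)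
  obtain ⟨C', hC'⟩ := exists_decay hf hc k
  refine Summable.of_norm_bounded_eventually (hn.mul_left C) ?_
  -- The comparison divides by `‖m‖ ^ n`, so the zero frequency is set aside.
  have : ∀ᶠ m : ι → ℤ in cofinite, m ≠ 0 := by
    exact (Set.finite_singleton (0 : ι → ℤ)).compl_mem_cofinite
  filter_upwards [this] with m hm
  have hpos : 0 < ‖m‖ := norm_pos_iff.mpr hm
  rw [Real.norm_of_nonneg (by positivity), inv_pow, ← div_eq_mul_inv, le_div_iff₀ (by positivity)]
  calc _ = ‖m‖ ^ (k + n) * ‖coeff b f m‖ := by rw [pow_add]; ring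
    _ ≤ C := hC m

theorem hasSum_coeff {f : V → ℂ} (hf : IsPeriodic (latticeOf b) f) (hc : ContDiff ℝ ∞ f) (v : V) :
    HasSum (fun m => coeff b f m * char b m v) (f v) := by
  have hs : Summable (coeff b f) := by
    have := rapidDecay_coeff hf hc 0
    simp only [pow_zero, one_mul] at this
    exact this.of_norm
  have h := UnitAddTorus.hasSum_mFourier_series_apply_of_summable
    (f := ⟨descend b f, continuous_descend hf hc.continuous⟩) hs (toTorus b v)
  simp only [ContinuousMap.coe_mk, descend_toTorus hf, mFourier_toTorus, smul_eq_mul] at h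
  exact h

variable (b) in
/-- The sum of a Fourier series. -/
noncomputable def series (a : (ι → ℤ) → ℂ) (v : V) : ℂ := ∑' m, a m * char b m v

theorem RapidDecay.coord_mul {a : (ι → ℤ) → ℂ} (ha : RapidDecay a) (c : ℂ) (j : ι) :
    RapidDecay (fun m => c * (m j) * a m) := by
  intro k
  refine Summable.of_nonneg_of_le (fun m => by positivity) (fun m => ?_)
    ((ha (k + 1)).mul_left ‖c‖)
  rw [norm_mul, norm_mul, pow_succ]
  have : ‖(m j : ℂ)‖ ≤ ‖m‖ := by
    refine le_trans (le_of_eq ?_) (norm_le_pi_norm m j)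
    simp [Int.norm_eq_abs]
  have h0 : 0 ≤ ‖m‖ ^ k * ‖a m‖ * ‖c‖ := by positivity
  nlinarith [mul_le_mul_of_nonneg_left this h0]

theorem RapidDecay.summable {a : (ι → ℤ) → ℂ} (ha : RapidDecay a) (v : V) :
    Summable fun m => a m * char b m v := by
  refine Summable.of_norm ?_
  simp only [norm_mul, norm_char, mul_one]
  simpa using! ha 0

theorem norm_lin_le : ∃ C : ℝ, ∀ m, ‖(Complex.ofRealCLM ∘L lin b m)‖ ≤ C * ‖m‖ := by
  refine ⟨∑ j, ‖coordL b j‖, fun m => ?_⟩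
  refine ContinuousLinearMap.opNorm_le_bound _ (by positivity) fun v => ?_
  simp only [ContinuousLinearMap.comp_apply, Complex.ofRealCLM_apply, Complex.norm_real, lin,
    sum_apply, smul_apply, smul_eq_mul]
  refine (norm_sum_le _ _).trans ?_
  rw [Finset.sum_mul, Finset.sum_mul]
  refine Finset.sum_le_sum fun j _ => ?_
  rw [norm_mul]
  have h1 : ‖(m j : ℝ)‖ ≤ ‖m‖ := norm_le_pi_norm m j
  have h2 := (coordL b j).le_opNorm v
  calc _ ≤ ‖m‖ * (‖coordL b j‖ * ‖v‖) := by gcongr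
    _ = _ := by ring

/-- Termwise differentiation costs one power of `‖m‖`, which rapid decay absorbs; the majorant is
uniform in `v`. -/
theorem hasFDerivAt_series {a : (ι → ℤ) → ℂ} (ha : RapidDecay a) (v : V) :
    HasFDerivAt (series b a) (∑' m, a m • (char b m v * (2 * Real.pi * Complex.I)) •
      (Complex.ofRealCLM ∘L lin b m)) v ∧
    Summable (fun m => a m • (char b m v * (2 * Real.pi * Complex.I)) •
      (Complex.ofRealCLM ∘L lin b m)) := by
  obtain ⟨C, hC⟩ := norm_lin_le (b := b)
  have hb : ∀ m v, ‖a m • (char b m v * (2 * Real.pi * Complex.I)) •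
      (Complex.ofRealCLM ∘L lin b m)‖ ≤ 2 * Real.pi * C * (‖m‖ ^ 1 * ‖a m‖) := by
    intro m v
    rw [norm_smul, norm_smul, norm_mul, norm_char]
    simp only [norm_mul, Complex.norm_I, Complex.norm_real, Real.norm_eq_abs,
      abs_of_pos Real.pi_pos, mul_one, one_mul, Complex.norm_ofNat, pow_one]
    have := mul_le_mul_of_nonneg_left (hC m)
      (show 0 ≤ ‖a m‖ * (2 * Real.pi) by positivity)
    linarith
  have hs := (ha 1).mul_left (2 * Real.pi * C)
  exact ⟨hasFDerivAt_tsum (x₀ := v) hs (fun m v => (hasFDerivAt_char m v).const_mul (a m)) hb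
    (ha.summable v) v, Summable.of_norm_bounded hs fun m => hb m v⟩

theorem hasSum_fderiv_series {a : (ι → ℤ) → ℂ} (ha : RapidDecay a) (v w : V) :
    HasSum (fun m => a m * (2 * Real.pi * Complex.I * lin b m w) * char b m v)
      (fderiv ℝ (series b a) v w) := by
  obtain ⟨h1, h2⟩ := hasFDerivAt_series (b := b) ha v
  have h3 := (ContinuousLinearMap.apply ℝ ℂ w).hasSum h2.hasSum
  rw [h1.fderiv]
  simp only [ContinuousLinearMap.apply_apply] at h3
  refine h3.congr_fun fun m => ?_
  simp
  ring

/-- Each partial derivative is again a series with rapidly decaying coefficients, so induction on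
the order applies. -/
theorem contDiff_series {a : (ι → ℤ) → ℂ} (ha : RapidDecay a) : ContDiff ℝ ∞ (series b a) := by
  rw [contDiff_infty]
  intro n
  induction n generalizing a with
  | zero => exact contDiff_zero.mpr (continuous_iff_continuousAt.mpr fun v =>
      (hasFDerivAt_series ha v).1.continuousAt)
  | succ n ih =>
    refine contDiff_succ_iff_hasFDerivAt.mpr ⟨fun v => ∑ j,
      series b (fun m => (2 * Real.pi * Complex.I) * (m j) * a m) v •
        (Complex.ofRealCLM ∘L coordL b j), ?_, fun v => ?_⟩
    · exact ContDiff.sum fun j _ => (ih (ha.coord_mul _ j)).smul contDiff_const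
    · obtain ⟨h1, h2⟩ := hasFDerivAt_series (b := b) ha v
      refine h1.congr_fderiv (ContinuousLinearMap.ext fun w => ?_)
      have h3 := hasSum_fderiv_series (b := b) ha v w
      rw [h1.fderiv] at h3
      refine HasSum.unique h3 ?_
      simp only [sum_apply, smul_apply, ContinuousLinearMap.comp_apply, Complex.ofRealCLM_apply,
        smul_eq_mul]
      have := hasSum_sum (s := Finset.univ) fun j _ =>
        ((ha.coord_mul (2 * Real.pi * Complex.I) j).summable (b := b) v).hasSum.mul_right
          ((coordL b j w : ℝ) : ℂ)
      refine this.congr_fun fun m => ?_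
      simp only [lin, sum_apply, smul_apply, smul_eq_mul]
      push_cast
      rw [Finset.mul_sum, Finset.mul_sum, Finset.sum_mul]
      refine Finset.sum_congr rfl fun j _ => ?_
      ring

theorem series_periodic (a : (ι → ℤ) → ℂ) : IsPeriodic (latticeOf b) (series b a) := by
  intro v l hl
  simp only [series, char_periodic _ v l hl]

end LatticeFourier

/-! ### The `∂̄`-equation on a complex torus. -/

namespace LatticeFourier

open Module

variable {V : Type u} [NormedAddCommGroup V] [NormedSpace ℂ V] [FiniteDimensional ℝ V]
variable {ι : Type} [Fintype ι] {b : Basis ι ℝ V}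

/-- The antilinear part of the functional `lin b m`, multiplied by two. -/
noncomputable def symbol (b : Basis ι ℝ V) (m : ι → ℤ) (w : V) : ℂ :=
  lin b m w + Complex.I * lin b m (Complex.I • w)

/-- The operator `∂_x + i ∂_{ix}` acts on the Fourier coefficient at `m` as multiplication by `2πi *
symbol b m x`, so `∂̄`-closedness becomes an algebraic symmetry at each frequency. -/
theorem coeff_dbar_symm {α : V → V →L[ℝ] ℂ} (hα : ContDiff ℝ ∞ α)
    (hper : IsPeriodic (latticeOf b) α)
    (hclosed : ∀ v x y, fderiv ℝ α v x y + Complex.I * fderiv ℝ α v (Complex.I • x) y =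
      fderiv ℝ α v y x + Complex.I * fderiv ℝ α v (Complex.I • y) x) (m : ι → ℤ) (x y : V) :
    symbol b m x * coeff b (fun v => α v y) m = symbol b m y * coeff b (fun v => α v x) m := by
  have hc : ∀ y, ContDiff ℝ ∞ (fun v => α v y) := fun y => hα.clm_apply contDiff_const
  have hp : ∀ y, IsPeriodic (latticeOf b) (fun v => α v y) := fun y v l hl => by
    simp only [hper v l hl]
  have hd : ∀ v x y, fderiv ℝ (fun v => α v y) v x = fderiv ℝ α v x y := by
    intro v x y
    have h1 : HasFDerivAt α (fderiv ℝ α v) v := (hα.differentiable (by simp) v).hasFDerivAt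
    have h2 := (h1.clm_apply (hasFDerivAt_const y v)).fderiv
    rw [h2]
    simp
  have hpd : ∀ x y, IsPeriodic (latticeOf b) (fun v => fderiv ℝ (fun v => α v y) v x) :=
    fun x y v l hl => by simp only [IsPeriodic.fderiv_apply (hp y) v l hl]
  have hcd : ∀ x y, Continuous (fun v => fderiv ℝ (fun v => α v y) v x) := fun x y =>
    ((hc y).continuous_fderiv (by simp)).clm_apply continuous_const
  have key : ∀ x y, coeff b (fun v => fderiv ℝ α v x y +
      Complex.I * fderiv ℝ α v (Complex.I • x) y) m =
      2 * Real.pi * Complex.I * (symbol b m x * coeff b (fun v => α v y) m) := by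
    intro x y
    simp only [← hd]
    rw [coeff_add (f := fun v => fderiv ℝ (fun v => α v y) v x)
      (g := fun v => Complex.I * fderiv ℝ (fun v => α v y) v (Complex.I • x)) (hpd x y) (hcd x y)
      (fun v l hl => congrArg (Complex.I * ·) (hpd (Complex.I • x) y v l hl))
      (continuous_const.mul (hcd _ _)), coeff_const_mul,
      coeff_fderiv (hp y) ((hc y).of_le (by simp)), coeff_fderiv (hp y) ((hc y).of_le (by simp))]
    simp only [symbol]
    ring
  have e := congrArg (fun f => coeff b f m) (funext fun v => hclosed v x y)
  have h1 := (key x y).symm.trans (e.trans (key y x))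
  have hne : (2 * Real.pi * Complex.I : ℂ) ≠ 0 := Complex.two_pi_I_ne_zero
  exact mul_left_cancel₀ hne h1

/-- A smooth `∂̄`-closed periodic form is the sum of a constant form and a form `∂̄ φ` with a
smooth periodic function `φ`. -/
theorem exists_dbar_primitive {α : V → V →L[ℝ] ℂ} (hα : ContDiff ℝ ∞ α)
    (hper : IsPeriodic (latticeOf b) α)
    (hclosed : ∀ v x y, fderiv ℝ α v x y + Complex.I * fderiv ℝ α v (Complex.I • x) y =
      fderiv ℝ α v y x + Complex.I * fderiv ℝ α v (Complex.I • y) x) :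
    ∃ (φ : V → ℂ), ContDiff ℝ ∞ φ ∧ IsPeriodic (latticeOf b) φ ∧
      ∀ v v' w, α v w - 1 / 2 * (fderiv ℝ φ v w + Complex.I * fderiv ℝ φ v (Complex.I • w)) =
        α v' w - 1 / 2 * (fderiv ℝ φ v' w + Complex.I * fderiv ℝ φ v' (Complex.I • w)) := by
  have hc : ∀ y, ContDiff ℝ ∞ (fun v => α v y) := fun y => hα.clm_apply contDiff_const
  have hp : ∀ y, IsPeriodic (latticeOf b) (fun v => α v y) := fun y v l hl => by
    simp only [hper v l hl]
  have hex : ∀ m : ι → ℤ, m ≠ 0 → ∃ j, m j ≠ 0 := fun m hm => Function.ne_iff.mp hm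
  -- The real part of the symbol at `b j` is the nonzero integer `m j`. This lower bound preserves
  -- rapid decay under division.
  have hsymb : ∀ (m : ι → ℤ) j, m j ≠ 0 → 1 ≤ ‖symbol b m (b j)‖ := by
    intro m j hj
    refine le_trans ?_ (Complex.abs_re_le_norm _)
    simp only [symbol, lin_basis]
    simp
    exact_mod_cast Int.one_le_abs hj
  -- The coefficient of `φ` is found by dividing in one direction `b j` with `m j ≠ 0`;
  -- `coeff_dbar_symm` shows that it then solves the equation in every direction `w`.
  have hchoice : ∀ m : ι → ℤ, ∃ a : ℂ, (∀ w, m ≠ 0 →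
      a * (2 * Real.pi * Complex.I * symbol b m w) = 2 * coeff b (fun v => α v w) m) ∧
      (m = 0 → a = 0) ∧ ‖a‖ ≤ ∑ j, ‖coeff b (fun v => α v (b j)) m‖ := by
    intro m
    by_cases hm : m = 0
    · exact ⟨0, fun w h => absurd hm h, fun _ => rfl, by simp; positivity⟩
    · obtain ⟨j, hj⟩ := hex m hm
      have h1 := hsymb m j hj
      have hne : symbol b m (b j) ≠ 0 := by
        intro h
        rw [h, norm_zero] at h1
        linarith
      have hpi : (Real.pi : ℂ) ≠ 0 := Complex.ofReal_ne_zero.mpr Real.pi_ne_zero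
      refine ⟨coeff b (fun v => α v (b j)) m / (Real.pi * Complex.I * symbol b m (b j)), ?_,
        fun h => absurd h hm, ?_⟩
      · intro w _
        have h2 := coeff_dbar_symm hα hper hclosed m (b j) w
        have hI := Complex.I_ne_zero
        field_simp
        linear_combination -h2
      · refine le_trans ?_ (Finset.single_le_sum
          (f := fun j => ‖coeff b (fun v => α v (b j)) m‖) (fun _ _ => norm_nonneg _)
          (Finset.mem_univ j))
        rw [norm_div]
        refine div_le_self (norm_nonneg _) ?_
        simp only [norm_mul, Complex.norm_I, Complex.norm_real, Real.norm_eq_abs,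
          abs_of_pos Real.pi_pos, mul_one]
        nlinarith [Real.pi_gt_three]
  choose a ha ha0 hab using hchoice
  have hrapid : RapidDecay a := by
    intro k
    refine Summable.of_nonneg_of_le (fun m => by positivity) (fun m => ?_)
      (summable_sum (s := Finset.univ) fun j _ => rapidDecay_coeff (hp (b j)) (hc (b j)) k)
    rw [← Finset.mul_sum]
    exact mul_le_mul_of_nonneg_left (hab m) (by positivity)
  refine ⟨series b a, contDiff_series hrapid, series_periodic a, ?_⟩
  -- All nonzero frequencies cancel, and only the mean value of `α` survives.
  have key : ∀ v w, α v w - 1 / 2 * (fderiv ℝ (series b a) v w +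
      Complex.I * fderiv ℝ (series b a) v (Complex.I • w)) = coeff b (fun v => α v w) 0 := by
    intro v w
    have h1 := hasSum_coeff (hp w) (hc w) v
    have h2 := hasSum_fderiv_series (b := b) hrapid v w
    have h3 := hasSum_fderiv_series (b := b) hrapid v (Complex.I • w)
    have h4 := h1.sub ((h2.add (h3.mul_left Complex.I)).mul_left (1 / 2))
    refine h4.unique ?_
    classical
    have h5 := hasSum_ite_eq (0 : ι → ℤ) (coeff b (fun v => α v w) 0)
    refine h5.congr_fun fun m => ?_
    split_ifs with h
    · subst h
      simp [ha0 0 rfl, char, lin_apply]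
    · have h6 := ha m w h
      simp only [symbol] at h6
      linear_combination (-1 / 2 * char b m v) * h6
  intro v v' w
  rw [key, key]

end LatticeFourier

/-! ### Closed forms on a vector space -/

section Calculus

variable {V : Type u} [NormedAddCommGroup V] [NormedSpace ℝ V]

/-- The logarithmic derivative of a complex function. -/
noncomputable def dlog (f : V → ℂ) (v : V) : V →L[ℝ] ℂ := (f v)⁻¹ • fderiv ℝ f v

theorem dlog_congr {f g : V → ℂ} {v : V} (h : f =ᶠ[𝓝 v] g) : dlog f v = dlog g v := by
  rw [dlog, dlog, h.fderiv_eq, h.self_of_nhds]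

theorem dlog_eq_zero {f : V → ℂ} {v : V} {c : ℂ} (h : ∀ᶠ w in 𝓝 v, f w = c) : dlog f v = 0 := by
  have h' : f =ᶠ[𝓝 v] fun _ => c := h
  rw [dlog_congr h']
  ext w
  simp [dlog]

theorem dlog_mul {f g : V → ℂ} {v : V} (hf : DifferentiableAt ℝ f v) (hg : DifferentiableAt ℝ g v)
    (hf0 : f v ≠ 0) (hg0 : g v ≠ 0) : dlog (fun w => f w * g w) v = dlog f v + dlog g v := by
  rw [dlog, dlog, dlog, fderiv_fun_mul hf hg]
  ext w
  simp
  field_simp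
  ring

theorem dlog_inv {f : V → ℂ} {v : V} (hf : DifferentiableAt ℝ f v) (hf0 : f v ≠ 0) :
    dlog (fun w => (f w)⁻¹) v = - dlog f v := by
  have h1 := dlog_mul (g := fun w => (f w)⁻¹) hf (hf.inv hf0) hf0 (inv_ne_zero hf0)
  have h2 : dlog (fun w => f w * (f w)⁻¹) v = 0 := by
    refine dlog_eq_zero (c := 1) ?_
    filter_upwards [hf.continuousAt.eventually_ne hf0] with w hw
    exact mul_inv_cancel₀ hw
  rw [h2] at h1
  exact (neg_eq_of_add_eq_zero_right h1.symm).symm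

theorem dlog_exp {f : V → ℂ} {v : V} {L : V →L[ℝ] ℂ} (hf : HasFDerivAt f L v) :
    dlog (fun w => Complex.exp (f w)) v = L := by
  rw [dlog, hf.cexp.fderiv, smul_smul, inv_mul_cancel₀ (Complex.exp_ne_zero _), one_smul]

theorem ContDiffAt.dlog {f : V → ℂ} {v : V} (hf : ContDiffAt ℝ ∞ f v) (hf0 : f v ≠ 0) :
    ContDiffAt ℝ ∞ (dlog f) v :=
  (hf.inv hf0).smul (hf.fderiv_right (by simp))

/-- In `d (f⁻¹ df)` the first-order terms form a multiple of `df ∧ df`, which is zero, and the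
second derivative of `f` is symmetric. -/
theorem fderiv_dlog_symm {f : V → ℂ} {v : V} (hf : ContDiffAt ℝ ∞ f v) (hf0 : f v ≠ 0) (x y : V) :
    fderiv ℝ (dlog f) v x y = fderiv ℝ (dlog f) v y x := by
  have h1 : HasFDerivAt (fun w => (f w)⁻¹) (fderiv ℝ (fun w => (f w)⁻¹) v) v :=
    ((hf.inv hf0).differentiableAt (by simp)).hasFDerivAt
  have h2 : HasFDerivAt (fderiv ℝ f) (fderiv ℝ (fderiv ℝ f) v) v :=
    ((hf.fderiv_right (m := ∞) (by simp)).differentiableAt (by simp)).hasFDerivAt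
  have h3 : HasFDerivAt (dlog f) _ v := h1.smul h2
  have h4 : fderiv ℝ (fderiv ℝ f) v x y = fderiv ℝ (fderiv ℝ f) v y x :=
    (hf.isSymmSndFDerivAt (by simp; exact WithTop.coe_le_coe.mpr le_top)).eq x y
  have e : HasFDerivAt f (fderiv ℝ f v) v := (hf.differentiableAt (by simp)).hasFDerivAt
  have h5 : fderiv ℝ (fun w => (f w)⁻¹) v = _ :=
    (((hasDerivAt_inv hf0).hasFDerivAt.restrictScalars ℝ).comp v e).fderiv
  rw [h3.fderiv, h5]
  simp [h4]
  ring

/-- Poincaré lemma on the convex set `V`; smoothness of the primitive follows from that of its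
derivative. -/
theorem exists_primitive {β : V → V →L[ℝ] ℂ} (hβ : ContDiff ℝ ∞ β)
    (hs : ∀ v x y, fderiv ℝ β v x y = fderiv ℝ β v y x) :
    ∃ Φ : V → ℂ, ContDiff ℝ ∞ Φ ∧ ∀ v, HasFDerivAt Φ (β v) v := by
  obtain ⟨Φ, hΦ⟩ := (convex_univ (𝕜 := ℝ) (E := V)).exists_forall_hasFDerivAt_of_fderiv_symmetric
    isOpen_univ (hβ.differentiable (by simp)).differentiableOn (fun v _ => hs v)
  refine ⟨Φ, ?_, fun v => hΦ v trivial⟩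
  rw [contDiff_infty_iff_fderiv]
  refine ⟨fun v => (hΦ v trivial).differentiableAt, ?_⟩
  rwa [funext fun v => (hΦ v trivial).fderiv]

theorem sub_eq_sub_of_hasFDerivAt {F : Type v} [NormedAddCommGroup F] [NormedSpace ℝ F]
    {f g : V → F} {L : V → V →L[ℝ] F} (hf : ∀ v, HasFDerivAt f (L v) v)
    (hg : ∀ v, HasFDerivAt g (L v) v) (v w : V) : f v - g v = f w - g w := by
  have h : ∀ v, HasFDerivAt (fun v => f v - g v) (0 : V →L[ℝ] F) v := fun v => by
    simpa using! (hf v).sub (hg v)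
  exact is_const_of_fderiv_eq_zero (𝕜 := ℝ) (fun v => (h v).differentiableAt)
    (fun v => (h v).fderiv) v w

end Calculus

/-! ### Periodic forms: periods and constant representatives. -/

section Lattice

open Module

variable {V : Type u} [NormedAddCommGroup V] [NormedSpace ℝ V] [FiniteDimensional ℝ V]
variable (Λ : Submodule ℤ V) [DiscreteTopology Λ] [IsZLattice ℝ Λ]

/-- A `ℤ`-basis of a full lattice is an `ℝ`-basis of the space. This carries the results on
`latticeOf b` over to `Λ`. -/
theorem exists_basis_latticeOf_eq :
    ∃ (n : ℕ) (b : Basis (Fin n) ℝ V), LatticeFourier.latticeOf b = Λ := by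
  have : Module.Finite ℤ Λ := ZLattice.module_finite ℝ Λ
  have : Module.Free ℤ Λ := ZLattice.module_free ℝ Λ
  exact ⟨_, (Module.finBasis ℤ Λ).ofZLatticeBasis ℝ Λ,
    (Module.finBasis ℤ Λ).ofZLatticeBasis_span ℝ⟩

variable {Λ}

theorem clm_eq_of_eqOn_lattice {F : Type v} [NormedAddCommGroup F] [NormedSpace ℝ F]
    {r s : V →L[ℝ] F} (h : ∀ l ∈ Λ, r l = s l) : r = s := by
  obtain ⟨n, b, rfl⟩ := exists_basis_latticeOf_eq Λ
  refine ContinuousLinearMap.coe_injective (b.ext fun i => ?_)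
  exact h _ (Submodule.subset_span ⟨i, rfl⟩)

/-- Prescribing the values on a lattice basis determines a real linear map, and additivity forces
agreement on all of `Λ`. It is used to turn periods into a constant form. -/
theorem exists_clm_of_additive {c : V → ℂ} (h : ∀ l ∈ Λ, ∀ m ∈ Λ, c (l + m) = c l + c m) :
    ∃ r : V →L[ℝ] ℂ, ∀ l ∈ Λ, r l = c l := by
  obtain ⟨n, b, rfl⟩ := exists_basis_latticeOf_eq Λ
  let g : LatticeFourier.latticeOf b →+ ℂ := AddMonoidHom.mk' (fun l => c l)
    fun l m => h l l.2 m m.2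
  refine ⟨LinearMap.toContinuousLinearMap (b.constr ℝ fun i => c (b i)), fun l hl => ?_⟩
  induction hl using Submodule.span_induction with
  | mem x hx =>
    obtain ⟨i, rfl⟩ := hx
    simp
  | zero =>
    have : c 0 = 0 := g.map_zero
    simp [this]
  | add x y hx hy h1 h2 => rw [map_add, h1, h2, h x hx y hy]
  | smul a x hx h1 =>
    have : c (a • x) = a • c x := map_zsmul g a ⟨x, hx⟩
    rw [map_zsmul, h1, this]

/-- `f - r` is constant and `f` is periodic, so `r` vanishes on `Λ`, which spans `V`. -/
theorem eq_zero_of_periodic_of_hasFDerivAt_const {F : Type v} [NormedAddCommGroup F]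
    [NormedSpace ℝ F] {f : V → F} (hp : IsPeriodic Λ f) {r : V →L[ℝ] F}
    (hf : ∀ v, HasFDerivAt f r v) : r = 0 := by
  refine clm_eq_of_eqOn_lattice (Λ := Λ) fun l hl => ?_
  have h := sub_eq_sub_of_hasFDerivAt hf (fun v => r.hasFDerivAt) (0 + l) 0
  rw [hp 0 l hl, zero_add, map_zero] at h
  simpa using h

/-- A closed periodic form is the sum of a constant form and the differential of a periodic
function. -/
theorem exists_eq_const_add_fderiv {β : V → V →L[ℝ] ℂ} (hβ : ContDiff ℝ ∞ β)
    (hp : IsPeriodic Λ β) (hs : ∀ v x y, fderiv ℝ β v x y = fderiv ℝ β v y x) :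
    ∃ (r : V →L[ℝ] ℂ) (ψ : V → ℂ), ContDiff ℝ ∞ ψ ∧ IsPeriodic Λ ψ ∧
      ∀ v, HasFDerivAt ψ (β v - r) v := by
  obtain ⟨Φ, hΦ, hΦ'⟩ := exists_primitive hβ hs
  -- The period of `Φ` along `l` does not depend on the base point, hence is additive in `l`.
  have key : ∀ l ∈ Λ, ∀ v, Φ (v + l) - Φ v = Φ l - Φ 0 := by
    intro l hl v
    have h : ∀ v, HasFDerivAt (fun v => Φ (v + l)) (β v) v := fun v => by
      rw [← hp v l hl]
      exact (hasFDerivAt_comp_add_right l).mpr (hΦ' (v + l))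
    simpa using sub_eq_sub_of_hasFDerivAt h hΦ' v 0
  obtain ⟨r, hr⟩ := exists_clm_of_additive (Λ := Λ) (c := fun l => Φ l - Φ 0) (by
    intro l hl m hm
    have := key m hm l
    linear_combination this)
  refine ⟨r, fun v => Φ v - r v, hΦ.sub r.contDiff, fun v l hl => ?_, fun v =>
    (hΦ' v).sub r.hasFDerivAt⟩
  have h1 := key l hl v
  have h2 := hr l hl
  simp only [map_add]
  linear_combination h1 - h2

/-- A constant `2`-form on a torus is zero if it is exact. -/
theorem fderiv_symm_of_const {β : V → V →L[ℝ] ℂ} (hβ : ContDiff ℝ ∞ β)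
    (hp : IsPeriodic Λ β) (hs : ∀ v x y, fderiv ℝ β v x y - fderiv ℝ β v y x =
      fderiv ℝ β 0 x y - fderiv ℝ β 0 y x) (v x y : V) :
    fderiv ℝ β v x y = fderiv ℝ β v y x := by
  let σ : V →L[ℝ] V →L[ℝ] ℂ := fderiv ℝ β 0 - (fderiv ℝ β 0).flip
  have hσ : ∀ x y, σ x y = fderiv ℝ β 0 x y - fderiv ℝ β 0 y x := fun x y => rfl
  -- The linear form `v ↦ (1/2) σ v` has exterior derivative `σ`, by antisymmetry, so `γ` is closed.
  let γ : V → V →L[ℝ] ℂ := fun v => β v - (1 / 2 : ℝ) • σ v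
  have hγd : ∀ v, HasFDerivAt γ (fderiv ℝ β v - (1 / 2 : ℝ) • σ) v := fun v =>
    ((hβ.differentiable (by simp) v).hasFDerivAt).sub (σ.hasFDerivAt.const_smul (1 / 2 : ℝ))
  obtain ⟨Φ, -, hΦ⟩ := exists_primitive (β := γ) (hβ.sub (σ.contDiff.const_smul (1 / 2 : ℝ))) (by
    intro v x y
    rw [(hγd v).fderiv]
    have h1 := hs v x y
    simp only [sub_apply, smul_apply, hσ, Complex.real_smul]
    push_cast
    linear_combination h1)
  have key : ∀ l ∈ Λ, ∀ v, Φ (v + l) = Φ v - (1 / 2 : ℝ) • σ l v + (Φ l - Φ 0) := by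
    intro l hl v
    have h : ∀ v, HasFDerivAt (fun v => Φ (v + l)) (γ (v + l)) v := fun v =>
      (hasFDerivAt_comp_add_right l).mpr (hΦ (v + l))
    have h' : ∀ v, HasFDerivAt (fun v => Φ v - (1 / 2 : ℝ) • σ l v) (γ (v + l)) v := fun v => by
      have e : γ (v + l) = γ v - (1 / 2 : ℝ) • σ l := by
        simp only [γ, hp v l hl, map_add, smul_add]
        abel
      rw [e]
      exact (hΦ v).sub ((σ l).hasFDerivAt.const_smul (1 / 2 : ℝ))
    have := sub_eq_sub_of_hasFDerivAt h h' v 0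
    simp only [zero_add, map_zero, smul_zero, sub_zero] at this
    linear_combination this
  -- Computing `Φ (l + m)` in both orders gives `σ l m = σ m l`; antisymmetry makes this zero on the
  -- lattice.
  have hσ0 : σ = 0 := by
    refine clm_eq_of_eqOn_lattice (Λ := Λ) fun l hl =>
      clm_eq_of_eqOn_lattice (Λ := Λ) fun m hm => ?_
    have h1 := key l hl m
    have h2 := key m hm l
    have h3 : Φ (m + l) = Φ (l + m) := by rw [add_comm]
    simp only [hσ, Complex.real_smul] at h1 h2 ⊢
    push_cast at h1 h2
    simp
    linear_combination h1 - h2 - h3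
  have h := hs v x y
  rw [← hσ, hσ0] at h
  exact sub_eq_zero.mp (by simpa using h)

end Lattice

/-! ### Functions and forms on the quotient: descent, gluing, exterior derivative. -/

namespace ComplexTorus

section Basic

variable {V : Type u} [NormedAddCommGroup V] [NormedSpace ℂ V] {Λ : Submodule ℤ V}

theorem proj_surjective : Function.Surjective (proj Λ) := Submodule.Quotient.mk_surjective _

theorem proj_eq_iff {v w : V} : proj Λ v = proj Λ w ↔ v - w ∈ Λ := Submodule.Quotient.eq _

theorem proj_add_of_mem (v : V) {l : V} (hl : l ∈ Λ) : proj Λ (v + l) = proj Λ v :=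
  proj_eq_iff.mpr (by simpa using hl)

theorem isOpenMap_proj : IsOpenMap (proj Λ) := Submodule.isOpenMap_mkQ Λ

theorem isPeriodic_comp_proj {α : Type v} (f : V ⧸ Λ → α) :
    IsPeriodic Λ (fun v => f (proj Λ v)) := fun v l hl => by
  simp only [proj_add_of_mem v hl]

theorem exists_comp_proj_eq {α : Type v} {f : V → α} (hf : IsPeriodic Λ f) :
    ∃ g : V ⧸ Λ → α, ∀ v, g (proj Λ v) = f v := by
  refine ⟨fun x => f (Function.surjInv proj_surjective x), fun v => ?_⟩
  have h := proj_eq_iff.mp (Function.surjInv_eq (proj_surjective (Λ := Λ)) (proj Λ v)).symm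
  have h1 := hf (Function.surjInv proj_surjective (proj Λ v)) _ h
  rw [add_sub_cancel] at h1
  exact h1.symm

theorem eventually_proj_mem {U : Set (V ⧸ Λ)} (hU : IsOpen U) {v : V} (hv : proj Λ v ∈ U) :
    ∀ᶠ w in 𝓝 v, proj Λ w ∈ U :=
  (continuous_proj Λ).continuousAt.eventually_mem (hU.mem_nhds hv)

variable {F : Type v} [NormedAddCommGroup F] [NormedSpace ℝ F]

theorem smoothAt_of_forall {f : V ⧸ Λ → F} (h : ContDiff ℝ ∞ fun v => f (proj Λ v))
    (x : V ⧸ Λ) : SmoothAt f x := by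
  rintro v rfl
  exact h.contDiffAt

theorem contDiff_of_smoothAt {f : V ⧸ Λ → F} (h : ∀ x, SmoothAt f x) :
    ContDiff ℝ ∞ fun v => f (proj Λ v) :=
  contDiff_iff_contDiffAt.mpr fun v => h _ v rfl

theorem exists_descent {f : V → F} (hf : IsPeriodic Λ f) (hs : ContDiff ℝ ∞ f) :
    ∃ g : V ⧸ Λ → F, (∀ v, g (proj Λ v) = f v) ∧ ∀ x, SmoothAt g x := by
  obtain ⟨g, hg⟩ := exists_comp_proj_eq hf
  refine ⟨g, hg, smoothAt_of_forall ?_⟩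
  rwa [funext hg]

theorem SmoothAt.comp_contDiff {G : Type v} [NormedAddCommGroup G] [NormedSpace ℝ G] {f : V ⧸ Λ → F}
    {x : V ⧸ Λ} (hf : SmoothAt f x) {k : F → G} (hk : ContDiff ℝ ∞ k) :
    SmoothAt (fun y => k (f y)) x := fun v hv => hk.contDiffAt.comp v (hf v hv)

/-- Functions on the members of an open cover that agree on the overlaps glue. -/
theorem exists_glue {ι : Type v} {α : Type*} {U : ι → Set (V ⧸ Λ)} (hc : ∀ x, ∃ i, x ∈ U i)
    (a : ι → V ⧸ Λ → α) (h : ∀ i j x, x ∈ U i → x ∈ U j → a i x = a j x) :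
    ∃ f : V ⧸ Λ → α, ∀ i x, x ∈ U i → f x = a i x := by
  choose k hk using hc
  exact ⟨fun x => a (k x) x, fun i x hx => h _ _ x (hk x) hx⟩

theorem smoothAt_of_eqOn {f g : V ⧸ Λ → F} {U : Set (V ⧸ Λ)} (hU : IsOpen U)
    (h : ∀ x ∈ U, f x = g x) {x : V ⧸ Λ} (hx : x ∈ U) (hg : SmoothAt g x) : SmoothAt f x :=
  hg.congr (by filter_upwards [hU.mem_nhds hx] with y hy using (h y hy).symm)

/-- A global smooth function obtained by gluing. -/
theorem exists_glue_smooth {ι : Type u} {U : ι → Set (V ⧸ Λ)} (hU : ∀ i, IsOpen (U i))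
    (hc : ∀ x, ∃ i, x ∈ U i) (a : ι → V ⧸ Λ → F) (hs : ∀ i x, x ∈ U i → SmoothAt (a i) x)
    (h : ∀ i j x, x ∈ U i → x ∈ U j → a i x = a j x) :
    ∃ f : V ⧸ Λ → F, (∀ x, SmoothAt f x) ∧ ∀ i x, x ∈ U i → f x = a i x := by
  obtain ⟨f, hf⟩ := exists_glue hc a h
  refine ⟨f, fun x => ?_, hf⟩
  obtain ⟨i, hi⟩ := hc x
  exact smoothAt_of_eqOn (hU i) (hf i) hi (hs i x hi)

theorem eventuallyEq_comp_proj {α : Type v} {f g : V ⧸ Λ → α} {U : Set (V ⧸ Λ)} (hU : IsOpen U)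
    (h : ∀ x ∈ U, f x = g x) {v : V} (hv : proj Λ v ∈ U) :
    (fun w => f (proj Λ w)) =ᶠ[𝓝 v] fun w => g (proj Λ w) := by
  filter_upwards [eventually_proj_mem hU hv] with w hw using h _ hw

theorem dOne_apply {a : V ⧸ Λ → V →L[ℝ] ℂ} {v : V}
    (ha : DifferentiableAt ℝ (fun w => a (proj Λ w)) v) (x y : V) :
    dOne a v ![x, y] = fderiv ℝ (fun w => a (proj Λ w)) v x y -
      fderiv ℝ (fun w => a (proj Λ w)) v y x := by
  have h1 : ∀ z : V, fderiv ℝ (fun w => a (proj Λ w) z) v =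
      (ContinuousLinearMap.apply ℝ ℂ z).comp (fderiv ℝ (fun w => a (proj Λ w)) v) := fun z =>
    ((ContinuousLinearMap.apply ℝ ℂ z).hasFDerivAt.comp v ha.hasFDerivAt).fderiv
  rw [dOne, extDeriv_apply]
  · simp [Fin.sum_univ_two, h1, Fin.removeNth]
    ring
  · exact ((ContinuousAlternatingMap.ofSubsingletonLIE (𝕜 := ℝ) (E := V) (F := ℂ) (i := (0 : Fin 1))).toContinuousLinearEquiv
      |>.differentiableAt).comp v ha

theorem SmoothAt.differentiableAt {f : V ⧸ Λ → F} {v : V} (h : SmoothAt f (proj Λ v)) :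
    DifferentiableAt ℝ (fun w => f (proj Λ w)) v :=
  (h v rfl).differentiableAt (by simp)

theorem alternating_ext {F G : V [⋀^Fin 2]→L[ℝ] ℂ} (h : ∀ x y, F ![x, y] = G ![x, y]) :
    F = G := by
  ext w
  have : w = ![w 0, w 1] := by
    ext i
    fin_cases i <;> rfl
  rw [this]
  exact h _ _

end Basic

/-! ### Compactness, bump functions and Hermitian metrics. -/

section Compact

variable {V : Type u} [NormedAddCommGroup V] [NormedSpace ℂ V] [FiniteDimensional ℂ V]
variable (Λ : Submodule ℤ V) [DiscreteTopology Λ] [IsZLattice ℝ Λ]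

theorem compactSpace_quotient : CompactSpace (V ⧸ Λ) := by
  have : FiniteDimensional ℝ V := FiniteDimensional.complexToReal V
  have h := IsZLattice.isCompact_range_of_periodic Λ (proj Λ) (continuous_proj Λ)
    fun z w hw => proj_add_of_mem z hw
  rw [proj_surjective.range_eq] at h
  exact ⟨h⟩

variable {Λ}

/-- For every open neighbourhood of a point there is a smooth nonnegative function that is
supported in it and positive at the point. -/
theorem exists_bump {U : Set (V ⧸ Λ)} (hU : IsOpen U) {x : V ⧸ Λ} (hx : x ∈ U) :
    ∃ ρ : V ⧸ Λ → ℝ, (∀ y, SmoothAt ρ y) ∧ (∀ y, 0 ≤ ρ y) ∧ 0 < ρ x ∧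
      ∀ y ∉ U, ∀ᶠ z in 𝓝 y, ρ z = 0 := by
  have : FiniteDimensional ℝ V := FiniteDimensional.complexToReal V
  have := compactSpace_quotient Λ
  obtain ⟨v₀, rfl⟩ := proj_surjective x
  obtain ⟨n, b, hb⟩ := exists_basis_latticeOf_eq Λ
  -- Each summand is `1 - cos (2π x_j)` in the coordinates of `v - v₀`, so `p` is periodic,
  -- nonnegative and zero exactly on `v₀ + Λ`.
  let p : V → ℝ := fun v => ∑ j : Fin n,
    (1 - (LatticeFourier.char b (Pi.single j 1) (v - v₀)).re)
  have hps : ContDiff ℝ ∞ p := ContDiff.sum fun j _ => contDiff_const.sub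
    (Complex.reCLM.contDiff.comp ((LatticeFourier.contDiff_char _).comp
      (contDiff_id.sub contDiff_const)))
  have hpp : IsPeriodic Λ p := fun v l hl => by
    rw [← hb] at hl
    simp only [p, show v + l - v₀ = v - v₀ + l by abel,
      LatticeFourier.char_periodic _ (v - v₀) l hl]
  have hterm : ∀ j w, 0 ≤ 1 - (LatticeFourier.char b (Pi.single j 1) w).re := fun j w => by
    have := Complex.re_le_norm (LatticeFourier.char b (Pi.single j 1) w)
    rw [LatticeFourier.norm_char] at this
    linarith
  have hzero : ∀ v, p v = 0 → proj Λ v = proj Λ v₀ := by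
    intro v hv
    have h1 := (Finset.sum_eq_zero_iff_of_nonneg (fun j _ => hterm j (v - v₀))).mp hv
    have h2 : ∀ j, ∃ k : ℤ, b.repr (v - v₀) j = k := by
      intro j
      have h3 := h1 j (Finset.mem_univ j)
      have h4 : LatticeFourier.lin b (Pi.single j 1) (v - v₀) = b.repr (v - v₀) j := by
        simp [LatticeFourier.lin_apply, Pi.single_apply]
      rw [LatticeFourier.char, h4, show (2 * Real.pi * Complex.I * (b.repr (v - v₀) j : ℝ) : ℂ) =
        ((2 * Real.pi * b.repr (v - v₀) j : ℝ) : ℂ) * Complex.I by push_cast; ring,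
        Complex.exp_ofReal_mul_I_re] at h3
      obtain ⟨k, hk⟩ := (Real.cos_eq_one_iff _).mp (by linarith)
      refine ⟨k, ?_⟩
      have hpi := Real.pi_pos
      have : 2 * Real.pi * (b.repr (v - v₀) j - k) = 0 := by linarith
      have := (mul_eq_zero.mp this).resolve_left (by positivity)
      linarith
    choose k hk using h2
    refine proj_eq_iff.mpr ?_
    rw [← hb, ← b.sum_repr (v - v₀)]
    refine Submodule.sum_mem _ fun j _ => ?_
    rw [hk j, Int.cast_smul_eq_zsmul]
    exact Submodule.smul_mem _ _ (Submodule.subset_span ⟨j, rfl⟩)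
  obtain ⟨P, hP, hPs⟩ := exists_descent hpp hps
  have hPc : Continuous P := by
    have : Continuous fun v => P (proj Λ v) := (contDiff_of_smoothAt hPs).continuous
    exact (IsOpenQuotientMap.mk proj_surjective (continuous_proj Λ)
      isOpenMap_proj).isQuotientMap.continuous_iff.mpr this
  have hP0 : ∀ y, 0 ≤ P y := fun y => by
    obtain ⟨v, rfl⟩ := proj_surjective y
    rw [hP]
    exact Finset.sum_nonneg fun j _ => hterm j _
  -- `P` attains a minimum on the compact complement of `U`, and its only zero lies in `U`.
  obtain ⟨ε, hε, hεU⟩ : ∃ ε > 0, ∀ y ∉ U, ε ≤ P y := by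
    rcases (Uᶜ).eq_empty_or_nonempty with he | hne
    · exact ⟨1, one_pos, fun y hy => absurd (show y ∈ Uᶜ from hy) (by simp [he])⟩
    · obtain ⟨y₀, hy₀, hmin⟩ := hU.isClosed_compl.isCompact.exists_isMinOn hne hPc.continuousOn
      refine ⟨P y₀, lt_of_le_of_ne (hP0 y₀) fun h => hy₀ ?_, fun y hy => hmin hy⟩
      obtain ⟨w, rfl⟩ := proj_surjective y₀
      rw [hP] at h
      rwa [hzero w h.symm]
  -- The threshold `ε / 2` instead of `ε` makes the function vanish in a neighbourhood of every
  -- point outside `U`.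
  refine ⟨fun y => Real.smoothTransition (ε / 2 - P y), fun y => ?_, fun y =>
    Real.smoothTransition.nonneg _, ?_, fun y hy => ?_⟩
  · exact SmoothAt.comp_contDiff (hPs y)
      (Real.smoothTransition.contDiff.comp (contDiff_const.sub contDiff_id))
  · have : P (proj Λ v₀) = 0 := by
      rw [hP]
      simp [p, LatticeFourier.char]
    simp only [this]
    exact Real.smoothTransition.pos_of_pos (by linarith)
  · have h1 : ε / 2 < P y := lt_of_lt_of_le (by linarith) (hεU y hy)
    filter_upwards [hPc.continuousAt.eventually (lt_mem_nhds h1)] with z hz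
    exact Real.smoothTransition.zero_of_nonpos (by linarith)

/-- Every complex line bundle has a hermitian structure. -/
theorem exists_hermitianMetric (c : LineBundle Λ) : Nonempty (HermitianMetric c) := by
  have := compactSpace_quotient Λ
  choose k hk using c.cover
  choose ρ hρs hρ0 hρp hρz using fun x => exists_bump (c.isOpen_U (k x)) (hk x)
  have hcont : ∀ x, Continuous (ρ x) := fun x =>
    (IsOpenQuotientMap.mk proj_surjective (continuous_proj Λ)
      isOpenMap_proj).isQuotientMap.continuous_iff.mpr
        (contDiff_of_smoothAt (hρs x)).continuous
  obtain ⟨t, ht⟩ := isCompact_univ.elim_finite_subcover (fun x => {y | 0 < ρ x y})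
    (fun x => isOpen_lt continuous_const (hcont x))
    (fun x _ => Set.mem_iUnion.mpr ⟨x, hρp x⟩)
  -- The standard metric of the trivialization `k x`, expressed in the trivialization `i`, is
  -- weighted by a bump function supported in `U (k x)`. A sum of such terms needs no normalization.
  refine ⟨⟨fun i y => ∑ x ∈ t, ρ x y * ‖c.g (k x) i y‖ ^ 2, ?_, ?_, ?_⟩⟩
  · intro i y hy
    obtain ⟨x, hx, hxy⟩ := Set.mem_iUnion₂.mp (ht (Set.mem_univ y))
    have hyk : y ∈ c.U (k x) := by
      by_contra h
      have := (hρz x y h).self_of_nhds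
      exact absurd hxy (by simp [this])
    refine Finset.sum_pos' (fun x _ => mul_nonneg (hρ0 x y) (by positivity)) ⟨x, hx, ?_⟩
    have := norm_pos_iff.mpr (c.mem_g (k x) i y hyk hy).1
    exact mul_pos hxy (by positivity)
  · intro i y hy v hv
    refine ContDiffAt.sum fun x _ => ?_
    by_cases h : y ∈ c.U (k x)
    · exact (hρs x y v hv).mul (((c.mem_g (k x) i y h hy).2 v hv).norm_sq ℂ)
    · subst hv
      refine contDiffAt_const (c := 0) |>.congr_of_eventuallyEq ?_
      filter_upwards [(continuous_proj Λ).continuousAt.eventually (hρz x _ h)] with w hw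
      rw [hw, zero_mul]
  · intro i j y hi hj
    rw [Finset.sum_mul]
    refine Finset.sum_congr rfl fun x _ => ?_
    by_cases h : y ∈ c.U (k x)
    · rw [← c.cocycle (k x) i j y h hi hj, norm_mul]
      ring
    · rw [(hρz x y h).self_of_nhds]
      ring

end Compact

end ComplexTorus

/-! ### Conjugation and `(0,1)`-parts of complex valued forms. -/

section ComplexForms

variable {V : Type u} [NormedAddCommGroup V] [NormedSpace ℂ V]

/-- Complex conjugation of complex valued forms. -/
noncomputable def conjForm : (V →L[ℝ] ℂ) →L[ℝ] (V →L[ℝ] ℂ) :=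
  ContinuousLinearMap.compL ℝ V ℂ ℂ (Complex.conjCLE : ℂ →L[ℝ] ℂ)

@[simp]
theorem conjForm_apply (a : V →L[ℝ] ℂ) (w : V) : conjForm a w = conj (a w) := rfl

/-- Multiplication by `I` as a real linear map. -/
noncomputable def mulI : V →L[ℝ] V :=
  (Complex.I • ContinuousLinearMap.id ℂ V).restrictScalars ℝ

/-- The part of type `(0,1)` of a complex valued form. -/
noncomputable def antiForm : (V →L[ℝ] ℂ) →L[ℝ] (V →L[ℝ] ℂ) :=
  (1 / 2 : ℂ) • (ContinuousLinearMap.id ℝ (V →L[ℝ] ℂ) +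
    Complex.I • (ContinuousLinearMap.compL ℝ V V ℂ).flip mulI)

@[simp]
theorem antiForm_apply (a : V →L[ℝ] ℂ) (w : V) :
    antiForm a w = 1 / 2 * (a w + Complex.I * a (Complex.I • w)) := rfl

theorem fderiv_continuousLinearMap_comp_apply {W F G : Type*} [NormedAddCommGroup W] [NormedSpace ℝ W]
    [NormedAddCommGroup F] [NormedSpace ℝ F] [NormedAddCommGroup G] [NormedSpace ℝ G]
    (T : F →L[ℝ] G) {f : W → F} {v : W} (hf : DifferentiableAt ℝ f v) (x : W) :
    fderiv ℝ (fun w => T (f w)) v x = T (fderiv ℝ f v x) := by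
  have h : HasFDerivAt (fun w => T (f w)) (T.comp (fderiv ℝ f v)) v :=
    T.hasFDerivAt.comp v hf.hasFDerivAt
  rw [h.fderiv]
  rfl

theorem dlog_conj {f : V → ℂ} {v : V} (hf : DifferentiableAt ℝ f v) :
    dlog (fun w => conj (f w)) v = conjForm (dlog f v) := by
  ext w
  have h := fderiv_continuousLinearMap_comp_apply (Complex.conjCLE : ℂ →L[ℝ] ℂ) hf w
  simp only [ContinuousLinearEquiv.coe_coe, Complex.conjCLE_apply] at h
  simp [dlog, h]

end ComplexForms

/-! ### Connections: differences, curvature and unitarity. -/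

namespace ComplexTorus

section Forms

variable {V : Type u} [NormedAddCommGroup V] [NormedSpace ℂ V] {Λ : Submodule ℤ V}

/-- The logarithmic derivative of a function on the torus, as a form on the torus. -/
noncomputable def dlogForm (f : V ⧸ Λ → ℂ) (x : V ⧸ Λ) : V →L[ℝ] ℂ :=
  dlog (fun w => f (proj Λ w)) (Function.surjInv proj_surjective x)

theorem isPeriodic_fderiv {F : Type v} [NormedAddCommGroup F] [NormedSpace ℝ F] {f : V → F}
    (hf : IsPeriodic Λ f) : IsPeriodic Λ (fderiv ℝ f) := by
  intro v l hl
  have h : (fun w => f (w + l)) = f := funext fun w => hf w l hl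
  rw [← fderiv_comp_add_right, h]

theorem eq_of_isPeriodic_of_proj_eq {α : Type v} {f : V → α} (hf : IsPeriodic Λ f) {v w : V}
    (h : proj Λ v = proj Λ w) : f v = f w := by
  have := hf w _ (proj_eq_iff.mp h)
  rwa [add_sub_cancel] at this

/-- The choice of a lift in `dlogForm` is immaterial because the logarithmic derivative of a
periodic function is periodic. -/
theorem dlogForm_proj (f : V ⧸ Λ → ℂ) (v : V) :
    dlogForm f (proj Λ v) = dlog (fun w => f (proj Λ w)) v := by
  refine eq_of_isPeriodic_of_proj_eq (Λ := Λ) (fun v l hl => ?_) (Function.surjInv_eq _ _)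
  simp only [dlog, proj_add_of_mem v hl]
  rw [isPeriodic_fderiv (isPeriodic_comp_proj f) v l hl]

theorem SmoothAt.dlogForm {f : V ⧸ Λ → ℂ} {x : V ⧸ Λ} (hf : SmoothAt f x) (h0 : f x ≠ 0) :
    SmoothAt (dlogForm f) x := by
  rintro v rfl
  simp only [dlogForm_proj]
  exact ContDiffAt.dlog (hf v rfl) h0

/-- A form on the torus is closed. -/
def IsClosedForm (a : V ⧸ Λ → V →L[ℝ] ℂ) : Prop :=
  ∀ v x y, fderiv ℝ (fun w => a (proj Λ w)) v x y = fderiv ℝ (fun w => a (proj Λ w)) v y x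

theorem isPeriodic_dOne (a : V ⧸ Λ → V →L[ℝ] ℂ) : IsPeriodic Λ (dOne a) := by
  intro v l hl
  rw [dOne, dOne, extDeriv, extDeriv, isPeriodic_fderiv (Λ := Λ) _ v l hl]
  exact isPeriodic_comp_proj (fun x => ContinuousAlternatingMap.ofSubsingleton ℝ V ℂ (0 : Fin 1)
    (a x))

namespace Connection

variable {c : LineBundle Λ}

/-- The sum of a connection and a global form. -/
noncomputable def addForm (D : Connection c) (τ : V ⧸ Λ → V →L[ℝ] ℂ) (hτ : ∀ x, SmoothAt τ x) :
    Connection c where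
  A i x := D.A i x + τ x
  smooth i x hx v hv := (D.smooth i x hx v hv).add (hτ x v hv)
  transform i j v hi hj := by
    rw [D.transform i j v hi hj]
    abel

theorem transform_dlog (D : Connection c) {i j : c.ι} {v : V} (hi : proj Λ v ∈ c.U i)
    (hj : proj Λ v ∈ c.U j) :
    D.A j (proj Λ v) = D.A i (proj Λ v) + dlog (fun w => c.g i j (proj Λ w)) v :=
  D.transform i j v hi hj

theorem differentiableAt (D : Connection c) {i : c.ι} {v : V} (hi : proj Λ v ∈ c.U i) :
    DifferentiableAt ℝ (fun w => D.A i (proj Λ w)) v :=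
  (D.smooth i _ hi).differentiableAt

theorem HasCurvature.addForm {D : Connection c} {F : V ⧸ Λ → V [⋀^Fin 2]→L[ℝ] ℂ}
    (hF : D.HasCurvature F) {τ : V ⧸ Λ → V →L[ℝ] ℂ} (hτ : ∀ x, SmoothAt τ x)
    {G : V ⧸ Λ → V [⋀^Fin 2]→L[ℝ] ℂ} (hG : ∀ v, G (proj Λ v) = dOne τ v) :
    (D.addForm τ hτ).HasCurvature (fun x => F x + G x) := by
  intro i v hi
  refine alternating_ext fun x y => ?_
  have h1 : DifferentiableAt ℝ (fun w => D.A i (proj Λ w)) v := D.differentiableAt hi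
  have h2 : DifferentiableAt ℝ (fun w => τ (proj Λ w)) v := (hτ _).differentiableAt
  rw [dOne_apply (h1.add h2), ContinuousAlternatingMap.add_apply, hF i v hi, hG v,
    dOne_apply h1, dOne_apply h2]
  have e : fderiv ℝ (fun w => (D.addForm τ hτ).A i (proj Λ w)) v = _ := fderiv_add h1 h2
  rw [e]
  simp only [add_apply]
  ring

theorem HasCurvature.addForm_of_isClosed {D : Connection c} {F : V ⧸ Λ → V [⋀^Fin 2]→L[ℝ] ℂ}
    (hF : D.HasCurvature F) {τ : V ⧸ Λ → V →L[ℝ] ℂ} (hτ : ∀ x, SmoothAt τ x)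
    (hc : IsClosedForm τ) : (D.addForm τ hτ).HasCurvature F := by
  have h := hF.addForm hτ (G := fun _ => 0) fun v => alternating_ext fun x y => by
    rw [dOne_apply (hτ _).differentiableAt, hc v x y, sub_self]
    rfl
  simpa using h

theorem IsEFlat.addForm {D : Connection c} {E : V → V → ℝ} (hD : D.IsEFlat E)
    {τ : V ⧸ Λ → V →L[ℝ] ℂ} (hτ : ∀ x, SmoothAt τ x) (hc : IsClosedForm τ) :
    (D.addForm τ hτ).IsEFlat E := by
  obtain ⟨h, F, hF, hinv⟩ := hD
  exact ⟨h, F, hF.addForm_of_isClosed hτ hc, hinv⟩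

/-- `ρ` is a positive function whose logarithmic derivative is twice the real part of `τ`. -/
structure IsScaling (ρ : V ⧸ Λ → ℝ) (τ : V ⧸ Λ → V →L[ℝ] ℂ) : Prop where
  smooth : ∀ x, SmoothAt ρ x
  pos : ∀ x, 0 < ρ x
  fderiv_eq : ∀ v w, ((fderiv ℝ (fun y => ρ (proj Λ y)) v w : ℝ) : ℂ) =
    ρ (proj Λ v) * (τ (proj Λ v) w + conj (τ (proj Λ v) w))

/-- Multiplying the metric by `ρ` adds `d log ρ = τ + conj τ` to its logarithmic derivative. -/
theorem IsUnitary.addForm {D : Connection c} (hD : D.IsUnitary) {τ : V ⧸ Λ → V →L[ℝ] ℂ}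
    (hτ : ∀ x, SmoothAt τ x) {ρ : V ⧸ Λ → ℝ} (hρ : IsScaling ρ τ) :
    (D.addForm τ hτ).IsUnitary := by
  obtain ⟨m, hm⟩ := hD
  refine ⟨⟨fun i x => m.h i x * ρ x, fun i x hx => mul_pos (m.pos i x hx) (hρ.pos x),
    fun i x hx v hv => (m.smooth i x hx v hv).mul (hρ.smooth x v hv), fun i j x hi hj => by
      rw [m.transform i j x hi hj]; ring⟩, ?_⟩
  intro i v hi w
  have h1 := hm i v hi w
  have h2 := hρ.fderiv_eq v w
  have e1 : DifferentiableAt ℝ (fun w => m.h i (proj Λ w)) v := (m.smooth i _ hi).differentiableAt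
  have e2 : DifferentiableAt ℝ (fun w => ρ (proj Λ w)) v := (hρ.smooth _).differentiableAt
  change ((fderiv ℝ (fun y => m.h i (proj Λ y) * ρ (proj Λ y)) v w : ℝ) : ℂ) =
    ((m.h i (proj Λ v) * ρ (proj Λ v) : ℝ) : ℂ) * (D.A i (proj Λ v) w + τ (proj Λ v) w +
      conj (D.A i (proj Λ v) w + τ (proj Λ v) w))
  rw [fderiv_fun_mul e1 e2]
  simp only [add_apply, smul_apply, smul_eq_mul, map_add]
  push_cast
  rw [h1, h2]
  ring

/-- The logarithmic derivatives of the transition functions cancel in the difference, so the local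
forms glue. -/
theorem exists_sub (D D' : Connection c) : ∃ τ : V ⧸ Λ → V →L[ℝ] ℂ, (∀ x, SmoothAt τ x) ∧
    ∀ i x, x ∈ c.U i → D'.A i x = D.A i x + τ x := by
  obtain ⟨τ, h1, h2⟩ := exists_glue_smooth c.isOpen_U c.cover (fun i x => D'.A i x - D.A i x)
    (fun i x hx v hv => (D'.smooth i x hx v hv).sub (D.smooth i x hx v hv)) (by
      intro i j x hi hj
      obtain ⟨v, rfl⟩ := proj_surjective x
      rw [D.transform_dlog hi hj, D'.transform_dlog hi hj]
      abel)
  exact ⟨τ, h1, fun i x hx => by rw [h2 i x hx]; abel⟩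

/-- The ratio of the two Hermitian metrics is independent of the trivialization, and its logarithmic
derivative compares the two compatibility conditions. -/
theorem exists_isScaling {D D' : Connection c} (hD : D.IsUnitary) (hD' : D'.IsUnitary)
    {τ : V ⧸ Λ → V →L[ℝ] ℂ} (h : ∀ i x, x ∈ c.U i → D'.A i x = D.A i x + τ x) :
    ∃ ρ, IsScaling ρ τ := by
  obtain ⟨m, hm⟩ := hD
  obtain ⟨m', hm'⟩ := hD'
  obtain ⟨ρ, h1, h2⟩ := exists_glue_smooth c.isOpen_U c.cover (fun i x => m'.h i x / m.h i x)
    (fun i x hx v hv => (m'.smooth i x hx v hv).div (m.smooth i x hx v hv)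
      (by rw [hv]; exact (m.pos i x hx).ne')) (by
      intro i j x hi hj
      rw [m.transform i j x hi hj, m'.transform i j x hi hj,
        mul_div_mul_right _ _ (by simpa using (c.mem_g i j x hi hj).1)])
  refine ⟨ρ, h1, fun x => ?_, fun v w => ?_⟩
  · obtain ⟨i, hi⟩ := c.cover x
    rw [h2 i x hi]
    exact div_pos (m'.pos i x hi) (m.pos i x hi)
  · obtain ⟨i, hi⟩ := c.cover (proj Λ v)
    have e1 : DifferentiableAt ℝ (fun w => m.h i (proj Λ w)) v :=
      (m.smooth i _ hi).differentiableAt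
    have e2 : DifferentiableAt ℝ (fun w => ρ (proj Λ w)) v := (h1 _).differentiableAt
    have e3 : (fun w => m'.h i (proj Λ w)) =ᶠ[𝓝 v]
        fun w => m.h i (proj Λ w) * ρ (proj Λ w) := by
      refine eventuallyEq_comp_proj (g := fun x => m.h i x * ρ x) (c.isOpen_U i)
        (fun x hx => ?_) hi
      rw [h2 i x hx, mul_div_cancel₀ _ (m.pos i x hx).ne']
    have h3 := hm i v hi w
    have h4 := hm' i v hi w
    rw [e3.fderiv_eq, show m'.h i (proj Λ v) = _ from e3.self_of_nhds, fderiv_fun_mul e1 e2,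
      h i _ hi] at h4
    simp only [add_apply, smul_apply, smul_eq_mul, map_add] at h4
    push_cast at h4
    rw [h3] at h4
    have h5 : (m.h i (proj Λ v) : ℂ) ≠ 0 := Complex.ofReal_ne_zero.mpr (m.pos i _ hi).ne'
    refine mul_left_cancel₀ h5 ?_
    linear_combination h4

/-- `dτ` is the difference of two invariant curvatures, hence a constant form; being exact on the
torus, it is zero by `fderiv_symm_of_const`. -/
theorem isClosedForm_of_hasCurvature [FiniteDimensional ℂ V] [DiscreteTopology Λ]
    [IsZLattice ℝ Λ] {D D' : Connection c} {F F' : V ⧸ Λ → V [⋀^Fin 2]→L[ℝ] ℂ}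
    (hF : D.HasCurvature F) (hF' : D'.HasCurvature F') (hinv : ∀ x y, F (x + y) = F y)
    (hinv' : ∀ x y, F' (x + y) = F' y) {τ : V ⧸ Λ → V →L[ℝ] ℂ} (hτ : ∀ x, SmoothAt τ x)
    (h : ∀ i x, x ∈ c.U i → D'.A i x = D.A i x + τ x) : IsClosedForm τ := by
  have : FiniteDimensional ℝ V := FiniteDimensional.complexToReal V
  have key : ∀ v x y, fderiv ℝ (fun w => τ (proj Λ w)) v x y -
      fderiv ℝ (fun w => τ (proj Λ w)) v y x = F' 0 ![x, y] - F 0 ![x, y] := by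
    intro v x y
    obtain ⟨i, hi⟩ := c.cover (proj Λ v)
    have c1 : F (proj Λ v) = F 0 := by simpa using hinv (proj Λ v) 0
    have c2 : F' (proj Λ v) = F' 0 := by simpa using hinv' (proj Λ v) 0
    have h1 := D.differentiableAt hi
    have h2 : DifferentiableAt ℝ (fun w => τ (proj Λ w)) v := (hτ _).differentiableAt
    have e : (fun w => D'.A i (proj Λ w)) =ᶠ[𝓝 v] fun w => D.A i (proj Λ w) + τ (proj Λ w) :=
      eventuallyEq_comp_proj (g := fun x => D.A i x + τ x) (c.isOpen_U i) (h i) hi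
    rw [← c1, ← c2, hF i v hi, hF' i v hi, dOne_apply h1, dOne_apply (D'.differentiableAt hi),
      e.fderiv_eq, fderiv_fun_add h1 h2]
    simp only [add_apply]
    ring
  exact fun v x y => fderiv_symm_of_const (contDiff_of_smoothAt hτ) (isPeriodic_comp_proj τ)
    (fun v x y => by rw [key, key]) v x y

/-- The unitary connection obtained from a connection and a hermitian structure. -/
noncomputable def unitarize (D : Connection c) (m : HermitianMetric c) : Connection c where
  -- The imaginary part of `A` is kept and its real part is replaced by `(1/2) d log h`, as
  -- compatibility requires.
  A i x := (1 / 2 : ℝ) • (D.A i x - conjForm (D.A i x) + dlogForm (fun y => (m.h i y : ℂ)) x)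
  smooth i x hx v hv := by
    have h1 := D.smooth i x hx v hv
    have h2 : SmoothAt (fun y => (m.h i y : ℂ)) x :=
      fun v hv => Complex.ofRealCLM.contDiff.contDiffAt.comp v (m.smooth i x hx v hv)
    have h3 := h2.dlogForm (Complex.ofReal_ne_zero.mpr (m.pos i x hx).ne') v hv
    exact ((h1.sub (conjForm.contDiff.contDiffAt.comp v h1)).add h3).const_smul (1 / 2 : ℝ)
  transform i j v hi hj := by
    change _ = _ + dlog (fun w => c.g i j (proj Λ w)) v
    have hg := c.mem_g i j _ hi hj
    have dg : DifferentiableAt ℝ (fun w => c.g i j (proj Λ w)) v :=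
      SmoothAt.differentiableAt hg.2
    have dg' : DifferentiableAt ℝ (fun w => conj (c.g i j (proj Λ w))) v :=
      (Complex.conjCLE : ℂ →L[ℝ] ℂ).differentiableAt.comp v dg
    have dh : DifferentiableAt ℝ (fun w => (m.h i (proj Λ w) : ℂ)) v :=
      Complex.ofRealCLM.differentiableAt.comp v (m.smooth i _ hi).differentiableAt
    have hg' : conj (c.g i j (proj Λ v)) ≠ 0 := (map_ne_zero _).mpr hg.1
    have h0 : (m.h i (proj Λ v) : ℂ) ≠ 0 := Complex.ofReal_ne_zero.mpr (m.pos i _ hi).ne'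
    have e : (fun w => (m.h j (proj Λ w) : ℂ)) =ᶠ[𝓝 v] fun w => (m.h i (proj Λ w) : ℂ) *
        (c.g i j (proj Λ w) * conj (c.g i j (proj Λ w))) := by
      filter_upwards [eventually_proj_mem (c.isOpen_U i) hi,
        eventually_proj_mem (c.isOpen_U j) hj] with w h1 h2
      rw [m.transform i j _ h1 h2, Complex.mul_conj, Complex.normSq_eq_norm_sq]
      push_cast
      rfl
    rw [dlogForm_proj, dlogForm_proj, D.transform_dlog hi hj, dlog_congr e,
      dlog_mul (g := fun w => c.g i j (proj Λ w) * conj (c.g i j (proj Λ w))) dh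
        (dg.mul dg') h0 (mul_ne_zero hg.1 hg'), dlog_mul dg dg' hg.1 hg', dlog_conj dg,
      map_add]
    ext w
    simp only [add_apply, smul_apply, sub_apply, Complex.real_smul]
    push_cast
    ring

theorem isCompatible_unitarize (D : Connection c) (m : HermitianMetric c) :
    m.IsCompatible (D.unitarize m) := by
  intro i v hi w
  have h0 : (m.h i (proj Λ v) : ℂ) ≠ 0 := Complex.ofReal_ne_zero.mpr (m.pos i _ hi).ne'
  have e : dlogForm (fun y => (m.h i y : ℂ)) (proj Λ v) w = (m.h i (proj Λ v) : ℂ)⁻¹ *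
      ((fderiv ℝ (fun y => m.h i (proj Λ y)) v w : ℝ) : ℂ) := by
    rw [dlogForm_proj, dlog]
    simp only [smul_apply, smul_eq_mul]
    congr 1
    exact fderiv_continuousLinearMap_comp_apply Complex.ofRealCLM (m.smooth i _ hi).differentiableAt w
  simp only [unitarize, smul_apply, add_apply, sub_apply, conjForm_apply, e, Complex.real_smul,
    map_add, map_mul, map_sub, Complex.conj_conj, Complex.conj_ofReal, map_inv₀]
  push_cast
  field_simp
  ring

/-- The term `d log h` is closed, so the new curvature is `(F - conj F) / 2`, which is `F` for
imaginary `F`. -/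
theorem HasCurvature.unitarize {D : Connection c} {F : V ⧸ Λ → V [⋀^Fin 2]→L[ℝ] ℂ}
    (hF : D.HasCurvature F) (him : ∀ x v w, conj (F x ![v, w]) = - F x ![v, w])
    (m : HermitianMetric c) : (D.unitarize m).HasCurvature F := by
  intro i v hi
  refine alternating_ext fun x y => ?_
  have h0 : (m.h i (proj Λ v) : ℂ) ≠ 0 := Complex.ofReal_ne_zero.mpr (m.pos i _ hi).ne'
  have h1 := D.differentiableAt hi
  have hs : ContDiffAt ℝ ∞ (fun w => (m.h i (proj Λ w) : ℂ)) v :=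
    Complex.ofRealCLM.contDiff.contDiffAt.comp v (m.smooth i _ hi v rfl)
  have h2 : DifferentiableAt ℝ (dlog fun w => (m.h i (proj Λ w) : ℂ)) v :=
    (hs.dlog h0).differentiableAt (by simp)
  have h3 : DifferentiableAt ℝ (fun w => conjForm (D.A i (proj Λ w))) v :=
    conjForm.differentiableAt.comp v h1
  have e : (fun w => (D.unitarize m).A i (proj Λ w)) = fun w => (1 / 2 : ℝ) • (D.A i (proj Λ w) -
      conjForm (D.A i (proj Λ w)) + dlog (fun w => (m.h i (proj Λ w) : ℂ)) w) := by
    ext1 w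
    simp only [Connection.unitarize, dlogForm_proj]
  have e2 : ∀ x y, fderiv ℝ (fun w => (D.unitarize m).A i (proj Λ w)) v x y =
      1 / 2 * (fderiv ℝ (fun w => D.A i (proj Λ w)) v x y -
        conj (fderiv ℝ (fun w => D.A i (proj Λ w)) v x y) +
        fderiv ℝ (dlog fun w => (m.h i (proj Λ w) : ℂ)) v x y) := by
    intro x y
    have h5 := h1.fun_sub h3
    rw [e, fderiv_fun_const_smul (h5.fun_add h2), fderiv_fun_add h5 h2, fderiv_fun_sub h1 h3]
    simp only [smul_apply, add_apply, sub_apply, fderiv_continuousLinearMap_comp_apply conjForm h1, conjForm_apply,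
      Complex.real_smul]
    push_cast
    ring
  have h4 := him (proj Λ v) x y
  rw [hF i v hi, dOne_apply h1] at h4
  rw [hF i v hi, dOne_apply h1, dOne_apply ((D.unitarize m).differentiableAt hi), e2, e2,
    fderiv_dlog_symm hs h0 x y]
  simp only [map_sub] at h4
  linear_combination (1 / 2 : ℂ) * h4

end Connection

/-- A line bundle with Chern class `E` has a unitary connection with curvature `-2πi E`. -/
theorem exists_unitary_connection [FiniteDimensional ℂ V] [DiscreteTopology Λ]
    [IsZLattice ℝ Λ] {c : LineBundle Λ} {E : V → V → ℝ} (h : HasChernClass c E) :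
    ∃ (D : Connection c) (F : V ⧸ Λ → V [⋀^Fin 2]→L[ℝ] ℂ), D.HasCurvature F ∧ D.IsUnitary ∧
      (∀ x y, F (x + y) = F y) ∧
      ∀ x v w, F x ![v, w] = -(2 * Real.pi * Complex.I) * E w v := by
  obtain ⟨D, F, a, hF, ha, h⟩ := h
  -- Solving the Chern class identity gives `F = -2πi (E + da)`, so adding `2πi a` to the connection
  -- leaves the curvature `-2πi E`. This is imaginary, so unitarizing does not change it.
  let τ : V ⧸ Λ → V →L[ℝ] ℂ := fun x => (2 * Real.pi * Complex.I : ℂ) • a x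
  have hτ : ∀ x, SmoothAt τ x := fun x v hv => (ha x v hv).const_smul (2 * Real.pi * Complex.I : ℂ)
  obtain ⟨G, hG⟩ := exists_comp_proj_eq (isPeriodic_dOne τ)
  have hF' := hF.addForm hτ hG
  have hval : ∀ x v w, (F x + G x) ![v, w] = -(2 * Real.pi * Complex.I) * E w v := by
    intro x v w
    obtain ⟨z, rfl⟩ := proj_surjective x
    have h1 := h z v w
    have hz : DifferentiableAt ℝ (fun w => a (proj Λ w)) z := (ha _).differentiableAt
    have e : fderiv ℝ (fun w => τ (proj Λ w)) z = _ :=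
      fderiv_fun_const_smul hz (2 * Real.pi * Complex.I : ℂ)
    rw [ContinuousAlternatingMap.add_apply, hG, dOne_apply (hτ _).differentiableAt, e]
    rw [dOne_apply hz] at h1
    have hpi : (Real.pi : ℂ) ≠ 0 := Complex.ofReal_ne_zero.mpr Real.pi_ne_zero
    field_simp at h1
    simp only [smul_apply, smul_eq_mul]
    linear_combination (-Complex.I) * h1 + F (proj Λ z) ![v, w] * Complex.I_sq
  obtain ⟨m⟩ := exists_hermitianMetric c
  refine ⟨(D.addForm τ hτ).unitarize m, fun x => F x + G x, hF'.unitarize ?_ m,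
    ⟨m, Connection.isCompatible_unitarize _ m⟩, fun x y => ?_, hval⟩
  · intro x v w
    rw [hval]
    simp only [map_mul, map_neg, Complex.conj_I, Complex.conj_ofReal, map_ofNat]
    ring
  · exact alternating_ext fun v w => by rw [hval, hval]

end Forms

end ComplexTorus

/-! ### Flat sections and smooth triviality of `U(1)`-local systems. -/

namespace ComplexTorus

section LocalSystems

/-- The circle group with the discrete topology. -/
@[ext]
structure DiscreteCircle where
  val : ℂ
  norm_val : ‖val‖ = 1

instance : TopologicalSpace DiscreteCircle := ⊥

instance : DiscreteTopology DiscreteCircle := ⟨rfl⟩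

open Classical in
/-- Multiplication by a complex number of modulus one. -/
noncomputable def rotate (w : ℂ) (z : DiscreteCircle) : DiscreteCircle :=
  if h : ‖w‖ = 1 then ⟨w * z.val, by rw [norm_mul, h, z.norm_val, one_mul]⟩ else z

theorem rotate_val {w : ℂ} (h : ‖w‖ = 1) (z : DiscreteCircle) : (rotate w z).val = w * z.val := by
  rw [rotate, dif_pos h]

variable {V : Type u} [NormedAddCommGroup V] [NormedSpace ℂ V] {Λ : Submodule ℤ V}

/-- The pullback to `V` of the bundle of circles with discrete fibres given by a local system. -/
noncomputable def circleBundleCore (ℓ : CechCocycle (circleConst Λ)) :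
    FiberBundleCore ℓ.ι V DiscreteCircle where
  baseSet i := proj Λ ⁻¹' ℓ.U i
  isOpen_baseSet i := (ℓ.isOpen_U i).preimage (continuous_proj Λ)
  indexAt v := (ℓ.cover (proj Λ v)).choose
  mem_baseSet_at v := (ℓ.cover (proj Λ v)).choose_spec
  coordChange i j v z := rotate (ℓ.g j i (proj Λ v)) z
  coordChange_self i v hv z := by
    rw [ℓ.g_self i _ hv]
    exact DiscreteCircle.ext (by rw [rotate_val norm_one, one_mul])
  continuousOn_coordChange i j := by
    rintro ⟨v, z⟩ ⟨⟨hi, hj⟩, -⟩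
    refine ContinuousAt.continuousWithinAt ?_
    have h1 := circleConst_eventuallyEq Λ (ℓ.mem_g j i _ hj hi)
    refine (continuousAt_const (y := rotate (ℓ.g j i (proj Λ v)) z)).congr ?_
    have h2 : ∀ᶠ p : V × DiscreteCircle in 𝓝 (v, z), p.2 = z :=
      continuousAt_snd.eventually_mem (show ({z} : Set DiscreteCircle) ∈ 𝓝 (v, z).2 from
        (isOpen_discrete {z}).mem_nhds (Set.mem_singleton z))
    have h3 : ∀ᶠ p : V × DiscreteCircle in 𝓝 (v, z),
        ℓ.g j i (proj Λ p.1) = ℓ.g j i (proj Λ v) := continuousAt_fst.eventually h1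
    filter_upwards [h2, h3] with p h2 h3
    rw [h2, h3]
  coordChange_comp i j k v hv z := by
    obtain ⟨⟨hi, hj⟩, hk⟩ := hv
    refine DiscreteCircle.ext ?_
    rw [rotate_val (ℓ.mem_g k j _ hk hj).1, rotate_val (ℓ.mem_g j i _ hj hi).1,
      rotate_val (ℓ.mem_g k i _ hk hi).1, ← ℓ.cocycle k j i _ hk hj hi, mul_assoc]

/-- The pullback of a `U(1)`-local system to `V` has a flat section. -/
theorem exists_flat_section (ℓ : CechCocycle (circleConst Λ)) :
    ∃ s : ℓ.ι → V → ℂ, (∀ i v, proj Λ v ∈ ℓ.U i → ‖s i v‖ = 1 ∧ ∀ᶠ w in 𝓝 v, s i w = s i v) ∧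
      ∀ i j v, proj Λ v ∈ ℓ.U i → proj Λ v ∈ ℓ.U j → s i v = ℓ.g i j (proj Λ v) * s j v := by
  let Z := circleBundleCore ℓ
  -- With discrete fibres the bundle is a covering of the simply connected space `V`, so the
  -- identity of `V` lifts to a global section.
  have cov : IsCoveringMap (Bundle.TotalSpace.proj : Bundle.TotalSpace DiscreteCircle Z.Fiber → V) :=
    FiberBundle.isCoveringMap
  obtain ⟨σ, ⟨-, hσ⟩, -⟩ := cov.existsUnique_continuousMap_lifts (ContinuousMap.id V) 0
    ⟨0, (⟨1, norm_one⟩ : DiscreteCircle)⟩ rfl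
  have hσ' : ∀ v, (σ v).proj = v := fun v => congrFun hσ v
  let s : ℓ.ι → V → DiscreteCircle := fun i v => ((Z.localTriv i) (σ v)).2
  obtain ⟨e, hs⟩ : ∃ e : V → DiscreteCircle, ∀ i v, s i v =
    rotate (ℓ.g i (Z.indexAt (σ v).proj) (proj Λ (σ v).proj)) (e v) :=
    ⟨fun v => (σ v).2, fun i v => rfl⟩
  refine ⟨fun i v => (s i v).val, fun i v hi => ⟨(s i v).norm_val, ?_⟩, fun i j v hi hj => ?_⟩
  · have h1 : ContinuousAt (fun w => ((Z.localTriv i) (σ w)).2) v := by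
      have h2 : σ v ∈ (Z.localTriv i).source := by
        rw [Z.mem_localTriv_source, hσ']
        exact hi
      exact (((Z.localTriv i).continuousAt h2).snd).comp σ.continuous.continuousAt
    have h2 := h1.eventually (show ∀ᶠ z in 𝓝 ((Z.localTriv i) (σ v)).2,
      z = ((Z.localTriv i) (σ v)).2 by rw [nhds_discrete]; exact rfl)
    filter_upwards [h2] with w hw
    exact congrArg DiscreteCircle.val hw
  · have hk : proj Λ v ∈ ℓ.U (Z.indexAt v) := Z.mem_baseSet_at v
    simp only [hs, hσ']
    rw [rotate_val (ℓ.mem_g i _ _ hi hk).1, rotate_val (ℓ.mem_g j _ _ hj hk).1,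
      ← ℓ.cocycle i j _ _ hi hj hk, mul_assoc]

/-- Arguments of `χ` may be chosen freely on a lattice basis and extended linearly; multiplicativity
gives the remaining values. -/
theorem exists_real_functional [FiniteDimensional ℂ V] [DiscreteTopology Λ] [IsZLattice ℝ Λ]
    {χ : V → ℂ} (h1 : ∀ l ∈ Λ, ‖χ l‖ = 1) (hm : ∀ l ∈ Λ, ∀ m ∈ Λ, χ (l + m) = χ l * χ m) :
    ∃ r : V →L[ℝ] ℝ, ∀ l ∈ Λ, Complex.exp (r l * Complex.I) = χ l := by
  have : FiniteDimensional ℝ V := FiniteDimensional.complexToReal V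
  obtain ⟨n, b, rfl⟩ := exists_basis_latticeOf_eq Λ
  have hne : ∀ l ∈ LatticeFourier.latticeOf b, χ l ≠ 0 := fun l hl h => by
    simpa [h] using h1 l hl
  have h0 : χ 0 = 1 := by
    have := hm 0 (zero_mem _) 0 (zero_mem _)
    rw [add_zero] at this
    exact mul_left_cancel₀ (hne 0 (zero_mem _)) (by rw [← this, mul_one])
  refine ⟨LinearMap.toContinuousLinearMap (b.constr ℝ fun i => Complex.arg (χ (b i))),
    fun l hl => ?_⟩
  have hsub : ∀ l, l ∈ AddSubgroup.closure (Set.range b) → l ∈ LatticeFourier.latticeOf b :=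
    fun l hl => by
      rw [← Submodule.span_int_eq_addSubgroupClosure] at hl
      exact hl
  have hl' : l ∈ AddSubgroup.closure (Set.range b) := by
    rw [← Submodule.span_int_eq_addSubgroupClosure]
    exact hl
  clear hl
  induction hl' using AddSubgroup.closure_induction with
  | mem x hx =>
    obtain ⟨i, rfl⟩ := hx
    have h2 := Complex.norm_mul_exp_arg_mul_I (χ (b i))
    rw [h1 _ (Submodule.subset_span ⟨i, rfl⟩), Complex.ofReal_one, one_mul] at h2
    simpa using h2
  | zero => simp [h0]
  | add x y hx hy h2 h3 =>
    rw [map_add, Complex.ofReal_add, add_mul, Complex.exp_add, h2, h3,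
      hm x (hsub x hx) y (hsub y hy)]
  | neg x hx h2 =>
    have h3 := hm x (hsub x hx) (-x) (neg_mem (hsub x hx))
    rw [add_neg_cancel, h0] at h3
    rw [map_neg, Complex.ofReal_neg, neg_mul, Complex.exp_neg, h2]
    exact inv_eq_of_mul_eq_one_right h3.symm

/-- `t` is a smooth trivialization of the line bundle `c`. -/
structure IsTrivialization (c : LineBundle Λ) (t : c.ι → V ⧸ Λ → ℂ) : Prop where
  mem : ∀ i x, x ∈ c.U i → (smoothUnits Λ).mem (t i) x
  eq : ∀ i j x, x ∈ c.U i → x ∈ c.U j → t i x = c.g i j x * t j x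

/-- The complex line bundle of a `U(1)`-local system is trivial. -/
theorem exists_isTrivialization [FiniteDimensional ℂ V] [DiscreteTopology Λ] [IsZLattice ℝ Λ]
    (ℓ : CechCocycle (circleConst Λ)) :
    ∃ t, IsTrivialization (ℓ.map (circleConst_le_smooth Λ)) t := by
  obtain ⟨s, hs, hs'⟩ := exists_flat_section ℓ
  have hs0 : ∀ i v, proj Λ v ∈ ℓ.U i → s i v ≠ 0 := fun i v hi h => by
    simpa [h] using (hs i v hi).1
  -- The transition functions are periodic on `V` and cancel in the quotient, so the multiplier does
  -- not depend on the trivialization.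
  have hq : ∀ l ∈ Λ, ∀ i j v, proj Λ v ∈ ℓ.U i → proj Λ v ∈ ℓ.U j →
      s i (v + l) / s i v = s j (v + l) / s j v := by
    intro l hl i j v hi hj
    have e := proj_add_of_mem v hl
    have h1 := hs' i j v hi hj
    have h2 := hs' i j (v + l) (by rwa [e]) (by rwa [e])
    have h3 := hs0 i v hi
    have h4 := hs0 j v hj
    have h5 : ℓ.g i j (proj Λ v) ≠ 0 := (circleConst Λ).ne_zero (ℓ.mem_g i j _ hi hj)
    rw [h1, h2, e, mul_div_mul_left _ _ h5]
  -- The multiplier is locally constant in `v`, and `V` is connected.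
  have hconst : ∀ l ∈ Λ, ∃ z : ℂ, ∀ i v, proj Λ v ∈ ℓ.U i → s i (v + l) = z * s i v := by
    intro l hl
    choose k hk using fun v : V => ℓ.cover (proj Λ v)
    let q : V → ℂ := fun v => s (k v) (v + l) / s (k v) v
    have hloc : IsLocallyConstant q := by
      rw [IsLocallyConstant.iff_eventually_eq]
      intro v
      have e := proj_add_of_mem v hl
      have h1 := (hs (k v) v (hk v)).2
      have h2 := (hs (k v) (v + l) (by rw [e]; exact hk v)).2
      have h3 : Tendsto (fun w => w + l) (𝓝 v) (𝓝 (v + l)) :=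
        (continuous_add_const l).tendsto v
      filter_upwards [h1, h3.eventually h2,
        eventually_proj_mem (ℓ.isOpen_U (k v)) (hk v)] with w h4 h5 h6
      simp only [q]
      rw [hq l hl (k w) (k v) w (hk w) h6, h4, h5]
    refine ⟨q 0, fun i v hi => ?_⟩
    rw [← hloc.apply_eq_of_preconnectedSpace v 0]
    simp only [q]
    rw [hq l hl (k v) i v (hk v) hi, div_mul_cancel₀ _ (hs0 i v hi)]
  choose! χ hχ using hconst
  obtain ⟨i₀, hi₀⟩ := ℓ.cover (proj Λ 0)
  have hmem : ∀ l ∈ Λ, proj Λ l ∈ ℓ.U i₀ := fun l hl => by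
    have := proj_add_of_mem (0 : V) hl
    rw [zero_add] at this
    rwa [this]
  obtain ⟨r, hr⟩ := exists_real_functional (χ := χ) (fun l hl => by
    have h1 := hχ l hl i₀ 0 hi₀
    rw [zero_add] at h1
    have h2 := congrArg norm h1
    rw [norm_mul, (hs i₀ 0 hi₀).1, (hs i₀ l (hmem l hl)).1, mul_one] at h2
    exact h2.symm) (fun l hl m hm => by
    have h1 := hχ (l + m) (add_mem hl hm) i₀ 0 hi₀
    have h2 := hχ l hl i₀ 0 hi₀
    have h3 := hχ m hm i₀ l (hmem l hl)
    rw [zero_add] at h1 h2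
    rw [h3, h2] at h1
    have h4 := hs0 i₀ 0 hi₀
    refine mul_right_cancel₀ h4 ?_
    linear_combination -h1)
  -- The factor `exp (-i r)` cancels the multiplier `χ = exp (i r)`, so the product descends. The
  -- indicator below makes it periodic on all of `V`, as descent requires.
  have hex : ∀ i, ∃ t : V ⧸ Λ → ℂ, ∀ v, proj Λ v ∈ ℓ.U i →
      t (proj Λ v) = s i v * Complex.exp (-(r v * Complex.I)) := by
    intro i
    have hp : IsPeriodic Λ (fun v => (ℓ.U i).indicator (fun _ =>
        s i v * Complex.exp (-(r v * Complex.I))) (proj Λ v)) := by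
      intro v l hl
      have e := proj_add_of_mem v hl
      by_cases h : proj Λ v ∈ ℓ.U i
      · have h' : proj Λ (v + l) ∈ ℓ.U i := by rwa [e]
        simp only [Set.indicator_of_mem h, Set.indicator_of_mem h']
        rw [hχ l hl i v h, ← hr l hl, map_add]
        have : Complex.exp (r l * Complex.I) ≠ 0 := Complex.exp_ne_zero _
        push_cast
        rw [show -((r v + r l : ℂ) * Complex.I) = -(r v * Complex.I) + -(r l * Complex.I) by ring,
          Complex.exp_add, Complex.exp_neg (r l * Complex.I)]
        field_simp
      · have h' : proj Λ (v + l) ∉ ℓ.U i := by rwa [e]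
        simp only [Set.indicator_of_notMem h, Set.indicator_of_notMem h']
    obtain ⟨t, ht⟩ := exists_comp_proj_eq hp
    exact ⟨t, fun v hv => by rw [ht v, Set.indicator_of_mem hv]⟩
  choose t ht using hex
  refine ⟨t, ⟨fun i x hx => ⟨?_, ?_⟩, fun i j x hi hj => ?_⟩⟩
  · obtain ⟨v, rfl⟩ := proj_surjective x
    rw [ht i v hx]
    exact mul_ne_zero (hs0 i v hx) (Complex.exp_ne_zero _)
  · rintro v rfl
    have h1 : ContDiffAt ℝ ∞ (fun w => s i v * Complex.exp (-(r w * Complex.I))) v := by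
      have : ContDiff ℝ ∞ fun w => (r w : ℂ) := (Complex.ofRealCLM ∘L r).contDiff
      exact (contDiff_const.mul (this.mul contDiff_const).neg.cexp).contDiffAt
    refine h1.congr_of_eventuallyEq ?_
    filter_upwards [(hs i v hx).2, eventually_proj_mem (ℓ.isOpen_U i) hx] with w h2 h3
    rw [ht i w h3, h2]
  · obtain ⟨v, rfl⟩ := proj_surjective x
    rw [ht i v hi, ht j v hj, hs' i j v hi hj, mul_assoc]
    rfl

end LocalSystems

/-! ### Local inverses of the covering and local systems with prescribed monodromy. -/

section Sections

variable {V : Type u} [NormedAddCommGroup V] [NormedSpace ℂ V] (Λ : Submodule ℤ V)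
variable [DiscreteTopology Λ]

theorem exists_injectivity_radius : ∃ ε > 0, ∀ l ∈ Λ, ‖l‖ < ε → l = 0 := by
  obtain ⟨ε, hε, h⟩ := Metric.isOpen_iff.mp (isOpen_discrete ({0} : Set Λ)) 0 rfl
  refine ⟨ε, hε, fun l hl hlt => ?_⟩
  have : (⟨l, hl⟩ : Λ) ∈ Metric.ball (0 : Λ) ε := by simpa using hlt
  exact congrArg Subtype.val (h this)

/-- A ball of half this radius is mapped injectively to `V ⧸ Λ`. -/
noncomputable def radius : ℝ := (exists_injectivity_radius Λ).choose / 2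

theorem radius_pos : 0 < radius Λ := half_pos (exists_injectivity_radius Λ).choose_spec.1

variable {Λ}

theorem eq_of_proj_eq_of_mem_ball {p v w : V} (hv : v ∈ Metric.ball p (radius Λ))
    (hw : w ∈ Metric.ball p (radius Λ)) (h : proj Λ v = proj Λ w) : v = w := by
  refine sub_eq_zero.mp ((exists_injectivity_radius Λ).choose_spec.2 _ (proj_eq_iff.mp h) ?_)
  rw [← dist_eq_norm]
  refine lt_of_le_of_lt (dist_triangle_right v w p) ?_
  have h1 := Metric.mem_ball.mp hv
  have h2 := Metric.mem_ball.mp hw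
  have : radius Λ = (exists_injectivity_radius Λ).choose / 2 := rfl
  linarith

variable (Λ) in
/-- The image of a small ball in `V ⧸ Λ`. -/
def ballImage (p : V) : Set (V ⧸ Λ) := proj Λ '' Metric.ball p (radius Λ)

theorem isOpen_ballImage (p : V) : IsOpen (ballImage Λ p) := isOpenMap_proj _ Metric.isOpen_ball

theorem exists_mem_ballImage (x : V ⧸ Λ) : ∃ p, x ∈ ballImage Λ p := by
  obtain ⟨v, rfl⟩ := proj_surjective x
  exact ⟨v, v, Metric.mem_ball_self (radius_pos Λ), rfl⟩

open Classical in
/-- The local inverse of the covering map on the image of a small ball. -/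
noncomputable def localInverse (p : V) (x : V ⧸ Λ) : V :=
  if h : x ∈ ballImage Λ p then h.choose else 0

theorem localInverse_spec {p : V} {x : V ⧸ Λ} (h : x ∈ ballImage Λ p) :
    localInverse p x ∈ Metric.ball p (radius Λ) ∧ proj Λ (localInverse p x) = x := by
  rw [localInverse, dif_pos h]
  exact h.choose_spec

/-- Both sides are lifts of the same point to a ball that is mapped injectively; thus a local
inverse is locally a translation by a lattice vector. -/
theorem eventually_localInverse {p v : V} (h : proj Λ v ∈ ballImage Λ p) :
    ∀ᶠ w in 𝓝 v, localInverse p (proj Λ w) = w + (localInverse p (proj Λ v) - v) := by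
  have h1 := localInverse_spec h
  have h2 : Tendsto (fun w => w + (localInverse p (proj Λ v) - v)) (𝓝 v)
      (𝓝 (localInverse p (proj Λ v))) := by
    have := (continuous_add_const (localInverse p (proj Λ v) - v)).tendsto v
    simpa using this
  filter_upwards [eventually_proj_mem (isOpen_ballImage p) h,
    h2.eventually (Metric.isOpen_ball.mem_nhds h1.1)] with w h3 h4
  have h5 := localInverse_spec h3
  refine eq_of_proj_eq_of_mem_ball h5.1 h4 ?_
  rw [h5.2, proj_add_of_mem w (proj_eq_iff.mp h1.2)]

theorem eventually_of_eventually_proj {P : V ⧸ Λ → Prop} {v : V}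
    (h : ∀ᶠ w in 𝓝 v, P (proj Λ w)) : ∀ᶠ y in 𝓝 (proj Λ v), P y := by
  rw [← (IsOpenQuotientMap.mk proj_surjective (continuous_proj Λ) isOpenMap_proj).map_nhds_eq]
  exact h

/-- The `U(1)`-local system with monodromy `exp (i r)`. -/
noncomputable def localSystem (r : V →L[ℝ] ℝ) : CechCocycle (circleConst Λ) where
  ι := V
  U := ballImage Λ
  isOpen_U := isOpen_ballImage
  cover := exists_mem_ballImage
  -- Two local inverses differ by a lattice vector that is locally constant in `x`, which makes `g`
  -- locally constant.
  g p q x := Complex.exp (r (localInverse q x - localInverse p x) * Complex.I)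
  mem_g p q x hp hq := by
    refine ⟨Complex.norm_exp_ofReal_mul_I _, ?_⟩
    obtain ⟨v, rfl⟩ := proj_surjective x
    refine eventually_of_eventually_proj ?_
    filter_upwards [eventually_localInverse hp, eventually_localInverse hq] with w h1 h2
    rw [h1, h2]
    congr 4
    abel
  cocycle p q s x hp hq hs := by
    rw [← Complex.exp_add, ← add_mul, ← Complex.ofReal_add, ← map_add]
    congr 4
    abel

/-- The smooth trivialization of `localSystem r`. -/
noncomputable def localSystemTriv (r : V →L[ℝ] ℝ) (p : V) (x : V ⧸ Λ) : ℂ :=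
  Complex.exp (-(r (localInverse p x) * Complex.I))

theorem localSystemTriv_eventuallyEq (r : V →L[ℝ] ℝ) {p v : V} (h : proj Λ v ∈ ballImage Λ p) :
    (fun w => localSystemTriv r p (proj Λ w)) =ᶠ[𝓝 v] fun w =>
      Complex.exp (-((r (w + (localInverse p (proj Λ v) - v)) : ℂ) * Complex.I)) := by
  filter_upwards [eventually_localInverse h] with w hw
  rw [localSystemTriv, hw]

theorem isTrivialization_localSystemTriv (r : V →L[ℝ] ℝ) :
    IsTrivialization ((localSystem (Λ := Λ) r).map (circleConst_le_smooth Λ))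
      (localSystemTriv (V := V) r) := by
  refine ⟨fun (p : V) x hp => ⟨Complex.exp_ne_zero _, ?_⟩, fun p q x hp hq => ?_⟩
  · rintro v rfl
    refine ContDiffAt.congr_of_eventuallyEq ?_ (localSystemTriv_eventuallyEq r hp)
    have h : ContDiff ℝ ∞ fun w => (r w : ℂ) := (Complex.ofRealCLM ∘L r).contDiff
    exact ((h.comp (contDiff_id.add contDiff_const)).mul contDiff_const).neg.cexp.contDiffAt
  · change Complex.exp _ = Complex.exp _ * Complex.exp _
    rw [← Complex.exp_add, map_sub]
    congr 1
    push_cast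
    ring

theorem dlog_localSystemTriv (r : V →L[ℝ] ℝ) {p v : V} (h : proj Λ v ∈ ballImage Λ p) :
    dlog (fun w => localSystemTriv r p (proj Λ w)) v = -(Complex.I • (Complex.ofRealCLM ∘L r)) := by
  rw [dlog_congr (localSystemTriv_eventuallyEq r h)]
  have h1 : HasFDerivAt (fun w => (r (w + (localInverse p (proj Λ v) - v)) : ℂ))
      (Complex.ofRealCLM ∘L r) v :=
    (hasFDerivAt_comp_add_right _).mpr (Complex.ofRealCLM ∘L r).hasFDerivAt
  exact dlog_exp (h1.mul_const Complex.I).neg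

end Sections

end ComplexTorus

/-- A group acts simply transitively on `P` if the relation "`q` is the translate of `p` by `g`" is
given with suitable properties. -/
theorem exists_torsor_of_relation {G : Type u} [Group G] {P : Type v} [Nonempty P]
    (R : G → P → P → Prop) (one : ∀ p q, R 1 p q ↔ p = q)
    (mul : ∀ g h p q s, R g p q → R h q s → R (g * h) p s)
    (comm : ∀ g h : G, g * h = h * g)
    (inv : ∀ g p q, R g p q → R g⁻¹ q p) (ex : ∀ g p, ∃ q, R g p q)
    (free : ∀ g p, R g p p → g = 1) (trans : ∀ p q, ∃ g, R g p q) :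
    ∃ _ : Torsor G P, ∀ (g : G) (p q : P), g • p = q ↔ R g p q := by
  have uniq : ∀ g p q q', R g p q → R g p q' → q = q' := fun g p q q' h h' =>
    (one q q').mp (by simpa using mul _ _ _ _ _ (inv _ _ _ h) h')
  have uniq' : ∀ g g' p q, R g p q → R g' p q → g = g' := fun g g' p q h h' =>
    mul_inv_eq_one.mp (free _ p (mul _ _ _ _ _ h (inv _ _ _ h')))
  choose act hact using ex
  choose d hd using trans
  have key : ∀ g p q, act g p = q ↔ R g p q := fun g p q =>
    ⟨fun h => h ▸ hact g p, fun h => uniq _ _ _ _ (hact g p) h⟩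
  refine ⟨{
    smul := act
    one_smul := fun p => (key 1 p p).mpr ((one p p).mpr rfl)
    mul_smul := fun g h p => (key _ _ _).mpr (by
      -- In `R (g * h)` the translation by `g` comes first, whereas an action applies `h` first.
      rw [comm]
      exact mul _ _ _ _ _ (hact h p) (hact g (act h p)))
    sdiv := fun p q => d q p
    sdiv_smul' := fun p q => (key _ _ _).mpr (hd q p)
    smul_sdiv' := fun g p => uniq' _ _ _ _ (hd p (act g p)) (hact g p) }, key⟩

/-! ### Twisting a connection by a local system. -/

namespace ComplexTorus

section Shift

variable {V : Type u} [NormedAddCommGroup V] [NormedSpace ℂ V] {Λ : Submodule ℤ V}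

/-- The connections on `c` given by the tensor product of `D` with a local system, under a smooth
trivialization of the local system. -/
def IsShift (ℓ : CechCocycle (circleConst Λ)) {c : LineBundle Λ} (D D' : Connection c) : Prop :=
  ∃ t, IsTrivialization (ℓ.map (circleConst_le_smooth Λ)) t ∧
    ∀ a i v, proj Λ v ∈ ℓ.U a → proj Λ v ∈ c.U i →
      D'.A i (proj Λ v) = D.A i (proj Λ v) + dlog (fun w => t a (proj Λ w)) v

theorem differentiableAt_of_mem {f : V ⧸ Λ → ℂ} {v : V} (h : (smoothUnits Λ).mem f (proj Λ v)) :
    DifferentiableAt ℝ (fun w => f (proj Λ w)) v := SmoothAt.differentiableAt h.2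

theorem dlog_mul_of_mem {f g : V ⧸ Λ → ℂ} {v : V} (hf : (smoothUnits Λ).mem f (proj Λ v))
    (hg : (smoothUnits Λ).mem g (proj Λ v)) :
    dlog (fun w => f (proj Λ w) * g (proj Λ w)) v =
      dlog (fun w => f (proj Λ w)) v + dlog (fun w => g (proj Λ w)) v :=
  dlog_mul (differentiableAt_of_mem hf) (differentiableAt_of_mem hg) hf.1 hg.1

theorem dlog_eq_zero_of_mem {f : V ⧸ Λ → ℂ} {v : V} (hf : (circleConst Λ).mem f (proj Λ v)) :
    dlog (fun w => f (proj Λ w)) v = 0 :=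
  dlog_eq_zero (circleConst_eventuallyEq Λ hf)

/-- Cancelling the bundle `c` from an isomorphism `ℓ ⊗ c ≅ c` leaves a trivialization of `ℓ`; this
replaces tensor products by logarithmic derivatives of trivializations. -/
theorem isShift_iff_isomorphic (ℓ : CechCocycle (circleConst Λ)) {c : LineBundle Λ}
    (D D' : Connection c) :
    ((Connection.flat ℓ).tensor D).Isomorphic D' ↔ IsShift ℓ D D' := by
  constructor
  · rintro ⟨f, hf, hf'⟩
    choose k hk using c.cover
    -- The diagonal components of `f` are independent of the trivialization of `c`, since the
    -- transition function of `c` occurs on both sides.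
    have key : ∀ a i x, x ∈ ℓ.U a → x ∈ c.U i → f (a, k x) (k x) x = f (a, i) i x := by
      intro a i x ha hi
      have h := hf.comm (a, i) (a, k x) i (k x) x ⟨ha, hi⟩ ⟨ha, hk x⟩ hi (hk x)
      have h' : f (a, i) i x * c.g i (k x) x = ℓ.g a a x * c.g i (k x) x * f (a, k x) (k x) x := h
      rw [ℓ.g_self a x ha] at h'
      refine mul_left_cancel₀ (c.mem_g i (k x) x hi (hk x)).1 ?_
      linear_combination -h'
    refine ⟨fun a x => f (a, k x) (k x) x, ⟨fun a x ha => ?_, fun a a' x ha ha' => ?_⟩,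
      fun a i v ha hi => ?_⟩
    · refine (smoothUnits Λ).congr ?_ (hf.mem_f (a, k x) (k x) x ⟨ha, hk x⟩ (hk x))
      filter_upwards [(ℓ.isOpen_U a).mem_nhds ha, (c.isOpen_U (k x)).mem_nhds (hk x)] with y h1 h2
      exact (key a (k x) y h1 h2).symm
    · have h := hf.comm (a, k x) (a', k x) (k x) (k x) x ⟨ha, hk x⟩ ⟨ha', hk x⟩ (hk x) (hk x)
      have h' : f (a, k x) (k x) x * c.g (k x) (k x) x =
        ℓ.g a a' x * c.g (k x) (k x) x * f (a', k x) (k x) x := h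
      rw [c.g_self _ x (hk x), mul_one, mul_one] at h'
      exact h'
    · have h : D'.A i (proj Λ v) = 0 + D.A i (proj Λ v) +
        dlog (fun w => f (a, i) i (proj Λ w)) v := hf' (a, i) i v ⟨ha, hi⟩ hi
      rw [h, zero_add]
      congr 1
      refine dlog_congr ?_
      filter_upwards [eventually_proj_mem (ℓ.isOpen_U a) ha,
        eventually_proj_mem (c.isOpen_U i) hi] with w h1 h2
      exact (key a i _ h1 h2).symm
  · rintro ⟨t, ht, h⟩
    refine ⟨fun p j x => t p.1 x * c.g p.2 j x, ⟨?_, ?_⟩, ?_⟩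
    · intro p j x hp hj
      exact (smoothUnits Λ).mul (ht.mem _ _ hp.1) (c.mem_g _ _ _ hp.2 hj)
    · intro p p' j j' x hp hp' hj hj'
      have h1 : t p.1 x = ℓ.g p.1 p'.1 x * t p'.1 x := ht.eq _ _ _ hp.1 hp'.1
      have h2 := c.cocycle p.2 j j' x hp.2 hj hj'
      have h3 := c.cocycle p.2 p'.2 j' x hp.2 hp'.2 hj'
      change t p.1 x * c.g p.2 j x * c.g j j' x =
        ℓ.g p.1 p'.1 x * c.g p.2 p'.2 x * (t p'.1 x * c.g p'.2 j' x)
      rw [h1, mul_assoc, h2, ← h3]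
      ring
    · intro p j v hp hj
      change D'.A j (proj Λ v) = 0 + D.A p.2 (proj Λ v) +
        dlog (fun w => t p.1 (proj Λ w) * c.g p.2 j (proj Λ w)) v
      rw [dlog_mul_of_mem (ht.mem _ _ hp.1) (c.mem_g _ _ _ hp.2 hj), D'.transform_dlog hp.2 hj,
        h p.1 p.2 v hp.1 hp.2]
      abel

variable {c : LineBundle Λ} {D D' D'' : Connection c} {ℓ ℓ' : CechCocycle (circleConst Λ)}

/-- On the one-element cover a trivialization is a single global unit, that is, a gauge
transformation. -/
theorem isShift_triv_iff :
    IsShift (CechCocycle.triv (circleConst Λ)) D D' ↔ Connection.GaugeEquiv D D' := by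
  constructor
  · rintro ⟨t, ht, h⟩
    exact ⟨t PUnit.unit, fun x => ht.mem _ x trivial, fun i v hi => h PUnit.unit i v trivial hi⟩
  · rintro ⟨φ, hφ, h⟩
    exact ⟨fun _ => φ, ⟨fun _ x _ => hφ x, fun _ _ x _ _ => (one_mul _).symm⟩,
      fun _ i v _ hi => h i v hi⟩

theorem IsShift.tensor (h : IsShift ℓ D D') (h' : IsShift ℓ' D' D'') :
    IsShift (ℓ.tensor ℓ') D D'' := by
  obtain ⟨t, ht, h⟩ := h
  obtain ⟨t', ht', h'⟩ := h'
  refine ⟨fun p x => t p.1 x * t' p.2 x, ⟨fun p x hp => (smoothUnits Λ).mul (ht.mem _ _ hp.1)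
    (ht'.mem _ _ hp.2), fun p q x hp hq => ?_⟩, fun p i v hp hi => ?_⟩
  · have h1 : t p.1 x = ℓ.g p.1 q.1 x * t q.1 x := ht.eq _ _ _ hp.1 hq.1
    have h2 : t' p.2 x = ℓ'.g p.2 q.2 x * t' q.2 x := ht'.eq _ _ _ hp.2 hq.2
    change _ = ℓ.g p.1 q.1 x * ℓ'.g p.2 q.2 x * _
    rw [h1, h2]
    ring
  · rw [dlog_mul_of_mem (ht.mem _ _ hp.1) (ht'.mem _ _ hp.2), h' p.2 i v hp.2 hi,
      h p.1 i v hp.1 hi, add_assoc]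

theorem IsShift.dual (h : IsShift ℓ D D') : IsShift ℓ.dual D' D := by
  obtain ⟨t, ht, h⟩ := h
  refine ⟨fun a x => (t a x)⁻¹, ⟨fun a x ha => (smoothUnits Λ).inv (ht.mem _ _ ha),
    fun a b x ha hb => ?_⟩, fun a i v ha hi => ?_⟩
  · have h1 : t a x = ℓ.g a b x * t b x := ht.eq _ _ _ ha hb
    change _ = (ℓ.g a b x)⁻¹ * _
    rw [h1, mul_inv]
  · rw [h a i v ha hi, dlog_inv (differentiableAt_of_mem (ht.mem _ _ ha)) (ht.mem _ _ ha).1]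
    abel

/-- An isomorphism of local systems is locally constant, so transporting a trivialization along it
does not change the logarithmic derivative. -/
theorem IsShift.congr (hℓ : CechCocycle.IsIso ℓ' ℓ) (h : IsShift ℓ D D') : IsShift ℓ' D D' := by
  obtain ⟨f, hf⟩ := hℓ
  obtain ⟨t, ht, h⟩ := h
  choose k hk using ℓ.cover
  have key : ∀ a b x, x ∈ ℓ'.U a → x ∈ ℓ.U b → f a (k x) x * t (k x) x = f a b x * t b x := by
    intro a b x ha hb
    have h1 := hf.comm a a (k x) b x ha ha (hk x) hb
    have h2 : t (k x) x = ℓ.g (k x) b x * t b x := ht.eq _ _ _ (hk x) hb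
    rw [ℓ'.g_self a x ha, one_mul] at h1
    rw [h2, ← mul_assoc, h1]
  have hm : ∀ a b x, x ∈ ℓ'.U a → x ∈ ℓ.U b → (smoothUnits Λ).mem (f a b) x :=
    fun a b x ha hb => circleConst_le_smooth Λ _ _ (hf.mem_f a b x ha hb)
  refine ⟨fun a x => f a (k x) x * t (k x) x, ⟨fun a x ha => ?_, fun a a' x ha ha' => ?_⟩,
    fun a i v ha hi => ?_⟩
  · refine (smoothUnits Λ).congr ?_
      ((smoothUnits Λ).mul (hm a (k x) x ha (hk x)) (ht.mem _ _ (hk x)))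
    filter_upwards [(ℓ'.isOpen_U a).mem_nhds ha, (ℓ.isOpen_U (k x)).mem_nhds (hk x)] with y h1 h2
    exact (key a (k x) y h1 h2).symm
  · have h1 := hf.comm a a' (k x) (k x) x ha ha' (hk x) (hk x)
    rw [ℓ.g_self _ x (hk x), mul_one] at h1
    rw [h1, mul_assoc]
    rfl
  · have hb := hk (proj Λ v)
    have e : (fun w => f a (k (proj Λ w)) (proj Λ w) * t (k (proj Λ w)) (proj Λ w)) =ᶠ[𝓝 v]
        fun w => f a (k (proj Λ v)) (proj Λ w) * t (k (proj Λ v)) (proj Λ w) := by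
      filter_upwards [eventually_proj_mem (ℓ'.isOpen_U a) ha,
        eventually_proj_mem (ℓ.isOpen_U _) hb] with w h1 h2
      exact key a _ _ h1 h2
    rw [dlog_congr e, dlog_mul_of_mem (hm a _ _ ha hb) (ht.mem _ _ hb),
      dlog_eq_zero_of_mem (hf.mem_f a _ _ ha hb), zero_add]
    exact h _ i v hb hi

theorem eventually_eq_of_dlog_eq_zero {f : V ⧸ Λ → ℂ} {v : V}
    (h : ∀ᶠ w in 𝓝 v, (smoothUnits Λ).mem f (proj Λ w) ∧ dlog (fun w => f (proj Λ w)) w = 0) :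
    ∀ᶠ w in 𝓝 v, f (proj Λ w) = f (proj Λ v) := by
  obtain ⟨ε, hε, h⟩ := Metric.eventually_nhds_iff_ball.mp h
  filter_upwards [Metric.ball_mem_nhds v hε] with w hw
  refine Metric.isOpen_ball.is_const_of_fderiv_eq_zero (𝕜 := ℝ)
    (f := fun w => f (proj Λ w)) (convex_ball v ε).isPreconnected
    (fun z hz => (differentiableAt_of_mem (h z hz).1).differentiableWithinAt) (fun z hz => ?_) hw
    (Metric.mem_ball_self hε)
  have h1 := (h z hz).2
  refine ContinuousLinearMap.ext fun u => ?_
  have h2 := congrArg (fun L : V →L[ℝ] ℂ => L u) h1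
  simp only [dlog, smul_apply, smul_eq_mul, zero_apply] at h2
  exact (mul_eq_zero.mp h2).resolve_left (inv_ne_zero (h z hz).1.1)

/-- Fixing the connection forces `dlog t = 0`, so `t` is locally constant; division by its norm
makes it `U(1)`-valued and respects the unitary transition functions. -/
theorem IsShift.isIso_triv [DiscreteTopology Λ] (h : IsShift ℓ D D) :
    CechCocycle.IsIso ℓ (CechCocycle.triv _) := by
  obtain ⟨t, ht, h⟩ := h
  refine ⟨fun a _ x => t a x / ‖t a x‖, fun a _ x ha _ => ⟨?_, ?_⟩, fun a a' _ _ x ha ha' _ _ => ?_⟩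
  · rw [norm_div, Complex.norm_real, norm_norm]
    exact div_self (norm_ne_zero_iff.mpr (ht.mem a x ha).1)
  · obtain ⟨v, rfl⟩ := proj_surjective x
    refine eventually_of_eventually_proj ?_
    have h1 : ∀ᶠ w in 𝓝 v, t a (proj Λ w) = t a (proj Λ v) := by
      refine eventually_eq_of_dlog_eq_zero ?_
      filter_upwards [eventually_proj_mem (ℓ.isOpen_U a) ha] with w hw
      obtain ⟨i, hi⟩ := c.cover (proj Λ w)
      exact ⟨ht.mem a _ hw, by simpa using h a i w hw hi⟩
    filter_upwards [h1] with w hw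
    rw [hw]
  · have h1 : t a x = ℓ.g a a' x * t a' x := ht.eq _ _ _ ha ha'
    change _ * 1 = _
    rw [mul_one, h1, norm_mul, (ℓ.mem_g a a' x ha ha').1, one_mul, mul_div_assoc]

/-- Every trivialization of a local system gives a closed form with a positive scaling function. -/
theorem IsTrivialization.exists_form {t : ℓ.ι → V ⧸ Λ → ℂ}
    (ht : IsTrivialization (ℓ.map (circleConst_le_smooth Λ)) t) :
    ∃ (τ : V ⧸ Λ → V →L[ℝ] ℂ) (ρ : V ⧸ Λ → ℝ), (∀ x, SmoothAt τ x) ∧ IsClosedForm τ ∧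
      Connection.IsScaling ρ τ ∧ ∀ a v, proj Λ v ∈ ℓ.U a →
        τ (proj Λ v) = dlog (fun w => t a (proj Λ w)) v := by
  have hm : ∀ a x, x ∈ ℓ.U a → (smoothUnits Λ).mem (t a) x := ht.mem
  have he : ∀ a b x, x ∈ ℓ.U a → x ∈ ℓ.U b → t a x = ℓ.g a b x * t b x := ht.eq
  obtain ⟨τ, hτ, hτ'⟩ := exists_glue_smooth ℓ.isOpen_U ℓ.cover (fun a => dlogForm (t a))
    (fun a x ha => SmoothAt.dlogForm (hm a x ha).2 (hm a x ha).1) (by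
      intro a b x ha hb
      obtain ⟨v, rfl⟩ := proj_surjective x
      rw [dlogForm_proj, dlogForm_proj]
      have e : (fun w => t a (proj Λ w)) =ᶠ[𝓝 v] fun w => ℓ.g a b (proj Λ w) * t b (proj Λ w) := by
        filter_upwards [eventually_proj_mem (ℓ.isOpen_U a) ha,
          eventually_proj_mem (ℓ.isOpen_U b) hb] with w h1 h2 using he a b _ h1 h2
      rw [dlog_congr e, dlog_mul_of_mem (circleConst_le_smooth Λ _ _ (ℓ.mem_g a b _ ha hb))
        (hm b _ hb), dlog_eq_zero_of_mem (ℓ.mem_g a b _ ha hb), zero_add])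
  obtain ⟨ρ, hρ, hρ'⟩ := exists_glue_smooth ℓ.isOpen_U ℓ.cover (fun a x => ‖t a x‖ ^ 2)
    (fun a x ha v hv => ((hm a x ha).2 v hv).norm_sq ℂ) (by
      intro a b x ha hb
      rw [he a b x ha hb, norm_mul, (ℓ.mem_g a b x ha hb).1, one_mul])
  have hval : ∀ a v, proj Λ v ∈ ℓ.U a → τ (proj Λ v) = dlog (fun w => t a (proj Λ w)) v :=
    fun a v ha => by rw [hτ' a _ ha, dlogForm_proj]
  refine ⟨τ, ρ, hτ, fun v x y => ?_, ⟨hρ, fun x => ?_, fun v w => ?_⟩, hval⟩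
  · obtain ⟨a, ha⟩ := ℓ.cover (proj Λ v)
    have e : (fun w => τ (proj Λ w)) =ᶠ[𝓝 v] dlog (fun w => t a (proj Λ w)) := by
      filter_upwards [eventually_proj_mem (ℓ.isOpen_U a) ha] with w hw using hval a w hw
    rw [e.fderiv_eq]
    exact fderiv_dlog_symm ((hm a _ ha).2 v rfl) (hm a _ ha).1 x y
  · obtain ⟨a, ha⟩ := ℓ.cover x
    rw [hρ' a x ha]
    exact pow_pos (norm_pos_iff.mpr (hm a x ha).1) 2
  · obtain ⟨a, ha⟩ := ℓ.cover (proj Λ v)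
    have dt := differentiableAt_of_mem (hm a _ ha)
    have dt' : DifferentiableAt ℝ (fun w => conj (t a (proj Λ w))) v :=
      (Complex.conjCLE : ℂ →L[ℝ] ℂ).differentiableAt.comp v dt
    have t0 := (hm a _ ha).1
    have e : (fun w => (ρ (proj Λ w) : ℂ)) =ᶠ[𝓝 v]
        fun w => t a (proj Λ w) * conj (t a (proj Λ w)) := by
      filter_upwards [eventually_proj_mem (ℓ.isOpen_U a) ha] with w hw
      rw [hρ' a _ hw, Complex.mul_conj, Complex.normSq_eq_norm_sq]
    have h1 := dlog_mul dt dt' t0 ((map_ne_zero _).mpr t0)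
    rw [← dlog_congr e, dlog_conj dt, ← hval a v ha] at h1
    have h2 := fderiv_continuousLinearMap_comp_apply Complex.ofRealCLM
      (SmoothAt.differentiableAt (hρ (proj Λ v))) w
    simp only [Complex.ofRealCLM_apply] at h2
    have h3 := congrArg (fun L : V →L[ℝ] ℂ => L w) h1
    have hne : (ρ (proj Λ v) : ℂ) ≠ 0 := by
      rw [show (ρ (proj Λ v) : ℂ) = _ from e.eq_of_nhds]
      exact mul_ne_zero t0 ((map_ne_zero _).mpr t0)
    simp only [dlog, smul_apply, smul_eq_mul, h2, add_apply, conjForm_apply] at h3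
    rw [← h3, mul_inv_cancel_left₀ hne]

end Shift

/-! ### The torsor of `E`-flat connections under `H¹(X, U(1))`. -/

section ShiftEFlat

variable {V : Type u} [NormedAddCommGroup V] [NormedSpace ℂ V] [FiniteDimensional ℂ V]
variable {Λ : Submodule ℤ V} [DiscreteTopology Λ] [IsZLattice ℝ Λ]
variable {c : LineBundle Λ} {E : V → V → ℝ}

/-- The logarithmic derivative of a smooth trivialization of `ℓ` is a global closed form with a
scaling function, so adding it preserves curvature and unitarity. -/
theorem exists_isShift (ℓ : CechCocycle (circleConst Λ)) (D : EFlatConnection c E) :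
    ∃ D' : EFlatConnection c E, IsShift ℓ D.1 D'.1 := by
  obtain ⟨t, ht⟩ := exists_isTrivialization ℓ
  obtain ⟨τ, ρ, hτ, hc, hρ, hval⟩ := ht.exists_form
  refine ⟨⟨D.1.addForm τ hτ, D.2.1.addForm hτ hc, D.2.2.addForm hτ hρ⟩, t, ht,
    fun a i v ha hi => ?_⟩
  rw [← hval a v ha]
  rfl

/-- Since `2 Re τ = d log ρ`, the constant form `2 Re r` is the differential of the periodic
function `log ρ - 2 Re ψ`, hence zero. -/
theorem Connection.IsScaling.re_const_eq_zero {ρ : V ⧸ Λ → ℝ} {τ : V ⧸ Λ → V →L[ℝ] ℂ} 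
    (hρ : Connection.IsScaling ρ τ)
    {r : V →L[ℝ] ℂ} {ψ : V → ℂ} (hψ : IsPeriodic Λ ψ)
    (hψ' : ∀ v, HasFDerivAt ψ (τ (proj Λ v) - r) v) (w : V) : (r w).re = 0 := by
  have : FiniteDimensional ℝ V := FiniteDimensional.complexToReal V
  have h1 : ∀ v, HasFDerivAt (fun v => Real.log (ρ (proj Λ v)))
      ((2 : ℝ) • (Complex.reCLM ∘L τ (proj Λ v))) v := by
    intro v
    have h2 : HasFDerivAt (fun w => ρ (proj Λ w)) _ v :=
      (hρ.smooth (proj Λ v)).differentiableAt.hasFDerivAt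
    refine (h2.log (hρ.pos _).ne').congr_fderiv (ContinuousLinearMap.ext fun w => ?_)
    have h3 := hρ.fderiv_eq v w
    rw [Complex.add_conj, ← Complex.ofReal_mul, Complex.ofReal_inj] at h3
    simp only [smul_apply, smul_eq_mul, h3, ContinuousLinearMap.comp_apply,
      Complex.reCLM_apply]
    rw [inv_mul_cancel_left₀ (hρ.pos _).ne']
  have h2 : ∀ v, HasFDerivAt (fun v => Real.log (ρ (proj Λ v)) - 2 * (ψ v).re)
      ((2 : ℝ) • (Complex.reCLM ∘L r)) v := by
    intro v
    have h3 : HasFDerivAt (fun v => (ψ v).re) (Complex.reCLM ∘L (τ (proj Λ v) - r)) v :=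
      Complex.reCLM.hasFDerivAt.comp v (hψ' v)
    refine ((h1 v).sub (h3.const_mul 2)).congr_fderiv (ContinuousLinearMap.ext fun w => ?_)
    simp
    ring
  have h3 := eq_zero_of_periodic_of_hasFDerivAt_const (Λ := Λ)
    (fun v l hl => by simp only [proj_add_of_mem v hl, hψ v l hl]) h2
  have h4 := congrArg (fun L : V →L[ℝ] ℝ => L w) h3
  simpa using h4

/-- The difference is `τ = r + dψ` with `r` imaginary: `exp ψ` accounts for `dψ` as a gauge
transformation, and a local system accounts for `r`. -/
theorem exists_isShift_of_isEFlat (D D' : EFlatConnection c E) :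
    ∃ ℓ, IsShift ℓ D.1 D'.1 := by
  have : FiniteDimensional ℝ V := FiniteDimensional.complexToReal V
  obtain ⟨τ, hτ, h⟩ := D.1.exists_sub D'.1
  obtain ⟨ρ, hρ⟩ := Connection.exists_isScaling D.2.2 D'.2.2 h
  obtain ⟨-, F, hF, hinv⟩ := D.2.1
  obtain ⟨-, F', hF', hinv'⟩ := D'.2.1
  have hc := Connection.isClosedForm_of_hasCurvature hF hF' hinv hinv' hτ h
  obtain ⟨r, ψ, hψs, hψp, hψ⟩ := exists_eq_const_add_fderiv (Λ := Λ) (contDiff_of_smoothAt hτ)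
    (isPeriodic_comp_proj τ) hc
  have hr := hρ.re_const_eq_zero hψp hψ
  obtain ⟨φ, hφ, hφs⟩ := exists_descent (Λ := Λ) (f := fun v => Complex.exp (ψ v))
    (fun v l hl => by simp only [hψp v l hl]) hψs.cexp
  have hφm : ∀ x, (smoothUnits Λ).mem φ x := fun x => ⟨by
    obtain ⟨v, rfl⟩ := proj_surjective x
    rw [hφ]
    exact Complex.exp_ne_zero _, hφs x⟩
  have hT := isTrivialization_localSystemTriv (Λ := Λ) (-(Complex.imCLM ∘L r))
  -- The trivialization of `localSystem s` has logarithmic derivative `-i s`; with `s = -Im r` this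
  -- is `i Im r = r`.
  refine ⟨localSystem (-(Complex.imCLM ∘L r)),
    fun a x => localSystemTriv (-(Complex.imCLM ∘L r)) a x * φ x,
    ⟨fun a x ha => (smoothUnits Λ).mul (hT.mem a x ha) (hφm x), fun a b x ha hb => ?_⟩,
    fun a i v ha hi => ?_⟩
  · rw [hT.eq a b x ha hb, mul_assoc]
  · have e : dlog (fun w => φ (proj Λ w)) v = τ (proj Λ v) - r := by
      simp only [hφ]
      exact dlog_exp (hψ v)
    rw [dlog_mul_of_mem (hT.mem a _ ha) (hφm _), dlog_localSystemTriv _ ha, e, h i _ hi]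
    congr 1
    ext w
    have h1 : r w = (r w).im * Complex.I := by
      conv_lhs => rw [← Complex.re_add_im (r w), hr w]
      simp
    simp
    linear_combination h1

/-- The `E`-flat connections up to gauge equivalence are a torsor under `H¹(X, U(1))`. -/
theorem exists_torsor_H1Circle (hE : HasChernClass c E) {G : Type v} [Group G]
    (e : H1Circle Λ ≃* G) : ∃ _ : Torsor G (EFlatSpace c E),
      ∀ (ℓ : CechCocycle (circleConst Λ)) (D D' : EFlatConnection c E),
        e (CechH1.mk ℓ) • EFlatSpace.mk D = EFlatSpace.mk D' ↔ IsShift ℓ D.1 D'.1 := by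
  have hne : Nonempty (EFlatSpace c E) := by
    obtain ⟨D, F, hF, hu, hinv, -⟩ := exists_unitary_connection hE
    exact ⟨EFlatSpace.mk ⟨D, ⟨hE, F, hF, hinv⟩, hu⟩⟩
  let R : H1Circle Λ → EFlatSpace c E → EFlatSpace c E → Prop := fun χ P Q =>
    ∃ ℓ D D', CechH1.mk ℓ = χ ∧ EFlatSpace.mk D = P ∧ EFlatSpace.mk D' = Q ∧ IsShift ℓ D.1 D'.1
  have sound : ∀ D D' : EFlatConnection c E,
      EFlatSpace.mk D = EFlatSpace.mk D' ↔ Connection.GaugeEquiv D.1 D'.1 := fun D D' =>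
    Quotient.eq
  have sound' : ∀ ℓ ℓ' : CechCocycle (circleConst Λ),
      CechH1.mk ℓ = CechH1.mk ℓ' ↔ CechCocycle.IsIso ℓ ℓ' := fun ℓ ℓ' => Quotient.eq
  -- Gauge equivalences are shifts by the trivial local system, so changes of representatives are
  -- absorbed by composing shifts.
  have hR : ∀ ℓ D D', R (CechH1.mk ℓ) (EFlatSpace.mk D) (EFlatSpace.mk D') ↔
      IsShift ℓ D.1 D'.1 := by
    intro ℓ D D'
    refine ⟨?_, fun h => ⟨ℓ, D, D', rfl, rfl, rfl, h⟩⟩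
    rintro ⟨ℓ₁, D₁, D₁', h1, h2, h3, h⟩
    have g1 := isShift_triv_iff.mpr ((sound D D₁).mp h2.symm)
    have g2 := isShift_triv_iff.mpr ((sound D₁' D').mp h3)
    refine ((g1.tensor h).tensor g2).congr ((sound' _ _).mp ?_)
    change _ = (1 * CechH1.mk ℓ₁) * 1
    rw [mul_one, one_mul, h1]
  obtain ⟨T, hT⟩ := exists_torsor_of_relation (G := G) (fun g P Q => R (e.symm g) P Q)
    (by
      rintro ⟨D⟩ ⟨D'⟩
      rw [map_one]
      exact (hR (CechCocycle.triv _) D D').trans (isShift_triv_iff.trans (sound D D').symm))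
    (by
      rintro g h ⟨D⟩ ⟨D'⟩ ⟨D''⟩ h1 h2
      rw [map_mul]
      obtain ⟨ℓ, hℓ⟩ := Quotient.exists_rep (e.symm g)
      obtain ⟨ℓ', hℓ'⟩ := Quotient.exists_rep (e.symm h)
      rw [← hℓ] at h1 ⊢
      rw [← hℓ'] at h2 ⊢
      exact (hR (ℓ.tensor ℓ') D D'').mpr (((hR ℓ D D').mp h1).tensor ((hR ℓ' D' D'').mp h2)))
    (fun g h => e.symm.injective (by rw [map_mul, map_mul, mul_comm]))
    (by
      rintro g ⟨D⟩ ⟨D'⟩ h1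
      rw [map_inv]
      obtain ⟨ℓ, hℓ⟩ := Quotient.exists_rep (e.symm g)
      rw [← hℓ] at h1 ⊢
      exact (hR ℓ.dual D' D).mpr ((hR ℓ D D').mp h1).dual)
    (by
      rintro g ⟨D⟩
      obtain ⟨ℓ, hℓ⟩ := Quotient.exists_rep (e.symm g)
      rw [← hℓ]
      obtain ⟨D', h⟩ := exists_isShift ℓ D
      exact ⟨EFlatSpace.mk D', (hR ℓ D D').mpr h⟩)
    (by
      rintro g ⟨D⟩ h1
      obtain ⟨ℓ, hℓ⟩ := Quotient.exists_rep (e.symm g)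
      rw [← hℓ] at h1
      have h2 : (CechH1.mk ℓ : H1Circle Λ) = 1 :=
        (sound' ℓ (CechCocycle.triv _)).mpr ((hR ℓ D D).mp h1).isIso_triv
      have hℓ' : (CechH1.mk ℓ : H1Circle Λ) = e.symm g := hℓ
      exact e.symm.injective ((hℓ'.symm.trans h2).trans (map_one e.symm).symm))
    (by
      rintro ⟨D⟩ ⟨D'⟩
      obtain ⟨ℓ, h⟩ := exists_isShift_of_isEFlat D D'
      refine ⟨e (CechH1.mk ℓ), ?_⟩
      rw [e.symm_apply_apply]
      exact (hR ℓ D D').mpr h)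
  refine ⟨T, fun ℓ D D' => ?_⟩
  rw [hT, e.symm_apply_apply]
  exact hR ℓ D D'

end ShiftEFlat

end ComplexTorus

/-! ### Complex linearity and the Cauchy–Riemann equations. -/

section ComplexLinear

variable {V : Type u} [NormedAddCommGroup V] [NormedSpace ℂ V]

theorem antiForm_eq_zero_iff {a : V →L[ℝ] ℂ} :
    antiForm a = 0 ↔ ∀ w, a (Complex.I • w) = Complex.I * a w := by
  constructor
  · intro h w
    have h1 := congrArg (fun L : V →L[ℝ] ℂ => L w) h
    simp only [antiForm_apply, zero_apply] at h1
    linear_combination (-2 * Complex.I) * h1 + a (Complex.I • w) * Complex.I_sq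
  · intro h
    ext w
    simp only [antiForm_apply, h, zero_apply]
    linear_combination 1 / 2 * a w * Complex.I_sq

theorem antiForm_apply_I_smul (a : V →L[ℝ] ℂ) (w : V) :
    antiForm a (Complex.I • w) = -Complex.I * antiForm a w := by
  simp only [antiForm_apply, smul_smul, Complex.I_mul_I, neg_one_smul, map_neg]
  linear_combination 1 / 2 * a (Complex.I • w) * Complex.I_sq

theorem exists_restrictScalars_eq {a : V →L[ℝ] ℂ} (h : antiForm a = 0) :
    ∃ a' : V →L[ℂ] ℂ, a'.restrictScalars ℝ = a := by
  refine ⟨{ toFun := a, map_add' := a.map_add, map_smul' := fun z w => ?_, cont := a.cont }, rfl⟩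
  have h1 : z • w = z.re • w + z.im • (Complex.I • w) := by
    conv_lhs => rw [← Complex.re_add_im z]
    rw [add_smul, mul_smul, Complex.coe_smul, Complex.coe_smul]
  rw [h1, map_add, map_smul, map_smul, antiForm_eq_zero_iff.mp h]
  simp only [Complex.real_smul, RingHom.id_apply, smul_eq_mul]
  conv_rhs => rw [← Complex.re_add_im z]
  ring

theorem HasFDerivAt.differentiableAt_complex {f : V → ℂ} {a : V →L[ℝ] ℂ} {v : V}
    (hf : HasFDerivAt f a v) (h : antiForm a = 0) : DifferentiableAt ℂ f v := by
  obtain ⟨a', ha'⟩ := exists_restrictScalars_eq h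
  exact (hasFDerivAt_of_restrictScalars ℝ hf ha').differentiableAt

theorem antiForm_dlog {f : V → ℂ} {v : V} (hf : DifferentiableAt ℂ f v) :
    antiForm (dlog f v) = 0 := by
  rw [antiForm_eq_zero_iff]
  intro w
  simp only [dlog, smul_apply, smul_eq_mul, hf.fderiv_restrictScalars ℝ,
    ContinuousLinearMap.coe_restrictScalars', map_smul]
  ring

theorem differentiableAt_of_antiForm_dlog {f : V → ℂ} {v : V} (hf : DifferentiableAt ℝ f v)
    (hf0 : f v ≠ 0) (h : antiForm (dlog f v) = 0) : DifferentiableAt ℂ f v := by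
  refine hf.hasFDerivAt.differentiableAt_complex ?_
  rw [antiForm_eq_zero_iff] at h ⊢
  intro w
  have h1 := h w
  simp only [dlog, smul_apply, smul_eq_mul] at h1
  refine mul_left_cancel₀ (inv_ne_zero hf0) ?_
  rw [h1]
  ring

end ComplexLinear

/-! ### Compatibility with the holomorphic structure: existence and uniqueness. -/

namespace ComplexTorus

section Holomorphic

variable {V : Type u} [NormedAddCommGroup V] [NormedSpace ℂ V] {Λ : Submodule ℤ V}

theorem isHolCompatible_iff {L : HolLineBundle Λ} {D : Connection (toComplex L)} :
    D.IsHolCompatible ↔ ∀ i x, x ∈ L.U i → antiForm (D.A i x) = 0 :=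
  forall₃_congr fun _ _ _ => antiForm_eq_zero_iff.symm

/-- A connection with curvature of type `(1,1)` becomes compatible with the holomorphic structure
by adding an imaginary constant form and an exact form. -/
theorem exists_antiForm_add_eq_zero [FiniteDimensional ℂ V] [DiscreteTopology Λ] [IsZLattice ℝ Λ]
    {L : HolLineBundle Λ} {D : Connection (toComplex L)} {F : V ⧸ Λ → V [⋀^Fin 2]→L[ℝ] ℂ}
    (hF : D.HasCurvature F)
    (h11 : ∀ x v w, F x ![Complex.I • v, Complex.I • w] = F x ![v, w]) :
    ∃ (r : V →L[ℝ] ℂ) (φ : V → ℂ), ContDiff ℝ ∞ φ ∧ IsPeriodic Λ φ ∧ (∀ w, (r w).re = 0) ∧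
      ∀ i v, proj Λ v ∈ L.U i → antiForm (D.A i (proj Λ v) + (r - fderiv ℝ φ v)) = 0 := by
  have : FiniteDimensional ℝ V := FiniteDimensional.complexToReal V
  -- The `(0,1)`-parts of the connection forms glue because the logarithmic derivatives of
  -- holomorphic transition functions are of type `(1,0)`.
  obtain ⟨σ, hσ, hσ'⟩ := exists_glue_smooth L.isOpen_U L.cover (fun i x => antiForm (D.A i x))
    (fun i x hx v hv => antiForm.contDiff.contDiffAt.comp v (D.smooth i x hx v hv)) (by
      intro i j x hi hj
      obtain ⟨v, rfl⟩ := proj_surjective x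
      rw [D.transform_dlog (j := j) hi hj, map_add]
      have := antiForm_dlog ((L.mem_g i j _ hi hj).2.2 v rfl)
      exact (add_eq_left.mpr this).symm)
  -- This is `∂̄σ = 0`, the vanishing of the `(0,2)`-part of the curvature. It combines the type
  -- condition at `(x, y)` and at `(x, i y)`.
  have hclosed : ∀ v x y, fderiv ℝ (fun w => σ (proj Λ w)) v x y +
        Complex.I * fderiv ℝ (fun w => σ (proj Λ w)) v (Complex.I • x) y =
      fderiv ℝ (fun w => σ (proj Λ w)) v y x +
        Complex.I * fderiv ℝ (fun w => σ (proj Λ w)) v (Complex.I • y) x := by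
    intro v x y
    obtain ⟨i, hi⟩ := L.cover (proj Λ v)
    have hd : DifferentiableAt ℝ (fun w => D.A i (proj Λ w)) v := D.differentiableAt hi
    have e : (fun w => σ (proj Λ w)) =ᶠ[𝓝 v] fun w => antiForm (D.A i (proj Λ w)) :=
      eventuallyEq_comp_proj (L.isOpen_U i) (hσ' i) hi
    have h1 := h11 (proj Λ v) x y
    have h2 := h11 (proj Λ v) x (Complex.I • y)
    rw [hF i v hi, dOne_apply hd, dOne_apply hd] at h1 h2
    simp only [smul_smul, Complex.I_mul_I, neg_one_smul, map_neg, neg_apply] at h2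
    rw [e.fderiv_eq]
    simp only [fderiv_continuousLinearMap_comp_apply antiForm hd, antiForm_apply]
    have hI := Complex.I_sq
    generalize fderiv ℝ (fun w => D.A i (proj Λ w)) v = B at *
    linear_combination -1 / 2 * h1 - Complex.I / 2 * h2 +
      1 / 2 * (B (Complex.I • x) (Complex.I • y) - B (Complex.I • y) (Complex.I • x)) * hI
  obtain ⟨n, b, rfl⟩ := exists_basis_latticeOf_eq Λ
  obtain ⟨φ, hφ, hp, h⟩ := LatticeFourier.exists_dbar_primitive (contDiff_of_smoothAt hσ)
    (isPeriodic_comp_proj σ) hclosed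
  -- By the choice of `φ`, this is the constant value of `σ - ∂̄φ`.
  set a₀ : V →L[ℝ] ℂ := σ (proj _ 0) - antiForm (fderiv ℝ φ 0) with ha₀
  have hanti : ∀ w, a₀ (Complex.I • w) = -Complex.I * a₀ w := by
    intro w
    obtain ⟨i, hi⟩ := L.cover (proj _ 0)
    rw [ha₀, hσ' i _ hi, ← map_sub, antiForm_apply_I_smul]
  -- `conj a₀` is of type `(1,0)`, so `conj a₀ - a₀` is imaginary and its `(0,1)`-part is `-a₀`.
  refine ⟨conjForm a₀ - a₀, φ, hφ, hp, fun w => ?_, fun i v hi => ?_⟩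
  · simp only [sub_apply, conjForm_apply, Complex.sub_re, Complex.conj_re, sub_self]
  · have h1 : antiForm (conjForm a₀ - a₀) = -a₀ := by
      ext w
      simp only [antiForm_apply, sub_apply, conjForm_apply, hanti, neg_apply, map_mul, map_neg,
        Complex.conj_I]
      linear_combination 1 / 2 * (conj (a₀ w) + a₀ w) * Complex.I_sq
    rw [map_add, map_sub, h1, ← hσ' i _ hi]
    ext w
    have h0 := h v 0 w
    simp only [ha₀, add_apply, sub_apply, neg_apply, antiForm_apply, zero_apply]
    linear_combination h0

theorem _root_.fderiv_fderiv_symm {W : Type*} [NormedAddCommGroup W] [NormedSpace ℝ W] {φ : W → ℂ}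
    (hφ : ContDiff ℝ ∞ φ) (v x y : W) :
    fderiv ℝ (fderiv ℝ φ) v x y = fderiv ℝ (fderiv ℝ φ) v y x :=
  ((contDiff_infty.mp hφ 2).contDiffAt.isSymmSndFDerivAt (n := 2) (by simp)).eq x y

/-- A flat unitary connection with curvature of type `(1,1)` can be made compatible with the
holomorphic structure. -/
theorem exists_isHolCompatible [FiniteDimensional ℂ V] [DiscreteTopology Λ] [IsZLattice ℝ Λ]
    {L : HolLineBundle Λ} {D : Connection (toComplex L)} {F : V ⧸ Λ → V [⋀^Fin 2]→L[ℝ] ℂ}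
    (hF : D.HasCurvature F) (hu : D.IsUnitary)
    (h11 : ∀ x v w, F x ![Complex.I • v, Complex.I • w] = F x ![v, w]) :
    ∃ D' : Connection (toComplex L), D'.HasCurvature F ∧ D'.IsUnitary ∧ D'.IsHolCompatible := by
  obtain ⟨r, φ, hφ, hp, hr, h⟩ := exists_antiForm_add_eq_zero hF h11
  have hφ1 : ContDiff ℝ ∞ (fderiv ℝ φ) := hφ.fderiv_right (by simp)
  obtain ⟨τ, hτv, hτ⟩ := exists_descent (Λ := Λ) (f := fun v => r - fderiv ℝ φ v)
    (fun v l hl => by simp only [isPeriodic_fderiv hp v l hl]) (contDiff_const.sub hφ1)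
  -- As `r` is imaginary, `τ + conj τ = -2 d (Re φ)`, which is `d log ρ` for this `ρ`.
  obtain ⟨ρ, hρv, hρ⟩ := exists_descent (Λ := Λ) (f := fun v => Real.exp (-2 * (φ v).re))
    (fun v l hl => by simp only [hp v l hl])
    (contDiff_const.mul (Complex.reCLM.contDiff.comp hφ)).exp
  have hc : IsClosedForm τ := by
    intro v x y
    simp only [hτv]
    rw [fderiv_const_sub]
    simp only [neg_apply, fderiv_fderiv_symm hφ v x y]
  have hs : Connection.IsScaling ρ τ := by
    refine ⟨hρ, fun x => ?_, fun v w => ?_⟩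
    · obtain ⟨v, rfl⟩ := proj_surjective x
      rw [hρv]
      exact Real.exp_pos _
    · have h1 : HasFDerivAt (fun v => (φ v).re) (Complex.reCLM ∘L fderiv ℝ φ v) v :=
        Complex.reCLM.hasFDerivAt.comp v (hφ.differentiable (by simp) v).hasFDerivAt
      simp only [hρv]
      rw [(h1.const_mul (-2)).exp.fderiv, hτv, Complex.add_conj]
      simp only [smul_apply, smul_eq_mul, ContinuousLinearMap.comp_apply, Complex.reCLM_apply,
        sub_apply, Complex.sub_re, hr]
      push_cast
      ring
  refine ⟨D.addForm τ hτ, hF.addForm_of_isClosed hτ hc, hu.addForm hτ hs,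
    isHolCompatible_iff.mpr fun i x hx => ?_⟩
  obtain ⟨v, rfl⟩ := proj_surjective x
  change antiForm (D.A i (proj Λ v) + τ (proj Λ v)) = 0
  rw [hτv]
  exact h i v hx

/-- The difference `τ` is closed and of type `(1,0)`, so the exponential of its primitive is entire.
Unitarity makes it bounded, and Liouville's theorem makes it constant. -/
theorem eqOn_of_isHolCompatible [FiniteDimensional ℂ V] [DiscreteTopology Λ] [IsZLattice ℝ Λ]
    {L : HolLineBundle Λ} {E : V → V → ℝ} {D D' : Connection (toComplex L)} (hD : D.IsEFlat E)
    (hD' : D'.IsEFlat E) (hu : D.IsUnitary) (hu' : D'.IsUnitary) (hh : D.IsHolCompatible)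
    (hh' : D'.IsHolCompatible) (i : L.ι) : Set.EqOn (D'.A i) (D.A i) (L.U i) := by
  have : FiniteDimensional ℝ V := FiniteDimensional.complexToReal V
  obtain ⟨τ, hτ, h⟩ := D.exists_sub D'
  obtain ⟨ρ, hρ⟩ := Connection.exists_isScaling hu hu' h
  obtain ⟨-, F, hF, hinv⟩ := hD
  obtain ⟨-, F', hF', hinv'⟩ := hD'
  have hc := Connection.isClosedForm_of_hasCurvature hF hF' hinv hinv' hτ h
  have hlin : ∀ x, antiForm (τ x) = 0 := by
    intro x
    obtain ⟨i, hi⟩ := L.cover x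
    have h1 := isHolCompatible_iff.mp hh' i x hi
    rwa [h i x hi, map_add, isHolCompatible_iff.mp hh i x hi, zero_add] at h1
  obtain ⟨r, ψ, hψs, hψp, hψ⟩ := exists_eq_const_add_fderiv (Λ := Λ) (contDiff_of_smoothAt hτ)
    (isPeriodic_comp_proj τ) hc
  have hr := hρ.re_const_eq_zero hψp hψ
  have hΦ : ∀ v, HasFDerivAt (fun v => Complex.exp (ψ v + r v))
      (Complex.exp (ψ v + r v) • τ (proj Λ v)) v := by
    intro v
    have h1 := ((hψ v).fun_add r.hasFDerivAt).cexp
    rwa [sub_add_cancel] at h1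
  have hdiff : Differentiable ℂ (fun v => Complex.exp (ψ v + r v)) := by
    intro v
    refine (hΦ v).differentiableAt_complex (antiForm_eq_zero_iff.mpr fun w => ?_)
    simp only [smul_apply, smul_eq_mul, antiForm_eq_zero_iff.mp (hlin (proj Λ v)) w]
    ring
  -- Since `r` is imaginary, the modulus is `exp (Re ψ)`, a continuous periodic function.
  have hb : Bornology.IsBounded (Set.range fun v => Complex.exp (ψ v + r v)) := by
    obtain ⟨C, hC⟩ := (IsZLattice.isCompact_range_of_periodic Λ (fun v => Real.exp (ψ v).re)
      (Real.continuous_exp.comp (Complex.continuous_re.comp hψs.continuous))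
      fun z w hw => by simp only [hψp z w hw]).isBounded.exists_norm_le
    refine isBounded_iff_forall_norm_le.mpr ⟨C, ?_⟩
    rintro _ ⟨v, rfl⟩
    have h1 := hC _ ⟨v, rfl⟩
    rw [Complex.norm_exp, Complex.add_re, hr v, add_zero]
    exact (le_abs_self _).trans h1
  have hconst : ∀ v, τ (proj Λ v) = 0 := by
    intro v
    have e : (fun v => Complex.exp (ψ v + r v)) = fun _ => Complex.exp (ψ 0 + r 0) :=
      funext fun z => hdiff.apply_eq_apply_of_bounded hb z 0
    have h1 := hΦ v
    rw [e] at h1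
    have h2 := h1.unique (hasFDerivAt_const _ v)
    ext w
    have h3 := congrArg (fun L : V →L[ℝ] ℂ => L w) h2
    simpa [Complex.exp_ne_zero] using h3
  intro x hx
  obtain ⟨v, rfl⟩ := proj_surjective x
  rw [h i _ hx, hconst, add_zero]

end Holomorphic

/-! ### The isomorphism of `H¹(X, U(1))` with `Pic⁰`. -/

section Picard

variable {V : Type u} [NormedAddCommGroup V] [NormedSpace ℂ V] {Λ : Submodule ℤ V}

theorem isIso_triv_iff {c : LineBundle Λ} :
    CechCocycle.IsIso c (CechCocycle.triv _) ↔ ∃ t, IsTrivialization c t := by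
  constructor
  · rintro ⟨f, hf⟩
    refine ⟨fun a => f a PUnit.unit, fun a x ha => hf.mem_f a _ x ha trivial,
      fun a b x ha hb => ?_⟩
    rw [← hf.comm a b PUnit.unit PUnit.unit x ha hb trivial trivial]
    exact (mul_one _).symm
  · rintro ⟨t, ht⟩
    exact ⟨fun a _ => t a, fun a _ x ha _ => ht.mem a x ha, fun a a' _ _ x ha ha' _ _ =>
      (mul_one _).trans (ht.eq a a' x ha ha')⟩

theorem mk_mem_Pic0_iff {L : HolLineBundle Λ} :
    CechH1.mk L ∈ Pic0 Λ ↔ ∃ t, IsTrivialization (toComplex L) t := by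
  rw [← isIso_triv_iff]
  exact Quotient.eq (r := CechCocycle.setoid (smoothUnits Λ)) (x := toComplex L)
    (y := CechCocycle.triv _)

theorem flatToPic_mem_Pic0 [FiniteDimensional ℂ V] [DiscreteTopology Λ] [IsZLattice ℝ Λ]
    (χ : H1Circle Λ) : flatToPic Λ χ ∈ Pic0 Λ := by
  obtain ⟨ℓ, rfl⟩ := Quotient.exists_rep χ
  exact mk_mem_Pic0_iff.mpr (exists_isTrivialization ℓ)

/-- A holomorphic trivialization has a globally defined modulus `N`, because the transition
functions are unitary. By compactness and the maximum principle `N` is constant, so the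
trivialization is locally constant. -/
theorem flatToPic_injective [FiniteDimensional ℂ V] [DiscreteTopology Λ] [IsZLattice ℝ Λ] :
    Function.Injective (flatToPic Λ) := by
  rw [injective_iff_map_eq_one]
  intro χ hχ
  obtain ⟨ℓ, rfl⟩ := Quotient.exists_rep χ
  have hiso : CechCocycle.IsIso (ℓ.map (circleConst_le_hol Λ)) (CechCocycle.triv _) :=
    Quotient.exact hχ
  obtain ⟨f, hf⟩ := hiso
  set F : ℓ.ι → V ⧸ Λ → ℂ := fun a => f a PUnit.unit
  have hm : ∀ a x, x ∈ ℓ.U a → (holUnits Λ).mem (F a) x := fun a x ha => hf.mem_f a _ x ha trivial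
  have he : ∀ a b x, x ∈ ℓ.U a → x ∈ ℓ.U b → F a x = ℓ.g a b x * F b x := fun a b x ha hb =>
    (mul_one _).symm.trans (hf.comm a b PUnit.unit PUnit.unit x ha hb trivial trivial)
  obtain ⟨N, hN⟩ := exists_glue ℓ.cover (fun a x => ‖F a x‖) fun a b x ha hb => by
    rw [he a b x ha hb, norm_mul, (ℓ.mem_g a b x ha hb).1, one_mul]
  have hNe : ∀ a v, proj Λ v ∈ ℓ.U a → (fun w => N (proj Λ w)) =ᶠ[𝓝 v]
      fun w => ‖F a (proj Λ w)‖ := fun a v ha =>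
    eventuallyEq_comp_proj (g := fun x => ‖F a x‖) (ℓ.isOpen_U a) (hN a) ha
  have hNc : Continuous fun v => N (proj Λ v) := by
    refine continuous_iff_continuousAt.mpr fun v => ?_
    obtain ⟨a, ha⟩ := ℓ.cover (proj Λ v)
    exact ((hm a _ ha).2.2 v rfl).continuousAt.norm.congr (hNe a v ha).symm
  obtain ⟨v₀, hmax⟩ : ∃ v₀, ∀ v, N (proj Λ v) ≤ N (proj Λ v₀) := by
    have hcomp := IsZLattice.isCompact_range_of_periodic Λ _ hNc
      fun z w hw => by simp only [proj_add_of_mem z hw]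
    obtain ⟨_, ⟨v₀, rfl⟩, h⟩ := hcomp.exists_isGreatest (Set.range_nonempty _)
    exact ⟨v₀, fun v => h ⟨v, rfl⟩⟩
  have hd : ∀ a v, proj Λ v ∈ ℓ.U a → ∀ᶠ w in 𝓝 v,
      DifferentiableAt ℂ (fun w => F a (proj Λ w)) w := fun a v ha => by
    filter_upwards [eventually_proj_mem (ℓ.isOpen_U a) ha] with w hw using (hm a _ hw).2.2 w rfl
  have hloc : ∀ a v, proj Λ v ∈ ℓ.U a → N (proj Λ v) = N (proj Λ v₀) →
      IsLocalMax (norm ∘ fun w => F a (proj Λ w)) v := by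
    intro a v ha hv
    filter_upwards [eventually_proj_mem (ℓ.isOpen_U a) ha] with w hw
    have h1 := hmax w
    rw [← hv, hN a _ hw, hN a _ ha] at h1
    exact h1
  -- The set where the maximum is attained is closed, open by the maximum modulus principle, and
  -- non-empty in the connected space `V`.
  have hall : ∀ v, N (proj Λ v) = N (proj Λ v₀) := by
    have hclopen : IsClopen {v | N (proj Λ v) = N (proj Λ v₀)} := by
      refine ⟨isClosed_eq hNc continuous_const, isOpen_iff_mem_nhds.mpr fun v hv => ?_⟩
      obtain ⟨a, ha⟩ := ℓ.cover (proj Λ v)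
      filter_upwards [Complex.norm_eventually_eq_of_isLocalMax (hd a v ha) (hloc a v ha hv),
        hNe a v ha] with w h1 h2
      exact h2.trans (h1.trans ((hN a _ ha).symm.trans hv))
    have := hclopen.eq_univ ⟨v₀, rfl⟩
    exact fun v => (this ▸ Set.mem_univ v : v ∈ {v | N (proj Λ v) = N (proj Λ v₀)})
  refine Quotient.sound ⟨fun a _ x => F a x / ‖F a x‖, fun a _ x ha _ => ⟨?_, ?_⟩,
    fun a a' _ _ x ha ha' _ _ => ?_⟩
  · rw [norm_div, Complex.norm_real, norm_norm]
    exact div_self (norm_ne_zero_iff.mpr (hm a x ha).1)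
  · obtain ⟨v, rfl⟩ := proj_surjective x
    refine eventually_of_eventually_proj ?_
    filter_upwards [Complex.eventually_eq_of_isLocalMax_norm (hd a v ha)
      (hloc a v ha (hall v))] with w hw
    rw [hw]
  · change _ * 1 = _
    rw [mul_one, he a a' x ha ha', norm_mul, (ℓ.mem_g a a' x ha ha').1, one_mul, mul_div_assoc]

/-- The flat connection for which a trivializing section is parallel. -/
noncomputable def IsTrivialization.connection {c : LineBundle Λ} {t : c.ι → V ⧸ Λ → ℂ}
    (ht : IsTrivialization c t) : Connection c where
  A i x := -dlogForm (t i) x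
  smooth i x hx v hv := (SmoothAt.dlogForm (ht.mem i x hx).2 (ht.mem i x hx).1 v hv).neg
  transform i j v hi hj := by
    change _ = _ + dlog (fun w => c.g i j (proj Λ w)) v
    have e : (fun w => t i (proj Λ w)) =ᶠ[𝓝 v] fun w => c.g i j (proj Λ w) * t j (proj Λ w) := by
      filter_upwards [eventually_proj_mem (c.isOpen_U i) hi,
        eventually_proj_mem (c.isOpen_U j) hj] with w h1 h2 using ht.eq i j _ h1 h2
    rw [dlogForm_proj, dlogForm_proj, dlog_congr e,
      dlog_mul_of_mem (c.mem_g i j _ hi hj) (ht.mem j _ hj)]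
    abel

theorem IsTrivialization.hasCurvature_connection {c : LineBundle Λ} {t : c.ι → V ⧸ Λ → ℂ}
    (ht : IsTrivialization c t) : ht.connection.HasCurvature fun _ => 0 := by
  intro i v hi
  refine alternating_ext fun x y => ?_
  have e : (fun w => ht.connection.A i (proj Λ w)) =
      fun w => -dlog (fun w => t i (proj Λ w)) w := by
    ext1 w
    rw [← dlogForm_proj]
    rfl
  rw [dOne_apply (ht.connection.differentiableAt hi), e, fderiv_fun_neg]
  simp only [neg_apply, fderiv_dlog_symm ((ht.mem i _ hi).2 v rfl) (ht.mem i _ hi).1 x y, sub_self]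
  rfl

/-- A topologically trivial holomorphic line bundle has locally constant unitary transition
functions. -/
theorem exists_isIso_localSystem [FiniteDimensional ℂ V] [DiscreteTopology Λ] [IsZLattice ℝ Λ]
    {L : HolLineBundle Λ} {t : L.ι → V ⧸ Λ → ℂ} (ht : IsTrivialization (toComplex L) t) :
    ∃ r, CechCocycle.IsIso ((localSystem (Λ := Λ) r).map (circleConst_le_hol Λ)) L := by
  have hm : ∀ a x, x ∈ L.U a → (smoothUnits Λ).mem (t a) x := ht.mem
  have he : ∀ a b x, x ∈ L.U a → x ∈ L.U b → t a x = L.g a b x * t b x := ht.eq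
  obtain ⟨r, φ, hφ, hp, hr, h⟩ := exists_antiForm_add_eq_zero ht.hasCurvature_connection
    fun x v w => rfl
  -- The logarithmic derivative of `s` is minus the corrected connection form, so it is of type
  -- `(1,0)` and `s` is a holomorphic section on `V`. Its multiplier `exp (-r l)` is unitary because
  -- `r` is imaginary.
  set s : L.ι → V → ℂ := fun a v => t a (proj Λ v) * Complex.exp (φ v - r v) with hs
  have hsc : ∀ a v, proj Λ v ∈ L.U a → ContDiffAt ℝ ∞ (s a) v := fun a v ha =>
    ((hm a _ ha).2 v rfl).mul (hφ.sub r.contDiff).cexp.contDiffAt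
  have hs0 : ∀ a v, proj Λ v ∈ L.U a → s a v ≠ 0 := fun a v ha =>
    mul_ne_zero (hm a _ ha).1 (Complex.exp_ne_zero _)
  have hsd : ∀ a v, proj Λ v ∈ L.U a → DifferentiableAt ℂ (s a) v := by
    intro a v ha
    refine differentiableAt_of_antiForm_dlog ((hsc a v ha).differentiableAt (by simp))
      (hs0 a v ha) ?_
    have h1 : HasFDerivAt (fun v => φ v - r v) (fderiv ℝ φ v - r) v :=
      (hφ.differentiable (by simp) v).hasFDerivAt.sub r.hasFDerivAt
    have h2 := h a v ha
    have h3 : dlog (s a) v = -(ht.connection.A a (proj Λ v) + (r - fderiv ℝ φ v)) := by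
      rw [hs, dlog_mul (differentiableAt_of_mem (hm a _ ha)) h1.cexp.differentiableAt
        (hm a _ ha).1 (Complex.exp_ne_zero _), dlog_exp h1, ← dlogForm_proj]
      change _ = -(-dlogForm (t a) (proj Λ v) + _)
      abel
    rw [h3, map_neg, h2, neg_zero]
  have hsl : ∀ a v w, proj Λ v = proj Λ w →
      s a v = s a w * Complex.exp (r (w - v)) := by
    intro a v w hvw
    have h1 : φ v = φ w := eq_of_isPeriodic_of_proj_eq hp hvw
    rw [hs]
    simp only [hvw, h1, mul_assoc, ← Complex.exp_add, map_sub]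
    congr 2
    ring
  -- The section is read off through the local inverses; the inverse appears because the isomorphism
  -- goes from `L` to the local system.
  refine ⟨-(Complex.imCLM ∘L r), fun p a x => (s a (localInverse p x))⁻¹, ?_, ?_⟩
  · intro (p : V) a x hp ha
    have hinv := (localInverse_spec hp).2
    have e : ∀ v, proj Λ v = x → (fun w => (s a (localInverse p (proj Λ w)))⁻¹) =ᶠ[𝓝 v]
        fun w => (s a (w + (localInverse p x - v)))⁻¹ := by
      rintro v rfl
      filter_upwards [eventually_localInverse hp] with w hw
      rw [hw]
    have hmem : ∀ v, proj Λ (v + (localInverse p x - v)) ∈ L.U a := fun v => by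
      rwa [add_sub_cancel, hinv]
    refine ⟨inv_ne_zero (hs0 a _ (by rwa [hinv])), fun v hv => ?_, fun v hv => ?_⟩
    · have h1 := (hsc a _ (hmem v)).comp v (f := fun w => w + (localInverse p x - v))
        (contDiffAt_id.add contDiffAt_const)
      exact (h1.inv (hs0 a _ (hmem v))).congr_of_eventuallyEq (e v hv)
    · have h1 := (hsd a _ (hmem v)).comp v (f := fun w => w + (localInverse p x - v))
        (differentiableAt_id.add_const _)
      exact (h1.inv (hs0 a _ (hmem v))).congr_of_eventuallyEq (e v hv)
  · intro (p : V) (q : V) a b x hp hq ha hb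
    have hip := (localInverse_spec hp).2
    have hiq := (localInverse_spec hq).2
    have h1 : s a (localInverse p x) = L.g a b x * s b (localInverse p x) := by
      simp only [hs, hip, he a b x ha hb, mul_assoc]
    have h2 := hsl b _ _ (hip.trans hiq.symm)
    have h3 := hs0 b (localInverse q x) (by rwa [hiq])
    have h4 := (L.mem_g a b x ha hb).1
    change _ = Complex.exp _ * _
    have h5 : (((-(Complex.imCLM ∘L r)) (localInverse q x - localInverse p x) : ℝ) : ℂ) *
        Complex.I = -r (localInverse q x - localInverse p x) := by
      conv_rhs => rw [← Complex.re_add_im (r _), hr]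
      simp
      ring
    rw [h1, h2, h5, Complex.exp_neg]
    field_simp

theorem exists_H1Circle_equiv [FiniteDimensional ℂ V] [DiscreteTopology Λ] [IsZLattice ℝ Λ] :
    ∃ e : H1Circle Λ ≃* Pic0 Λ, ∀ χ, (e χ : Pic Λ) = flatToPic Λ χ := by
  refine ⟨MulEquiv.ofBijective ((flatToPic Λ).codRestrict (Pic0 Λ) flatToPic_mem_Pic0)
    ⟨fun χ χ' h => flatToPic_injective (congrArg Subtype.val h), ?_⟩, fun χ => rfl⟩
  rintro ⟨x, hx⟩
  obtain ⟨L, rfl⟩ := Quotient.exists_rep x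
  obtain ⟨t, ht⟩ := mk_mem_Pic0_iff.mp hx
  obtain ⟨r, hr⟩ := exists_isIso_localSystem ht
  exact ⟨CechH1.mk (localSystem r), Subtype.ext (Quotient.sound hr)⟩

end Picard

end ComplexTorus

/-! ### The main theorem. -/

theorem mainTheorem11 {V : Type u} [NormedAddCommGroup V] [NormedSpace ℂ V]
    [FiniteDimensional ℂ V] (Λ : Submodule ℤ V) [DiscreteTopology Λ] [IsZLattice ℝ Λ]
    (L : HolLineBundle Λ) (H : V →ₗ[ℂ] V →ₗ⋆[ℂ] ℂ) (hH : ∀ v w, H w v = conj (H v w))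
    (hL : HasChernClass (toComplex L) (fun v w => (H v w).im)) :
    (∃ e : H1Circle Λ ≃* Pic0 Λ, (∀ χ, (e χ : Pic Λ) = flatToPic Λ χ) ∧
      ∃ _ : Torsor (Pic0 Λ) (EFlatSpace (toComplex L) (fun v w => (H v w).im)),
        ∀ (ℓ : CechCocycle (circleConst Λ))
          (D D' : EFlatConnection (toComplex L) (fun v w => (H v w).im)),
          e (CechH1.mk ℓ) • EFlatSpace.mk D = EFlatSpace.mk D' ↔
            ((Connection.flat ℓ).tensor D.1).Isomorphic D'.1) ∧
    ∃ D : Connection (toComplex L),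
      (D.IsEFlat (fun v w => (H v w).im) ∧ D.IsUnitary ∧ D.IsHolCompatible) ∧
      ∀ D' : Connection (toComplex L),
        D'.IsEFlat (fun v w => (H v w).im) ∧ D'.IsUnitary ∧ D'.IsHolCompatible →
          ∀ i, Set.EqOn (D'.A i) (D.A i) (L.U i) := by
  refine ⟨?_, ?_⟩
  · obtain ⟨e, he⟩ := exists_H1Circle_equiv (Λ := Λ)
    obtain ⟨T, hT⟩ := exists_torsor_H1Circle hL e
    exact ⟨e, he, T, fun ℓ D D' => (hT ℓ D D').trans (isShift_iff_isomorphic ℓ D.1 D'.1).symm⟩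
  · obtain ⟨D₀, F, hF, hu, hinv, hval⟩ := exists_unitary_connection hL
    -- `H (i v) (i w) = H v w` since `i * conj i = 1`, so the curvature `-2πi Im H` is of type
    -- `(1,1)`.
    obtain ⟨D, hDF, hDu, hDh⟩ := exists_isHolCompatible hF hu fun x v w => by
      rw [hval, hval]
      simp [← mul_assoc]
    have hD : D.IsEFlat fun v w => (H v w).im := ⟨hL, F, hDF, hinv⟩
    exact ⟨D, ⟨hD, hDu, hDh⟩, fun D' h i =>
      eqOn_of_isHolCompatible hD h.1 hDu h.2.1 hDh h.2.2 i⟩
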